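/- Let $1/2<H<1$, $1-H<\alpha<1/2$ and $T>0$. Let $W^{\alpha,\infty}[0,1]$ be the space of measurable $f:[0,1]\to\mathbb{R}$ with $$\|f\|_{\alpha,\infty}:=\sup_{\xi\in[0,1]}\Big(|f(\xi)|+\int_0^\xi\frac{|f(\xi)-f(\eta)|}{(\xi-\eta)^{\alpha+1}}\,d\eta\Big)<\infty ,$$ let $C([0,T],W^{\alpha,\infty}[0,1])$ denote the space of measurable $f:[0,T]\times[0,1]\to\mathbb{R}$ with $\sup_{t\in[0,T]}\|f(t,\cdot)\|_{\alpha,\infty}<\infty$, and let $C([0,T],W_0^{1-\alpha,\infty}[0,1])$ denote the space of measurable $f:[0,T]\times[0,1]\to\mathbb{R}$ with $$\sup_{t\in[0,T]}\ \sup_{0<\eta<\xi<1}\Big(\frac{|f(t,\xi)-f(t,\eta)|}{(\xi-\eta)^{1-\alpha}}+\int_\eta^\xi\frac{|f(t,\gamma)-f(t,\eta)|}{(\gamma-\eta)^{2-\alpha}}\,d\gamma\Big)<\infty .$$ For $a<b$ write $f_{a+}=(f-f(a+))1_{(a,b)}$, $g_{b-}=(g-g(b-))1_{(a,b)}$, and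 for $a<x<b$ and $0<\beta<1$ $$D^{\beta}_{a+}f(x)=\frac1{\Gamma(1-\beta)}\Big(\frac{f(x)}{(x-a)^\beta}+\beta\int_a^x\frac{f(x)-f(y)}{(x-y)^{\beta+1}}dy\Big),\qquad D^{\beta}_{b-}g(x)=\frac{(-1)^{\beta}}{\Gamma(1-\beta)}\Big(\frac{g(x)}{(b-x)^\beta}+\beta\int_x^b\frac{g(x)-g(y)}{(y-x)^{\beta+1}}dy\Big),$$ where $(-1)^\beta=e^{i\pi\beta}$. The generalized Stieltjes integral is $$\int_a^b f\,dg=(-1)^\alpha\int_a^b D^\alpha_{a+}f_{a+}(x)\,D^{1-\alpha}_{b-}g_{b-}(x)\,dx+f(a+)\,[g(b-)-g(a+)],$$ defined when the one-sided limits $f(a+),g(a+),g(b-)$ exist and, for some $p,q\ge1$ with $\frac1p+\frac1q\le1$, $f_{a+}$ and $g_{b-}$ are the Riemann--Liouville fractional integrals $I^{\alpha}_{a+}$ and $I^{1-\alpha}_{b-}$ of functions in $L^p(a,b)$ and $L^q(a,b)$ respectively (the integrals above being convergent); for $a=b$ it is $0$. Let $g\in C([0,T],W_0^{1-\alpha,\infty}[0,1])$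 and $\phi\in W^{\alpha,\infty}[0,1]$, and let $A:\mathbb{R}\to\mathbb{R}$ satisfy: (A1) $A$ is differentiable; (A2) there is $M_1>0$ with $|A(x)-A(y)|\le M_1|x-y|$ for all $x,y\in\mathbb{R}$; (A3) there is $M_2>0$ with $|A(x)|\le M_2$ for all $x\in\mathbb{R}$; (A4) for every $N$ there is $M_N>0$ with $|A'(x)-A'(y)|\le M_N|x-y|$ whenever $|x|,|y|\le N$. Then there exists a unique $Y\in C([0,T],W^{\alpha,\infty}[0,1])$ such that, for all $t\in[0,T]$ and $\xi\in[0,1]$, $$Y(t,\xi)=\phi(\xi)+\int_0^t\int_0^\xi A(Y(s,\eta))\,dg(s,\eta)\,ds ,$$ where, for each $s\in[0,T]$, the inner integral is the generalized Stieltjes integral of $A(Y(s,\cdot))$ with respect to $g(s,\cdot)$ over $(0,\xi)$, and all the integrals are well defined. -/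

import Mathlib

open MeasureTheory Set Filter
open scoped Topology ENNReal

noncomputable section

namespace FracVortex

/-- The norm `‖f‖_{α,∞} = sup_{ξ ∈ [0,1]} (|f ξ| + ∫_0^ξ |f ξ - f η| / (ξ - η)^(α+1) dη)`,
with values in `[0, ∞]`. -/
def normW (α : ℝ) (f : ℝ → ℝ) : ℝ≥0∞ :=
  ⨆ ξ ∈ Icc (0 : ℝ) 1, (ENNReal.ofReal |f ξ| +
    ∫⁻ η in Ioo 0 ξ, ENNReal.ofReal (|f ξ - f η| / (ξ - η) ^ (α + 1)))

/-- The norm `‖f‖_{1-α,∞,0} = sup_{0<η<ξ<1} (|f ξ - f η| / (ξ - η)^(1-α)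
+ ∫_η^ξ |f γ - f η| / (γ - η)^(2-α) dγ)`, with values in `[0, ∞]`. -/
def normW0 (α : ℝ) (f : ℝ → ℝ) : ℝ≥0∞ :=
  ⨆ (ξ : ℝ) (η : ℝ) (_ : 0 < η ∧ η < ξ ∧ ξ < 1),
    (ENNReal.ofReal (|f ξ - f η| / (ξ - η) ^ (1 - α)) +
      ∫⁻ γ in Ioo η ξ, ENNReal.ofReal (|f γ - f η| / (γ - η) ^ (2 - α)))

/-- The space `W^{α,∞}[0,1]`. Functions on `[0,1]` are represented by functions on `ℝ`, of which
only the values on `[0,1]` matter. -/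
def MemW (α : ℝ) (f : ℝ → ℝ) : Prop :=
  Measurable ((Icc (0 : ℝ) 1).domRestrict f) ∧ normW α f < ∞

/-- The space `C([0,T], W^{α,∞}[0,1])`: measurable functions on `[0,T] × [0,1]` with
`sup_{t ∈ [0,T]} ‖f(t,·)‖_{α,∞} < ∞`. -/
def MemCW (α T : ℝ) (f : ℝ → ℝ → ℝ) : Prop :=
  Measurable ((Icc 0 T ×ˢ Icc (0 : ℝ) 1).domRestrict (fun p : ℝ × ℝ => f p.1 p.2)) ∧
    (⨆ t ∈ Icc 0 T, normW α (f t)) < ∞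

/-- The space `C([0,T], W_0^{1-α,∞}[0,1])`: measurable functions on `[0,T] × [0,1]` with
`sup_{t ∈ [0,T]} ‖f(t,·)‖_{1-α,∞,0} < ∞`. -/
def MemCW0 (α T : ℝ) (f : ℝ → ℝ → ℝ) : Prop :=
  Measurable ((Icc 0 T ×ˢ Icc (0 : ℝ) 1).domRestrict (fun p : ℝ × ℝ => f p.1 p.2)) ∧
    (⨆ t ∈ Icc 0 T, normW0 α (f t)) < ∞

/-- Left-sided Riemann–Liouville fractional integral `I^β_{a+} h`. -/
def fracIntLeft (β a : ℝ) (h : ℝ → ℝ) (x : ℝ) : ℝ :=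
  (Real.Gamma β)⁻¹ * ∫ y in Ioo a x, h y / (x - y) ^ (1 - β)

/-- Right-sided Riemann–Liouville fractional integral `I^β_{b-} h`, without the unimodular
factor `(-1)^(-β)` (which does not change the image space). -/
def fracIntRight (β b : ℝ) (h : ℝ → ℝ) (x : ℝ) : ℝ :=
  (Real.Gamma β)⁻¹ * ∫ y in Ioo x b, h y / (y - x) ^ (1 - β)

/-- `f ∈ I^β_{a+}(L^p(a,b))`. -/
def MemFracLeft (β : ℝ) (p : ℝ≥0∞) (a b : ℝ) (f : ℝ → ℝ) : Prop :=
  ∃ h : ℝ → ℝ, MemLp h p (volume.restrict (Ioo a b)) ∧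
    ∀ᵐ x ∂(volume.restrict (Ioo a b)), f x = fracIntLeft β a h x

/-- `f ∈ I^β_{b-}(L^q(a,b))`. -/
def MemFracRight (β : ℝ) (q : ℝ≥0∞) (a b : ℝ) (f : ℝ → ℝ) : Prop :=
  ∃ h : ℝ → ℝ, MemLp h q (volume.restrict (Ioo a b)) ∧
    ∀ᵐ x ∂(volume.restrict (Ioo a b)), f x = fracIntRight β b h x

/-- Left Weyl derivative `D^β_{a+} f` on `(a,b)`. -/
def weylLeft (β a b : ℝ) (f : ℝ → ℝ) : ℝ → ℝ :=
  (Ioo a b).indicator fun x => (Real.Gamma (1 - β))⁻¹ *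
    (f x / (x - a) ^ β + β * ∫ y in Ioo a x, (f x - f y) / (x - y) ^ (β + 1))

/-- Right Weyl derivative `D^β_{b-} f` on `(a,b)`, without the unimodular factor `(-1)^β`. -/
def weylRight (β a b : ℝ) (f : ℝ → ℝ) : ℝ → ℝ :=
  (Ioo a b).indicator fun x => (Real.Gamma (1 - β))⁻¹ *
    (f x / (b - x) ^ β + β * ∫ y in Ioo x b, (f x - f y) / (y - x) ^ (β + 1))

/-- `f_{a+} = (f - f(a+)) 1_{(a,b)}`. -/
def leftCentered (a b : ℝ) (f : ℝ → ℝ) : ℝ → ℝ :=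
  (Ioo a b).indicator fun x => f x - Function.rightLim f a

/-- `g_{b-} = (g - g(b-)) 1_{(a,b)}`. -/
def rightCentered (a b : ℝ) (g : ℝ → ℝ) : ℝ → ℝ :=
  (Ioo a b).indicator fun x => g x - Function.leftLim g b

/-- The conditions under which the generalized Stieltjes integral `∫_a^b f dg` (`a < b`) of
order `α` is defined, together with the convergence of all the integrals in its definition. -/
structure StieltjesIntegrable (α : ℝ) (f g : ℝ → ℝ) (a b : ℝ) : Prop where
  f_right : ∃ l : ℝ, Tendsto f (𝓝[>] a) (𝓝 l)
  g_right : ∃ l : ℝ, Tendsto g (𝓝[>] a) (𝓝 l)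
  g_left : ∃ l : ℝ, Tendsto g (𝓝[<] b) (𝓝 l)
  mem_frac : ∃ p q : ℝ≥0∞, 1 ≤ p ∧ 1 ≤ q ∧ p⁻¹ + q⁻¹ ≤ 1 ∧
    MemFracLeft α p a b (leftCentered a b f) ∧
    MemFracRight (1 - α) q a b (rightCentered a b g)
  kernel_left : ∀ᵐ x ∂(volume.restrict (Ioo a b)),
    IntegrableOn (fun y => (f x - f y) / (x - y) ^ (α + 1)) (Ioo a x)
  kernel_right : ∀ᵐ x ∂(volume.restrict (Ioo a b)),
    IntegrableOn (fun y => (g x - g y) / (y - x) ^ (1 - α + 1)) (Ioo x b)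
  product : IntegrableOn (fun x => weylLeft α a b (leftCentered a b f) x *
    weylRight (1 - α) a b (rightCentered a b g) x) (Ioo a b)

/-- The generalized Stieltjes integral
`∫_a^b f dg = (-1)^α ∫_a^b D^α_{a+} f_{a+} D^{1-α}_{b-} g_{b-} dx + f(a+) (g(b-) - g(a+))`
for `a < b`, and `0` on a degenerate interval. The sign is `(-1)^α (-1)^(1-α) = -1`, the second
factor being the one left out of `weylRight`. -/
def stieltjes (α : ℝ) (f g : ℝ → ℝ) (a b : ℝ) : ℝ :=
  if a < b then
    -(∫ x in Ioo a b, weylLeft α a b (leftCentered a b f) x *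
        weylRight (1 - α) a b (rightCentered a b g) x) +
      Function.rightLim f a * (Function.leftLim g b - Function.rightLim g a)
  else 0

/-- `Y` solves `Y(t,ξ) = φ(ξ) + ∫_0^t ∫_0^ξ A(Y(s,η)) dg(s,η) ds` on `[0,T] × [0,1]`, all
integrals being well defined. -/
structure IsSolution (α T : ℝ) (A : ℝ → ℝ) (g : ℝ → ℝ → ℝ) (φ : ℝ → ℝ) (Y : ℝ → ℝ → ℝ) :
    Prop where
  inner : ∀ s ∈ Icc 0 T, ∀ ξ ∈ Ioc (0 : ℝ) 1,
    StieltjesIntegrable α (fun η => A (Y s η)) (g s) 0 ξ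
  outer : ∀ ξ ∈ Icc (0 : ℝ) 1,
    IntegrableOn (fun s => stieltjes α (fun η => A (Y s η)) (g s) 0 ξ) (Icc 0 T)
  eqn : ∀ t ∈ Icc 0 T, ∀ ξ ∈ Icc (0 : ℝ) 1,
    Y t ξ = φ ξ + ∫ s in (0 : ℝ)..t, stieltjes α (fun η => A (Y s η)) (g s) 0 ξ

end FracVortex

end

noncomputable section

namespace FracVortex

/-! ### Integrals of powers -/

/-! The time integral is an ordinary Lebesgue integral, so the equation is an ODE in `t` for
functions of `ξ`, and Picard iteration solves it once the spatial Stieltjes integral is controlled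
in `W^{α,∞}`.

The control comes from a gain of regularity. If `f` has `W^{α,∞}` bound `K` and `g` has
`W_0^{1-α,∞}` bound `Λ`, then `ξ ↦ ∫_0^ξ f dg` vanishes at `0` and is `(1-α)`-Hölder with constant
`C Λ K` (`abs_stieltjesReg_sub_le`). Because `α < 1/2`, such functions embed into `W^{α,∞}`
(`HolderBd.wBound`).

The integral must also exist. A `W^{α,∞}` bound forces a limit at `0+` with an error `O(x^α)`
(`WBound.abs_sub_le`), so the Weyl derivatives of the centered `f` and `g` are bounded. A function
with bounded Weyl derivative is the fractional integral of that derivative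
(`eq_fracIntLeft_weylDer`), so `p = q = ∞` is admissible.

The nonlinearity enters in two ways. Since `A` is bounded and Lipschitz, `f ↦ A ∘ f` grows at most
affinely in the norm (`LeftReg.comp`), and a Gronwall argument bounds all Picard iterates at once
(`picardStep_growth`). Since `A'` is locally Lipschitz, `f ↦ A ∘ f` is Lipschitz on norm-bounded
sets (`WBound.comp_sub`), so successive differences are `O((L t)^n / n!)`. This gives convergence to
a solution, and the same estimate gives uniqueness.

Values at the endpoints do not affect the Stieltjes integral beyond one-sided limits. Hence `Y`, `φ`
and `g` are first redefined there by their limits, the problem is solved for these regularized data,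
and the value at `ξ = 0` is restored at the end. -/

theorem integral_Ioo_comp_sub_left (F : ℝ → ℝ) {a b : ℝ} (hab : a ≤ b) (c : ℝ) :
    ∫ y in Ioo a b, F (c - y) = ∫ y in Ioo (c - b) (c - a), F y := by
  rw [← integral_Ioc_eq_integral_Ioo, ← integral_Ioc_eq_integral_Ioo,
    ← intervalIntegral.integral_of_le hab, ← intervalIntegral.integral_of_le (by linarith)]
  exact intervalIntegral.integral_comp_sub_left F c

theorem integrableOn_Ioo_comp_sub_left {F : ℝ → ℝ} {a b : ℝ} (hab : a ≤ b) {c : ℝ}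
    (h : IntegrableOn F (Ioo (c - b) (c - a))) :
    IntegrableOn (fun y => F (c - y)) (Ioo a b) := by
  rw [← integrableOn_Ioc_iff_integrableOn_Ioo,
    ← intervalIntegrable_iff_integrableOn_Ioc_of_le hab]
  rw [← integrableOn_Ioc_iff_integrableOn_Ioo,
    ← intervalIntegrable_iff_integrableOn_Ioc_of_le (by linarith)] at h
  simpa using (h.comp_sub_left c).symm

theorem integrableOn_rpow {p : ℝ} (hp : -1 < p) (x : ℝ) :
    IntegrableOn (fun y : ℝ => y ^ p) (Ioo 0 x) := by
  rcases le_or_gt x 0 with hx | hx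
  · simp [Ioo_eq_empty (not_lt.2 hx)]
  · exact (intervalIntegral.integrableOn_Ioo_rpow_iff hx).2 hp

theorem integral_Ioo_rpow {p : ℝ} (hp : -1 < p) {x : ℝ} (hx : 0 ≤ x) :
    ∫ y in Ioo 0 x, y ^ p = x ^ (p + 1) / (p + 1) := by
  rw [← integral_Ioc_eq_integral_Ioo, ← intervalIntegral.integral_of_le hx,
    integral_rpow (Or.inl hp), Real.zero_rpow (by linarith), sub_zero]

theorem integrableOn_sub_rpow {p : ℝ} (hp : -1 < p) {a x : ℝ} (hax : a ≤ x) :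
    IntegrableOn (fun y : ℝ => (x - y) ^ p) (Ioo a x) :=
  integrableOn_Ioo_comp_sub_left (F := fun y => y ^ p) hax
    (by simpa using integrableOn_rpow hp (x - a))

theorem integral_sub_rpow {p : ℝ} (hp : -1 < p) {a x : ℝ} (hax : a ≤ x) :
    ∫ y in Ioo a x, (x - y) ^ p = (x - a) ^ (p + 1) / (p + 1) := by
  rw [integral_Ioo_comp_sub_left (fun y => y ^ p) hax x]
  simpa using integral_Ioo_rpow hp (sub_nonneg.2 hax)

theorem integral_one_div_sub_rpow {β : ℝ} (hβ : 0 < β) {a b x : ℝ} (hab : a ≤ b) (hx : x < a) :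
    ∫ y in Ioo a b, 1 / (y - x) ^ (β + 1) = ((a - x) ^ (-β) - (b - x) ^ (-β)) / β := by
  rw [← integral_Ioc_eq_integral_Ioo, ← intervalIntegral.integral_of_le hab,
    intervalIntegral.integral_comp_sub_right (fun y => 1 / y ^ (β + 1)) x,
    intervalIntegral.integral_congr (g := fun y => y ^ (-(β + 1))), integral_rpow]
  · have : -(β + 1) + 1 = -β := by ring
    rw [this]
    field_simp
    ring
  · right
    refine ⟨by linarith, ?_⟩
    rw [uIcc_of_le (by linarith)]
    exact fun h => by linarith [h.1]
  · intro y hy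
    rw [uIcc_of_le (by linarith)] at hy
    have : 0 ≤ y := by linarith [hy.1]
    simp only [Real.rpow_neg this, one_div]

theorem integrableOn_one_div_sub_rpow {a b x : ℝ} (hx : x < a) (p : ℝ) :
    IntegrableOn (fun y => 1 / (y - x) ^ p) (Ioo a b) := by
  refine ContinuousOn.integrableOn_Icc ?_ |>.mono_set Ioo_subset_Icc_self
  intro y hy
  have h0 : 0 < y - x := by linarith [hy.1]
  refine ContinuousAt.continuousWithinAt ?_
  refine ContinuousAt.div continuousAt_const ?_ (Real.rpow_pos_of_pos h0 _).ne'
  exact ContinuousAt.rpow_const (by fun_prop) (Or.inl h0.ne')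

theorem integral_one_div_rsub_rpow {β : ℝ} (hβ : 0 < β) {a b x : ℝ} (hab : a ≤ b) (hx : b < x) :
    ∫ y in Ioo a b, 1 / (x - y) ^ (β + 1) = ((x - b) ^ (-β) - (x - a) ^ (-β)) / β := by
  rw [integral_Ioo_comp_sub_left (fun y => 1 / y ^ (β + 1)) hab x]
  simpa using integral_one_div_sub_rpow hβ (x := 0) (a := x - b) (b := x - a)
    (by linarith) (by linarith)

/-- The reflection `y = x - t` turns this into the scaled complex beta integral; the real identity
is its real part. -/
theorem integral_beta_kernel {p q : ℝ} (hp : 0 < p) (hq : 0 < q) {s x : ℝ} (hsx : s < x) :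
    ∫ t in Ioo s x, (x - t) ^ (p - 1) * (t - s) ^ (q - 1) =
      ProbabilityTheory.beta p q * (x - s) ^ (p + q - 1) := by
  have h1 : ∫ t in Ioo s x, (x - t) ^ (p - 1) * (t - s) ^ (q - 1) =
      ∫ y in (0 : ℝ)..(x - s), y ^ (p - 1) * ((x - s) - y) ^ (q - 1) := by
    rw [intervalIntegral.integral_of_le (by linarith), integral_Ioc_eq_integral_Ioo]
    have := integral_Ioo_comp_sub_left (fun y => y ^ (p - 1) * ((x - s) - y) ^ (q - 1)) hsx.le x
    rw [sub_self] at this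
    rw [← this]
    congr 1
    ext t
    congr 2
    ring
  have h2 := Complex.betaIntegral_scaled (p : ℂ) (q : ℂ) (sub_pos.2 hsx)
  have h3 : (∫ y in (0 : ℝ)..(x - s), (y : ℂ) ^ ((p : ℂ) - 1) *
      (((x - s : ℝ) : ℂ) - y) ^ ((q : ℂ) - 1)) =
      ((∫ y in (0 : ℝ)..(x - s), y ^ (p - 1) * ((x - s) - y) ^ (q - 1) : ℝ) : ℂ) := by
    rw [← intervalIntegral.integral_ofReal]
    refine intervalIntegral.integral_congr fun y hy => ?_
    rw [uIcc_of_le (by linarith)] at hy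
    rw [Complex.ofReal_mul, Complex.ofReal_cpow hy.1, Complex.ofReal_cpow (sub_nonneg.2 hy.2)]
    push_cast
    rfl
  rw [h1, ProbabilityTheory.beta_eq_betaIntegralReal p q hp hq]
  rw [h3] at h2
  have h4 : ((x - s : ℝ) : ℂ) ^ ((p : ℂ) + q - 1) = (((x - s) ^ (p + q - 1) : ℝ) : ℂ) := by
    rw [Complex.ofReal_cpow (by linarith)]
    push_cast
    rfl
  rw [h4] at h2
  have := congrArg Complex.re h2
  rw [Complex.ofReal_re, Complex.re_ofReal_mul] at this
  rw [this, mul_comm]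

/-- A non-integrable function has integral `0` by convention, which contradicts the positive value
just computed. -/
theorem integrableOn_beta_kernel {p q : ℝ} (hp : 0 < p) (hq : 0 < q) {s x : ℝ} (hsx : s < x) :
    IntegrableOn (fun t => (x - t) ^ (p - 1) * (t - s) ^ (q - 1)) (Ioo s x) := by
  by_contra h
  have h1 := integral_beta_kernel hp hq hsx
  rw [integral_undef h] at h1
  have := ProbabilityTheory.beta_pos hp hq
  have h2 : 0 < (x - s) ^ (p + q - 1) := Real.rpow_pos_of_pos (by linarith) _
  exact absurd h1 (by positivity)

/-! ### Abel integrals -/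

/-- The Riemann–Liouville integral of order `p` based at `0`, without the factor `1 / Γ(p)`. -/
def abelInt (p : ℝ) (h : ℝ → ℝ) (x : ℝ) : ℝ :=
  ∫ y in Ioo 0 x, (x - y) ^ (p - 1) * h y

theorem IntegrableOn.mul_of_abs_le {k h : ℝ → ℝ} {s : Set ℝ} {M : ℝ} (hs : MeasurableSet s)
    (hk : IntegrableOn k s) (hh : Measurable h) (hM : ∀ y ∈ s, |h y| ≤ M) :
    IntegrableOn (fun y => k y * h y) s :=
  Integrable.mul_bdd (c := M) hk hh.aestronglyMeasurable
    ((ae_restrict_iff' hs).2 (Eventually.of_forall fun y hy => by simpa using hM y hy))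

theorem integrableOn_abelInt_kernel {p M x : ℝ} (hp : 0 < p) {h : ℝ → ℝ}
    (hh : Measurable h) (hM : ∀ y ∈ Ioo 0 x, |h y| ≤ M) :
    IntegrableOn (fun y => (x - y) ^ (p - 1) * h y) (Ioo 0 x) := by
  rcases le_or_gt x 0 with hx | hx
  · simp [Ioo_eq_empty (not_lt.2 hx)]
  · exact IntegrableOn.mul_of_abs_le measurableSet_Ioo
      (integrableOn_sub_rpow (by linarith) hx.le) hh hM

theorem setIntegral_Ioo_eq_ite {F : ℝ → ℝ} {t x : ℝ} (htx : t ≤ x) :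
    ∫ s in Ioo 0 x, (if s < t then F s else 0) = ∫ s in Ioo 0 t, F s := by
  have : (fun s => if s < t then F s else 0) = (Iio t).indicator F := by
    ext s
    simp [indicator]
  rw [this, setIntegral_indicator measurableSet_Iio]
  congr 2
  ext s
  simp only [mem_inter_iff, mem_Ioo, mem_Iio]
  constructor
  · rintro ⟨⟨h1, -⟩, h2⟩
    exact ⟨h1, h2⟩
  · rintro ⟨h1, h2⟩
    exact ⟨⟨h1, by linarith⟩, h2⟩

theorem setIntegral_Ioo_eq_ite' {F : ℝ → ℝ} {s x : ℝ} (hs : 0 ≤ s) :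
    ∫ t in Ioo 0 x, (if s < t then F t else 0) = ∫ t in Ioo s x, F t := by
  have : (fun t => if s < t then F t else 0) = (Ioi s).indicator F := by
    ext t
    simp [indicator]
  rw [this, setIntegral_indicator measurableSet_Ioi]
  congr 2
  ext t
  simp only [mem_inter_iff, mem_Ioo, mem_Ioi]
  constructor
  · rintro ⟨⟨-, h1⟩, h2⟩
    exact ⟨h2, h1⟩
  · rintro ⟨h1, h2⟩
    exact ⟨⟨by linarith, h2⟩, h1⟩

theorem integrableOn_Ioo_ite {F : ℝ → ℝ} {s x : ℝ} (h : IntegrableOn F (Ioo s x)) :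
    IntegrableOn (fun t => if s < t then F t else 0) (Ioo 0 x) := by
  have : (fun t => if s < t then F t else 0) = (Ioi s).indicator F := by
    ext t
    simp [indicator]
  rw [this]
  rw [IntegrableOn, integrable_indicator_iff measurableSet_Ioi, IntegrableOn,
    Measure.restrict_restrict measurableSet_Ioi]
  exact IntegrableOn.mono_set h fun t ht => ⟨ht.1, ht.2.2⟩

/-- The semigroup law of fractional integration: Fubini on the triangle `s < t`, whose inner
integral is a beta kernel. The triangle is encoded by an `if` so that both variables range over
`(0,x)`. -/
theorem abelInt_abelInt {p q M x : ℝ} (hp : 0 < p) (hq : 0 < q) {h : ℝ → ℝ}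
    (hh : Measurable h) (hM : ∀ y ∈ Ioo 0 x, |h y| ≤ M) :
    abelInt p (abelInt q h) x = ProbabilityTheory.beta p q * abelInt (p + q) h x := by
  set μ := volume.restrict (Ioo (0 : ℝ) x) with hμ
  let F : ℝ → ℝ → ℝ := fun t s =>
    if s < t then ((x - t) ^ (p - 1) * (t - s) ^ (q - 1)) * h s else 0
  have hFm : Measurable (Function.uncurry F) := by
    refine Measurable.ite (measurableSet_lt measurable_snd measurable_fst) ?_ measurable_const
    fun_prop
  have hin : ∀ s ∈ Ioo 0 x, ∀ c : ℝ,
      IntegrableOn (fun t => ((x - t) ^ (p - 1) * (t - s) ^ (q - 1)) * c) (Ioo s x) ∧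
      ∫ t in Ioo s x, ((x - t) ^ (p - 1) * (t - s) ^ (q - 1)) * c =
        ProbabilityTheory.beta p q * ((x - s) ^ (p + q - 1) * c) := by
    intro s hs c
    refine ⟨(integrableOn_beta_kernel hp hq hs.2).mul_const c, ?_⟩
    rw [integral_mul_const, integral_beta_kernel hp hq hs.2]
    ring
  have hF : Integrable (Function.uncurry F) (μ.prod μ) := by
    rw [integrable_prod_iff' hFm.aestronglyMeasurable]
    constructor
    · refine (ae_restrict_iff' measurableSet_Ioo).2 (Eventually.of_forall fun s hs => ?_)
      exact integrableOn_Ioo_ite (hin s hs (h s)).1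
    · have : Integrable (fun s => ProbabilityTheory.beta p q * ((x - s) ^ (p + q - 1) * |h s|))
          μ := by
        refine Integrable.const_mul ?_ _
        exact integrableOn_abelInt_kernel (M := M) (add_pos hp hq) hh.abs
          (by simpa using hM)
      refine this.congr ?_
      refine (ae_restrict_iff' measurableSet_Ioo).2 (Eventually.of_forall fun s hs => ?_)
      simp only
      rw [← (hin s hs |h s|).2, ← setIntegral_Ioo_eq_ite' hs.1.le]
      refine setIntegral_congr_fun measurableSet_Ioo fun t ht => ?_
      simp only [Function.uncurry, F]
      split_ifs with hst
      · have h1 : 0 ≤ (x - t) ^ (p - 1) := Real.rpow_nonneg (by linarith [ht.2]) _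
        have h2 : 0 ≤ (t - s) ^ (q - 1) := Real.rpow_nonneg (by linarith) _
        rw [Real.norm_eq_abs, abs_mul, abs_of_nonneg (mul_nonneg h1 h2)]
      · simp
  have e1 : abelInt p (abelInt q h) x = ∫ t, ∫ s, F t s ∂μ ∂μ := by
    refine setIntegral_congr_fun measurableSet_Ioo fun t ht => ?_
    simp only [F, abelInt]
    rw [setIntegral_Ioo_eq_ite ht.2.le, ← integral_const_mul]
    simp only [mul_assoc]
  rw [e1, integral_integral_swap hF, abelInt, ← integral_const_mul]
  refine setIntegral_congr_fun measurableSet_Ioo fun s hs => ?_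
  simp only [F]
  rw [setIntegral_Ioo_eq_ite' hs.1.le]
  exact (hin s hs (h s)).2

theorem measurable_integral_Ioo {X : Type*} [MeasurableSpace X] {a b : X → ℝ} {F : X → ℝ → ℝ}
    (ha : Measurable a) (hb : Measurable b) (hF : Measurable (Function.uncurry F)) :
    Measurable fun x => ∫ y in Ioo (a x) (b x), F x y := by
  have : (fun x => ∫ y in Ioo (a x) (b x), F x y) =
      fun x => ∫ y, if a x < y ∧ y < b x then F x y else 0 := by
    ext x
    rw [← integral_indicator measurableSet_Ioo]
    simp only [indicator_apply, mem_Ioo]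
  rw [this]
  refine (StronglyMeasurable.integral_prod_right
    (f := fun x y => if a x < y ∧ y < b x then F x y else 0) ?_).measurable
  refine Measurable.stronglyMeasurable ?_
  refine Measurable.ite ?_ hF measurable_const
  exact (measurableSet_lt (ha.comp measurable_fst) measurable_snd).inter
    (measurableSet_lt measurable_snd (hb.comp measurable_fst))

theorem measurable_abelInt {p : ℝ} {h : ℝ → ℝ} (hh : Measurable h) :
    Measurable (abelInt p h) :=
  measurable_integral_Ioo (F := fun x y => (x - y) ^ (p - 1) * h y) measurable_const
    measurable_id (by fun_prop)

theorem abs_abelInt_le {p M x : ℝ} (hp : 0 < p) {h : ℝ → ℝ} (hx : 0 ≤ x)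
    (hM : ∀ y ∈ Ioo 0 x, |h y| ≤ M) : |abelInt p h x| ≤ M * (x ^ p / p) := by
  have h1 : IntegrableOn (fun y => (x - y) ^ (p - 1) * M) (Ioo 0 x) :=
    (integrableOn_sub_rpow (by linarith) hx).mul_const M
  have h2 := norm_integral_le_of_norm_le h1 (f := fun y => (x - y) ^ (p - 1) * h y)
    ((ae_restrict_iff' measurableSet_Ioo).2 (Eventually.of_forall fun y hy => by
      have : 0 ≤ (x - y) ^ (p - 1) := Real.rpow_nonneg (by linarith [hy.2]) _
      rw [Real.norm_eq_abs, abs_mul, abs_of_nonneg this]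
      exact mul_le_mul_of_nonneg_left (hM y hy) this))
  rw [integral_mul_const, integral_sub_rpow (by linarith) hx] at h2
  simp only [sub_zero, sub_add_cancel] at h2
  rw [mul_comm M]
  exact h2

/-! ### Inversion of the Weyl derivative -/

/-- Removes the regularization `ε = 1/(n+1)` from both boundary terms of
`integral_regularized_kernel`, with `w y = x - y` and `w y = y`. -/
theorem tendsto_integral_div_add_rpow {β M x : ℝ} (hβ : 0 < β) {f w : ℝ → ℝ}
    (hf : Measurable f) (hM : ∀ y ∈ Ioo 0 x, |f y| ≤ M) (hw : Measurable w)
    (hw0 : ∀ y ∈ Ioo 0 x, 0 < w y) (hwi : IntegrableOn (fun y => w y ^ (-β)) (Ioo 0 x)) :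
    Tendsto (fun n : ℕ => ∫ y in Ioo 0 x, (w y + 1 / ((n : ℝ) + 1)) ^ (-β) * f y) atTop
      (𝓝 (∫ y in Ioo 0 x, w y ^ (-β) * f y)) := by
  refine tendsto_integral_of_dominated_convergence (fun y => w y ^ (-β) * |f y|) ?_ ?_ ?_ ?_
  · intro n
    exact Measurable.aestronglyMeasurable (by fun_prop)
  · exact IntegrableOn.mul_of_abs_le measurableSet_Ioo hwi hf.abs (by simpa using hM)
  · intro n
    refine (ae_restrict_iff' measurableSet_Ioo).2 (Eventually.of_forall fun y hy => ?_)
    have h0 := hw0 y hy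
    have hn : (0 : ℝ) < 1 / ((n : ℝ) + 1) := by positivity
    rw [Real.norm_eq_abs, abs_mul, abs_of_nonneg (by positivity)]
    refine mul_le_mul_of_nonneg_right ?_ (abs_nonneg _)
    exact Real.rpow_le_rpow_of_nonpos h0 (by linarith) (by linarith)
  · refine (ae_restrict_iff' measurableSet_Ioo).2 (Eventually.of_forall fun y hy => ?_)
    have h0 := hw0 y hy
    refine Tendsto.mul_const _ ?_
    have h1 : Tendsto (fun n : ℕ => w y + 1 / ((n : ℝ) + 1)) atTop (𝓝 (w y + 0)) :=
      tendsto_const_nhds.add tendsto_one_div_add_atTop_nhds_zero_nat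
    rw [add_zero] at h1
    exact (Real.continuousAt_rpow_const _ _ (Or.inl h0.ne')).tendsto.comp h1

theorem ae_eq_of_forall_integral_Ioo_eq {h₁ h₂ : ℝ → ℝ} {b : ℝ} (hb : 0 ≤ b)
    (hi₁ : IntegrableOn h₁ (Ioo 0 b)) (hi₂ : IntegrableOn h₂ (Ioo 0 b))
    (h : ∀ x ∈ Ioo 0 b, ∫ y in Ioo 0 x, h₁ y = ∫ y in Ioo 0 x, h₂ y) :
    ∀ᵐ x ∂(volume.restrict (Ioo 0 b)), h₁ x = h₂ x := by
  rw [← integrableOn_Ioc_iff_integrableOn_Ioo,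
    ← intervalIntegrable_iff_integrableOn_Ioc_of_le hb] at hi₁ hi₂
  rw [ae_restrict_iff' measurableSet_Ioo]
  filter_upwards [hi₁.ae_hasDerivAt_integral, hi₂.ae_hasDerivAt_integral] with x hx₁ hx₂ hx
  have hx' : x ∈ uIcc 0 b := by
    rw [uIcc_of_le hb]
    exact Ioo_subset_Icc_self hx
  refine (hx₁ hx' 0 left_mem_uIcc).unique ((hx₂ hx' 0 left_mem_uIcc).congr_of_eventuallyEq ?_)
  filter_upwards [isOpen_Ioo.mem_nhds hx] with z hz
  rw [intervalIntegral.integral_of_le hz.1.le, intervalIntegral.integral_of_le hz.1.le,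
    integral_Ioc_eq_integral_Ioo, integral_Ioc_eq_integral_Ioo, h z hz]

theorem setLIntegral_Ioo_eq_ite {F : ℝ → ℝ≥0∞} {t x : ℝ} (htx : t ≤ x) :
    ∫⁻ s in Ioo 0 x, (if s < t then F s else 0) = ∫⁻ s in Ioo 0 t, F s := by
  have : (fun s => if s < t then F s else 0) = (Iio t).indicator F := by
    ext s
    simp [indicator]
  rw [this, setLIntegral_indicator measurableSet_Iio]
  congr 2
  ext s
  simp only [mem_inter_iff, mem_Ioo, mem_Iio]
  constructor
  · rintro ⟨h2, ⟨h1, -⟩⟩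
    exact ⟨h1, h2⟩
  · rintro ⟨h1, h2⟩
    exact ⟨h2, h1, by linarith⟩

theorem integrable_prod_restrict_of_abs_le {F : ℝ × ℝ → ℝ} (hF : Measurable F) {x C : ℝ}
    (hC : ∀ t ∈ Ioo 0 x, ∀ s ∈ Ioo 0 x, |F (t, s)| ≤ C) :
    Integrable F ((volume.restrict (Ioo 0 x)).prod (volume.restrict (Ioo 0 x))) := by
  refine Integrable.of_bound hF.aestronglyMeasurable C ?_
  rw [Measure.prod_restrict, ae_restrict_iff' (measurableSet_Ioo.prod measurableSet_Ioo)]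
  exact Eventually.of_forall fun z hz => hC z.1 hz.1 z.2 hz.2

/-- The shift by `ε` makes the `f t` and `f s` halves separately integrable. Integrating the first
in `s` and the second in `t` produces the same singular term `ε^(-β) ∫ f` twice; these cancel and
only the two boundary terms remain. -/
theorem integral_regularized_kernel {β M x ε : ℝ} (hβ : 0 < β) (hε : 0 < ε) {f : ℝ → ℝ}
    (hf : Measurable f) (hM : ∀ y ∈ Ioo 0 x, |f y| ≤ M) :
    β * ∫ z, (if z.2 < z.1 then (f z.1 - f z.2) / (z.1 - z.2 + ε) ^ (β + 1) else 0)
        ∂((volume.restrict (Ioo 0 x)).prod (volume.restrict (Ioo 0 x))) =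
      (∫ y in Ioo 0 x, (x - y + ε) ^ (-β) * f y) - ∫ y in Ioo 0 x, (y + ε) ^ (-β) * f y := by
  set μ := volume.restrict (Ioo (0 : ℝ) x) with hμ
  let P : ℝ → ℝ → ℝ := fun t s => if s < t then f t * (1 / (t - s + ε) ^ (β + 1)) else 0
  let Q : ℝ → ℝ → ℝ := fun t s => if s < t then f s * (1 / (t - s + ε) ^ (β + 1)) else 0
  have hPm : Measurable (Function.uncurry P) :=
    Measurable.ite (measurableSet_lt measurable_snd measurable_fst) (by fun_prop)
      measurable_const
  have hQm : Measurable (Function.uncurry Q) :=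
    Measurable.ite (measurableSet_lt measurable_snd measurable_fst) (by fun_prop)
      measurable_const
  have hk : ∀ t s, s < t → ∀ c, |c| ≤ M →
      |c * (1 / (t - s + ε) ^ (β + 1))| ≤ M * (1 / ε ^ (β + 1)) := by
    intro t s hst c hc
    have h0 : 0 < ε ^ (β + 1) := Real.rpow_pos_of_pos hε _
    have h1 : ε ^ (β + 1) ≤ (t - s + ε) ^ (β + 1) :=
      Real.rpow_le_rpow hε.le (by linarith) (by linarith)
    rw [abs_mul, abs_of_nonneg (one_div_nonneg.2 (h0.le.trans h1))]
    exact mul_le_mul hc (one_div_le_one_div_of_le h0 h1)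
      (one_div_nonneg.2 (h0.le.trans h1)) ((abs_nonneg _).trans hc)
  have hb0 : ∀ y ∈ Ioo 0 x, 0 ≤ M * (1 / ε ^ (β + 1)) := fun y hy =>
    mul_nonneg ((abs_nonneg _).trans (hM y hy)) (by positivity)
  have hP : Integrable (Function.uncurry P) (μ.prod μ) := by
    refine integrable_prod_restrict_of_abs_le hPm (C := M * (1 / ε ^ (β + 1))) fun t ht s hs => ?_
    simp only [Function.uncurry, P]
    split_ifs with h
    · exact hk t s h _ (hM t ht)
    · simpa using hb0 t ht
  have hQ : Integrable (Function.uncurry Q) (μ.prod μ) := by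
    refine integrable_prod_restrict_of_abs_le hQm (C := M * (1 / ε ^ (β + 1))) fun t ht s hs => ?_
    simp only [Function.uncurry, Q]
    split_ifs with h
    · exact hk t s h _ (hM s hs)
    · simpa using hb0 t ht
  have hsub : (fun z : ℝ × ℝ =>
      if z.2 < z.1 then (f z.1 - f z.2) / (z.1 - z.2 + ε) ^ (β + 1) else 0) =
      fun z => Function.uncurry P z - Function.uncurry Q z := by
    ext z
    simp only [Function.uncurry, P, Q]
    split_ifs
    · ring
    · ring
  have hμ_bdd : ∀ {w : ℝ → ℝ}, Measurable w → (∀ y ∈ Ioo 0 x, 0 ≤ w y) →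
      Integrable (fun y => (w y + ε) ^ (-β) * f y) μ := by
    intro w hw hw0
    refine Integrable.of_bound (C := ε ^ (-β) * M)
      (Measurable.aestronglyMeasurable (by fun_prop)) ?_
    refine (ae_restrict_iff' measurableSet_Ioo).2 (Eventually.of_forall fun y hy => ?_)
    have h0 := hw0 y hy
    rw [Real.norm_eq_abs, abs_mul, abs_of_nonneg (by positivity)]
    exact mul_le_mul (Real.rpow_le_rpow_of_nonpos hε (by linarith) (by linarith)) (hM y hy)
      (abs_nonneg _) (by positivity)
  have hμf : Integrable f μ := by
    refine Integrable.of_bound (C := M) hf.aestronglyMeasurable ?_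
    exact (ae_restrict_iff' measurableSet_Ioo).2 (Eventually.of_forall fun y hy => hM y hy)
  have eP : ∫ z, Function.uncurry P z ∂(μ.prod μ) =
      (ε ^ (-β) * (∫ y, f y ∂μ) - ∫ y, (y + ε) ^ (-β) * f y ∂μ) / β := by
    rw [integral_prod _ hP, ← integral_const_mul, ← integral_sub (hμf.const_mul _)
      (hμ_bdd (w := fun y => y) measurable_id fun y hy => hy.1.le), ← integral_div]
    refine setIntegral_congr_fun measurableSet_Ioo fun t ht => ?_
    simp only [Function.uncurry, P]
    rw [setIntegral_Ioo_eq_ite ht.2.le, integral_const_mul]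
    have := integral_one_div_rsub_rpow hβ (a := 0) (b := t) (x := t + ε) ht.1.le (by linarith)
    have e : (fun s => 1 / (t - s + ε) ^ (β + 1)) = fun s => 1 / (t + ε - s) ^ (β + 1) := by
      ext s
      rw [sub_add_eq_add_sub]
    rw [e, this]
    simp only [add_sub_cancel_left, sub_zero]
    ring
  have eQ : ∫ z, Function.uncurry Q z ∂(μ.prod μ) =
      (ε ^ (-β) * (∫ y, f y ∂μ) - ∫ y, (x - y + ε) ^ (-β) * f y ∂μ) / β := by
    rw [integral_prod_symm _ hQ, ← integral_const_mul, ← integral_sub (hμf.const_mul _)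
      (hμ_bdd (w := fun y => x - y) (by fun_prop) fun y hy => by linarith [hy.2]),
      ← integral_div]
    refine setIntegral_congr_fun measurableSet_Ioo fun s hs => ?_
    simp only [Function.uncurry, Q]
    rw [setIntegral_Ioo_eq_ite' hs.1.le, integral_const_mul]
    have := integral_one_div_sub_rpow hβ (a := s) (b := x) (x := s - ε) hs.2.le (by linarith)
    have e : (fun t => 1 / (t - s + ε) ^ (β + 1)) = fun t => 1 / (t - (s - ε)) ^ (β + 1) := by
      ext t
      rw [sub_sub_eq_add_sub, sub_add_eq_add_sub]
    rw [e, this]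
    have e2 : x - (s - ε) = x - s + ε := by ring
    simp only [sub_sub_cancel, e2]
    ring
  rw [hsub, integral_sub hP hQ, eP, eQ]
  field_simp
  ring

/-- The limit `ε → 0` of `integral_regularized_kernel`. The unregularized kernel is integrable on
the triangle by `hK` and dominates the regularized ones. -/
theorem integral_weyl_kernel {β M K x : ℝ} (hβ : 0 < β) (hβ' : β < 1) {f : ℝ → ℝ}
    (hf : Measurable f) (hM : ∀ y ∈ Ioo 0 x, |f y| ≤ M)
    (hK : ∀ t ∈ Ioo 0 x, ∫⁻ s in Ioo 0 t, ENNReal.ofReal (|f t - f s| / (t - s) ^ (β + 1)) ≤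
      ENNReal.ofReal K) :
    β * ∫ t in Ioo 0 x, ∫ s in Ioo 0 t, (f t - f s) / (t - s) ^ (β + 1) =
      abelInt (1 - β) f x - ∫ t in Ioo 0 x, f t / t ^ β := by
  rcases le_or_gt x 0 with hx | hx
  · simp [abelInt, Ioo_eq_empty (not_lt.2 hx)]
  set μ := volume.restrict (Ioo (0 : ℝ) x) with hμ
  let Φ : ℝ × ℝ → ℝ := fun z =>
    if z.2 < z.1 then (f z.1 - f z.2) / (z.1 - z.2) ^ (β + 1) else 0
  have hΦm : Measurable Φ :=
    Measurable.ite (measurableSet_lt measurable_snd measurable_fst) (by fun_prop)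
      measurable_const
  have hΦ : Integrable Φ (μ.prod μ) := by
    refine ⟨hΦm.aestronglyMeasurable, ?_⟩
    rw [hasFiniteIntegral_iff_norm, lintegral_prod _ (by fun_prop)]
    refine lt_of_le_of_lt (b := ∫⁻ t, ENNReal.ofReal K ∂μ) ?_ ?_
    · refine setLIntegral_mono' measurableSet_Ioo fun t ht => ?_
      refine le_trans (le_of_eq ?_) (hK t ht)
      rw [← setLIntegral_Ioo_eq_ite ht.2.le]
      refine setLIntegral_congr_fun measurableSet_Ioo fun s hs => ?_
      simp only [Φ]
      split_ifs with h
      · rw [Real.norm_eq_abs, abs_div,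
          abs_of_nonneg (Real.rpow_nonneg (sub_pos.2 h).le _)]
      · simp
    · simp [hμ, ENNReal.mul_lt_top]
  have hlim : Tendsto (fun n : ℕ => β * ∫ z, (if z.2 < z.1 then
      (f z.1 - f z.2) / (z.1 - z.2 + 1 / ((n : ℝ) + 1)) ^ (β + 1) else 0) ∂(μ.prod μ)) atTop
      (𝓝 (β * ∫ z, Φ z ∂(μ.prod μ))) := by
    refine Tendsto.const_mul _ ?_
    refine tendsto_integral_of_dominated_convergence (fun z => ‖Φ z‖) ?_ hΦ.norm ?_ ?_
    · intro n
      refine Measurable.aestronglyMeasurable ?_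
      exact Measurable.ite (measurableSet_lt measurable_snd measurable_fst) (by fun_prop)
        measurable_const
    · intro n
      refine Eventually.of_forall fun z => ?_
      simp only [Φ]
      split_ifs with h
      · have h0 : 0 < z.1 - z.2 := sub_pos.2 h
        have hn : (0 : ℝ) < 1 / ((n : ℝ) + 1) := by positivity
        rw [norm_div, norm_div]
        refine div_le_div_of_nonneg_left (norm_nonneg _)
          (norm_pos_iff.2 (Real.rpow_pos_of_pos h0 _).ne') ?_
        rw [Real.norm_of_nonneg (by positivity), Real.norm_of_nonneg (by positivity)]
        exact Real.rpow_le_rpow h0.le (by linarith) (by linarith)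
      · simp
    · refine Eventually.of_forall fun z => ?_
      simp only [Φ]
      split_ifs with h
      · have h0 : 0 < z.1 - z.2 := sub_pos.2 h
        refine Tendsto.div tendsto_const_nhds ?_ (Real.rpow_pos_of_pos h0 _).ne'
        have h1 : Tendsto (fun n : ℕ => z.1 - z.2 + 1 / ((n : ℝ) + 1)) atTop
            (𝓝 (z.1 - z.2 + 0)) :=
          tendsto_const_nhds.add tendsto_one_div_add_atTop_nhds_zero_nat
        rw [add_zero] at h1
        exact (Real.continuousAt_rpow_const _ _ (Or.inl h0.ne')).tendsto.comp h1
      · exact tendsto_const_nhds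
  have hlim2 := (tendsto_integral_div_add_rpow hβ hf hM (w := fun y => x - y) (by fun_prop)
    (fun y hy => by linarith [hy.2]) (integrableOn_sub_rpow (by linarith) hx.le)).sub
    (tendsto_integral_div_add_rpow hβ hf hM (w := fun y => y) (by fun_prop)
    (fun y hy => by linarith [hy.1]) (integrableOn_rpow (by linarith) x))
  have heq := tendsto_nhds_unique (hlim.congr fun n =>
    integral_regularized_kernel hβ (by positivity) hf hM) hlim2
  have e1 : ∫ z, Φ z ∂(μ.prod μ) =
      ∫ t in Ioo 0 x, ∫ s in Ioo 0 t, (f t - f s) / (t - s) ^ (β + 1) := by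
    rw [integral_prod _ hΦ]
    refine setIntegral_congr_fun measurableSet_Ioo fun t ht => ?_
    simp only [Φ]
    rw [setIntegral_Ioo_eq_ite ht.2.le]
  have e2 : abelInt (1 - β) f x = ∫ y in Ioo 0 x, (x - y) ^ (-β) * f y := by
    rw [abelInt]
    congr 2
    ext y
    congr 2
    ring
  have e3 : ∫ t in Ioo 0 x, f t / t ^ β = ∫ y in Ioo 0 x, y ^ (-β) * f y := by
    refine setIntegral_congr_fun measurableSet_Ioo fun t ht => ?_
    rw [Real.rpow_neg ht.1.le, div_eq_inv_mul]
  rw [← e1, heq, e2, e3]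

/-- The left Weyl derivative based at `0`, for functions vanishing at `0`. -/
def weylDer (β : ℝ) (f : ℝ → ℝ) (x : ℝ) : ℝ :=
  (Real.Gamma (1 - β))⁻¹ * (f x / x ^ β + β * ∫ y in Ioo 0 x, (f x - f y) / (x - y) ^ (β + 1))

theorem measurable_integral_Ioo_kernel {β : ℝ} {f : ℝ → ℝ} (hf : Measurable f) :
    Measurable fun x => ∫ y in Ioo 0 x, (f x - f y) / (x - y) ^ (β + 1) :=
  measurable_integral_Ioo (F := fun x y => (f x - f y) / (x - y) ^ (β + 1)) measurable_const
    measurable_id (by fun_prop)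

theorem measurable_weylDer {β : ℝ} {f : ℝ → ℝ} (hf : Measurable f) :
    Measurable (weylDer β f) := by
  have := measurable_integral_Ioo_kernel (β := β) hf
  unfold weylDer
  fun_prop

theorem abs_integral_le_of_lintegral_le {F G : ℝ → ℝ} {s : Set ℝ} (hs : MeasurableSet s) {K : ℝ}
    (hK : 0 ≤ K) (hFG : ∀ y ∈ s, |F y| ≤ G y)
    (h : ∫⁻ y in s, ENNReal.ofReal (G y) ≤ ENNReal.ofReal K) : |∫ y in s, F y| ≤ K := by
  rw [← Real.norm_eq_abs, ← ENNReal.ofReal_le_ofReal_iff hK]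
  rw [ofReal_norm]
  refine (enorm_integral_le_lintegral_enorm _).trans (le_trans ?_ h)
  refine setLIntegral_mono' hs fun y hy => ?_
  rw [← ofReal_norm]
  exact ENNReal.ofReal_le_ofReal (hFG y hy)

theorem abs_weylDer_le {β K x : ℝ} (hβ : 0 < β) (hβ' : β < 1) (hx : 0 < x) {f : ℝ → ℝ}
    (h0 : |f x| ≤ K * x ^ β)
    (hK : ∫⁻ s in Ioo 0 x, ENNReal.ofReal (|f x - f s| / (x - s) ^ (β + 1)) ≤
      ENNReal.ofReal K) : |weylDer β f x| ≤ (Real.Gamma (1 - β))⁻¹ * (2 * K) := by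
  have hxp : 0 < x ^ β := Real.rpow_pos_of_pos hx _
  have hK0 : 0 ≤ K := by
    by_contra h
    have := (abs_nonneg _).trans h0
    nlinarith
  have hG : 0 < Real.Gamma (1 - β) := Real.Gamma_pos_of_pos (by linarith)
  rw [weylDer, abs_mul, abs_of_pos (inv_pos.2 hG)]
  refine mul_le_mul_of_nonneg_left ?_ (inv_pos.2 hG).le
  have h1 : |f x / x ^ β| ≤ K := by
    rw [abs_div, abs_of_pos hxp, div_le_iff₀ hxp]
    exact h0
  have h2 : |∫ y in Ioo 0 x, (f x - f y) / (x - y) ^ (β + 1)| ≤ K := by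
    refine abs_integral_le_of_lintegral_le measurableSet_Ioo hK0 (fun y hy => ?_) hK
    rw [abs_div, abs_of_nonneg (Real.rpow_nonneg (sub_pos.2 hy.2).le _)]
  calc _ ≤ |f x / x ^ β| + |β * ∫ y in Ioo 0 x, (f x - f y) / (x - y) ^ (β + 1)| := abs_add_le _ _
    _ ≤ K + 1 * K := by
      rw [abs_mul, abs_of_pos hβ]
      exact add_le_add h1 (mul_le_mul hβ'.le h2 (abs_nonneg _) zero_le_one)
    _ = 2 * K := by ring

/-- A function with bounded Weyl derivative is the fractional integral of that derivative. -/
theorem eq_fracIntLeft_weylDer {β K b : ℝ} (hβ : 0 < β) (hβ' : β < 1) (hb : 0 ≤ b) {f : ℝ → ℝ}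
    (hf : Measurable f) (h0 : ∀ x ∈ Ioo 0 b, |f x| ≤ K * x ^ β)
    (hK : ∀ t ∈ Ioo 0 b, ∫⁻ s in Ioo 0 t, ENNReal.ofReal (|f t - f s| / (t - s) ^ (β + 1)) ≤
      ENNReal.ofReal K) :
    ∀ᵐ x ∂(volume.restrict (Ioo 0 b)), f x = fracIntLeft β 0 (weylDer β f) x := by
  rcases hb.eq_or_lt with rfl | hb
  · simp
  have hK0 : 0 ≤ K := by
    have := (abs_nonneg _).trans (h0 (b / 2) ⟨by linarith, by linarith⟩)
    have h2 : 0 < (b / 2) ^ β := Real.rpow_pos_of_pos (by linarith) _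
    by_contra h
    nlinarith
  have hM : ∀ y ∈ Ioo 0 b, |f y| ≤ K * b ^ β := fun y hy =>
    (h0 y hy).trans (mul_le_mul_of_nonneg_left
      (Real.rpow_le_rpow hy.1.le hy.2.le hβ.le) hK0)
  have hG : 0 < Real.Gamma (1 - β) := Real.Gamma_pos_of_pos (by linarith)
  have hGβ : 0 < Real.Gamma β := Real.Gamma_pos_of_pos hβ
  set u := weylDer β f with hu
  have hum : Measurable u := measurable_weylDer hf
  set U := (Real.Gamma (1 - β))⁻¹ * (2 * K) with hU
  have hub : ∀ y ∈ Ioo 0 b, |u y| ≤ U := fun y hy =>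
    abs_weylDer_le hβ hβ' hy.1 (h0 y hy) (hK y hy)
  have hone : ∀ h x, abelInt 1 h x = ∫ y in Ioo 0 x, h y := by
    intro h x
    simp [abelInt]
  have hmono : ∀ {x y : ℝ}, x ∈ Ioo 0 b → y ∈ Ioo 0 x → y ∈ Ioo 0 b := fun hx hy =>
    ⟨hy.1, hy.2.trans hx.2⟩
  -- One integration of the Weyl derivative: the term `∫ f t / t^β` cancels against the one in
  -- `integral_weyl_kernel`, leaving the fractional integral of order `1 - β`.
  have step : ∀ x ∈ Ioo 0 b, Real.Gamma (1 - β) * abelInt 1 u x = abelInt (1 - β) f x := by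
    intro x hx
    have hw := integral_weyl_kernel hβ hβ' hf (fun y hy => hM y (hmono hx hy))
      (fun y hy => hK y (hmono hx hy))
    rw [hone, ← integral_const_mul]
    have e : ∀ t, Real.Gamma (1 - β) * u t =
        f t / t ^ β + β * ∫ s in Ioo 0 t, (f t - f s) / (t - s) ^ (β + 1) := by
      intro t
      rw [hu, weylDer, mul_inv_cancel_left₀ hG.ne']
    simp only [e]
    rw [integral_add, integral_const_mul, hw]
    · ring
    · refine Integrable.of_bound (C := K) (Measurable.aestronglyMeasurable (by fun_prop)) ?_
      refine (ae_restrict_iff' measurableSet_Ioo).2 (Eventually.of_forall fun y hy => ?_)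
      have : 0 < y ^ β := Real.rpow_pos_of_pos hy.1 _
      rw [Real.norm_eq_abs, abs_div, abs_of_pos this, div_le_iff₀ this]
      exact h0 y (hmono hx hy)
    · refine Integrable.const_mul ?_ _
      refine Integrable.of_bound (C := K)
        (measurable_integral_Ioo_kernel hf).aestronglyMeasurable ?_
      refine (ae_restrict_iff' measurableSet_Ioo).2 (Eventually.of_forall fun t ht => ?_)
      refine abs_integral_le_of_lintegral_le measurableSet_Ioo hK0 (fun y hy => ?_)
        (hK t (hmono hx ht))
      rw [abs_div, abs_of_nonneg (Real.rpow_nonneg (sub_pos.2 hy.2).le _)]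
  -- Applying the integral of order `β` to `step` and using the semigroup law shows that `f` and its
  -- candidate have the same primitive. Integrals of orders `1` and `β` commute because both
  -- composites are the same multiple of order `β + 1`.
  have key : ∀ x ∈ Ioo 0 b,
      ∫ y in Ioo 0 x, f y = ∫ y in Ioo 0 x, (Real.Gamma β)⁻¹ * abelInt β u y := by
    intro x hx
    have hbx : ∀ y ∈ Ioo 0 x, |u y| ≤ U := fun y hy => hub y (hmono hx hy)
    have hMx : ∀ y ∈ Ioo 0 x, |f y| ≤ K * b ^ β := fun y hy => hM y (hmono hx hy)
    have a1 := abelInt_abelInt hβ (sub_pos.2 hβ') hf hMx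
    have a2 := abelInt_abelInt hβ one_pos hum hbx
    have a3 := abelInt_abelInt one_pos hβ hum hbx
    have a4 : abelInt β (abelInt (1 - β) f) x =
        Real.Gamma (1 - β) * abelInt β (abelInt 1 u) x := by
      rw [abelInt, abelInt, ← integral_const_mul]
      refine setIntegral_congr_fun measurableSet_Ioo fun y hy => ?_
      rw [← step y (hmono hx hy)]
      ring
    have b1 : ProbabilityTheory.beta β (1 - β) = Real.Gamma β * Real.Gamma (1 - β) := by
      simp [ProbabilityTheory.beta]
    have b2 : ProbabilityTheory.beta 1 β = ProbabilityTheory.beta β 1 := by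
      simp only [ProbabilityTheory.beta]
      rw [mul_comm, add_comm]
    rw [add_comm 1 β, b2, ← a2] at a3
    rw [a4, b1, ← a3, add_sub_cancel, hone, hone] at a1
    rw [integral_const_mul]
    field_simp
    have : Real.Gamma (1 - β) * ∫ y in Ioo 0 x, abelInt β u y =
      Real.Gamma (1 - β) * (Real.Gamma β * ∫ y in Ioo 0 x, f y) := by rw [a1]; ring
    rw [mul_comm]
    exact (mul_left_cancel₀ hG.ne' this).symm
  have hfi : IntegrableOn f (Ioo 0 b) :=
    Integrable.of_bound (C := K * b ^ β) hf.aestronglyMeasurable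
      ((ae_restrict_iff' measurableSet_Ioo).2 (Eventually.of_forall fun y hy => hM y hy))
  have hui : IntegrableOn (fun y => (Real.Gamma β)⁻¹ * abelInt β u y) (Ioo 0 b) := by
    refine Integrable.const_mul ?_ _
    refine Integrable.of_bound (C := U * (b ^ β / β))
      (measurable_abelInt hum).aestronglyMeasurable ?_
    refine (ae_restrict_iff' measurableSet_Ioo).2 (Eventually.of_forall fun y hy => ?_)
    refine (abs_abelInt_le hβ hy.1.le fun z hz => hub z (hmono hy hz)).trans ?_
    have hU0 : 0 ≤ U := (abs_nonneg _).trans (hub y hy)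
    have := Real.rpow_le_rpow hy.1.le hy.2.le hβ.le
    gcongr
  filter_upwards [ae_eq_of_forall_integral_Ioo_eq hb.le hfi hui key,
    ae_restrict_mem measurableSet_Ioo] with x hx hx'
  rw [hx, fracIntLeft, abelInt]
  congr 1
  refine setIntegral_congr_fun measurableSet_Ioo fun y hy => ?_
  rw [div_eq_inv_mul, ← Real.rpow_neg (sub_pos.2 hy.2).le, neg_sub]

/-! ### Integrands of class `W^{α,∞}` -/

/-- Both terms of the norm `‖f‖_{α,∞}` are bounded by `K` on `(0,1]`. -/
def WBound (α K : ℝ) (f : ℝ → ℝ) : Prop :=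
  ∀ x ∈ Ioc (0 : ℝ) 1, |f x| ≤ K ∧
    ∫⁻ y in Ioo 0 x, ENNReal.ofReal (|f x - f y| / (x - y) ^ (α + 1)) ≤ ENNReal.ofReal K

theorem WBound.nonneg {α K : ℝ} {f : ℝ → ℝ} (h : WBound α K f) : 0 ≤ K :=
  (abs_nonneg _).trans (h 1 ⟨one_pos, le_rfl⟩).1

theorem WBound.mono {α K K' : ℝ} {f : ℝ → ℝ} (h : WBound α K f) (hK : K ≤ K') :
    WBound α K' f := fun x hx =>
  ⟨(h x hx).1.trans hK, (h x hx).2.trans (ENNReal.ofReal_le_ofReal hK)⟩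

theorem WBound.congr {α K : ℝ} {f f' : ℝ → ℝ} (h : WBound α K f) (hf : EqOn f' f (Ioc 0 1)) :
    WBound α K f' := by
  intro x hx
  rw [hf hx]
  refine ⟨(h x hx).1, le_of_eq_of_le ?_ (h x hx).2⟩
  refine setLIntegral_congr_fun measurableSet_Ioo fun y hy => ?_
  rw [hf ⟨hy.1, hy.2.le.trans hx.2⟩]

/-- The kernel term is monotone and subadditive in the increments of `f`. Measurability of `f₁`
alone suffices, since additivity of `∫⁻` needs only one measurable summand. -/
theorem WBound.of_abs_le {α K₁ K₂ K : ℝ} {f f₁ f₂ : ℝ → ℝ} (hf₁ : Measurable f₁)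
    (h₁ : WBound α K₁ f₁) (h₂ : WBound α K₂ f₂) {c₁ c₂ : ℝ} (hc₁ : 0 ≤ c₁) (hc₂ : 0 ≤ c₂)
    (hK : c₁ * K₁ + c₂ * K₂ ≤ K) (hb : ∀ x ∈ Ioc (0 : ℝ) 1, |f x| ≤ K)
    (hd : ∀ x ∈ Ioc (0 : ℝ) 1, ∀ y ∈ Ioo 0 x,
      |f x - f y| ≤ c₁ * |f₁ x - f₁ y| + c₂ * |f₂ x - f₂ y|) : WBound α K f := by
  intro x hx
  refine ⟨hb x hx, ?_⟩
  have hm : Measurable fun y => ENNReal.ofReal (|f₁ x - f₁ y| / (x - y) ^ (α + 1)) := by fun_prop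
  calc ∫⁻ y in Ioo 0 x, ENNReal.ofReal (|f x - f y| / (x - y) ^ (α + 1))
      ≤ ∫⁻ y in Ioo 0 x, (ENNReal.ofReal c₁ *
          ENNReal.ofReal (|f₁ x - f₁ y| / (x - y) ^ (α + 1)) + ENNReal.ofReal c₂ *
          ENNReal.ofReal (|f₂ x - f₂ y| / (x - y) ^ (α + 1))) := by
        refine setLIntegral_mono' measurableSet_Ioo fun y hy => ?_
        have hp : 0 < (x - y) ^ (α + 1) := Real.rpow_pos_of_pos (sub_pos.2 hy.2) _
        rw [← ENNReal.ofReal_mul hc₁, ← ENNReal.ofReal_mul hc₂,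
          ← ENNReal.ofReal_add (by positivity) (by positivity)]
        refine ENNReal.ofReal_le_ofReal ?_
        rw [← mul_div_assoc, ← mul_div_assoc, ← add_div]
        exact div_le_div_of_nonneg_right (hd x hx y hy) hp.le
    _ = ENNReal.ofReal c₁ * (∫⁻ y in Ioo 0 x,
          ENNReal.ofReal (|f₁ x - f₁ y| / (x - y) ^ (α + 1))) + ENNReal.ofReal c₂ *
          ∫⁻ y in Ioo 0 x, ENNReal.ofReal (|f₂ x - f₂ y| / (x - y) ^ (α + 1)) := by
        rw [lintegral_add_left (hm.const_mul _), lintegral_const_mul' _ _ ENNReal.ofReal_ne_top,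
          lintegral_const_mul' _ _ ENNReal.ofReal_ne_top]
    _ ≤ ENNReal.ofReal c₁ * ENNReal.ofReal K₁ + ENNReal.ofReal c₂ * ENNReal.ofReal K₂ := by
        gcongr
        · exact (h₁ x hx).2
        · exact (h₂ x hx).2
    _ ≤ ENNReal.ofReal K := by
        have := h₁.nonneg
        have := h₂.nonneg
        rw [← ENNReal.ofReal_mul hc₁, ← ENNReal.ofReal_mul hc₂,
          ← ENNReal.ofReal_add (by positivity) (by positivity)]
        exact ENNReal.ofReal_le_ofReal hK

theorem WBound.sub {α K₁ K₂ : ℝ} {f₁ f₂ : ℝ → ℝ} (hf₁ : Measurable f₁)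
    (h₁ : WBound α K₁ f₁) (h₂ : WBound α K₂ f₂) : WBound α (K₁ + K₂) fun x => f₁ x - f₂ x :=
  WBound.of_abs_le hf₁ h₁ h₂ zero_le_one zero_le_one (by linarith)
    (fun x hx => (abs_sub _ _).trans (add_le_add (h₁ x hx).1 (h₂ x hx).1))
    fun x _ y _ => by
      have : f₁ x - f₂ x - (f₁ y - f₂ y) = (f₁ x - f₁ y) - (f₂ x - f₂ y) := by ring
      rw [this, one_mul, one_mul]
      exact abs_sub _ _

theorem WBound.add {α K₁ K₂ : ℝ} {f₁ f₂ : ℝ → ℝ} (hf₁ : Measurable f₁)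
    (h₁ : WBound α K₁ f₁) (h₂ : WBound α K₂ f₂) : WBound α (K₁ + K₂) fun x => f₁ x + f₂ x :=
  WBound.of_abs_le hf₁ h₁ h₂ zero_le_one zero_le_one (by linarith)
    (fun x hx => (abs_add_le _ _).trans (add_le_add (h₁ x hx).1 (h₂ x hx).1))
    fun x _ y _ => by
      have : f₁ x + f₂ x - (f₁ y + f₂ y) = (f₁ x - f₁ y) + (f₂ x - f₂ y) := by ring
      rw [this, one_mul, one_mul]
      exact abs_add_le _ _

/-- Average `|f x - f y| ≤ |f x - f η| + |f y - f η|` over `η ∈ (0,y)`. All distances involved are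
at most `x`, so the weight can be inserted at the cost of `x^(α+1)`. -/
theorem WBound.abs_sub_mul_le {α K : ℝ} (hα : 0 < α) {f : ℝ → ℝ} (hf : Measurable f)
    (h : WBound α K f) {x y : ℝ} (hy : 0 < y) (hyx : y ≤ x) (hx : x ≤ 1) :
    |f x - f y| * y ≤ 2 * (x ^ (α + 1) * K) := by
  have hK := h.nonneg
  have hx0 : 0 < x := hy.trans_le hyx
  have key : ∀ z, y ≤ z → z ≤ x → ∫⁻ η in Ioo 0 y, ENNReal.ofReal |f z - f η| ≤
      ENNReal.ofReal (x ^ (α + 1) * K) := by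
    intro z hyz hzx
    have hz0 : 0 < z := hy.trans_le hyz
    rw [ENNReal.ofReal_mul (by positivity)]
    refine le_trans ?_ (mul_le_mul_right (h z ⟨hz0, hzx.trans hx⟩).2 _)
    rw [← lintegral_const_mul' _ _ ENNReal.ofReal_ne_top]
    refine le_trans ?_ (lintegral_mono_set (Ioo_subset_Ioo_right hyz))
    refine setLIntegral_mono' measurableSet_Ioo fun η hη => ?_
    rw [← ENNReal.ofReal_mul (by positivity)]
    refine ENNReal.ofReal_le_ofReal ?_
    have h0 : 0 < z - η := by linarith [hη.2]
    have hp : 0 < (z - η) ^ (α + 1) := Real.rpow_pos_of_pos h0 _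
    rw [← mul_div_assoc, le_div_iff₀ hp, mul_comm]
    refine mul_le_mul_of_nonneg_right ?_ (abs_nonneg _)
    exact Real.rpow_le_rpow h0.le (by linarith [hη.1]) (by linarith)
  have h1 : ENNReal.ofReal (|f x - f y| * y) ≤ ENNReal.ofReal (2 * (x ^ (α + 1) * K)) := by
    calc ENNReal.ofReal (|f x - f y| * y)
        = ∫⁻ _ in Ioo 0 y, ENNReal.ofReal |f x - f y| := by
          simp [ENNReal.ofReal_mul]
      _ ≤ ∫⁻ η in Ioo 0 y, (ENNReal.ofReal |f x - f η| + ENNReal.ofReal |f y - f η|) := by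
          refine lintegral_mono fun η => ?_
          rw [← ENNReal.ofReal_add (abs_nonneg _) (abs_nonneg _)]
          refine ENNReal.ofReal_le_ofReal ?_
          rw [abs_sub_comm (f y)]
          exact abs_sub_le _ _ _
      _ = (∫⁻ η in Ioo 0 y, ENNReal.ofReal |f x - f η|) +
            ∫⁻ η in Ioo 0 y, ENNReal.ofReal |f y - f η| :=
          lintegral_add_left (by fun_prop) _
      _ ≤ ENNReal.ofReal (x ^ (α + 1) * K) + ENNReal.ofReal (x ^ (α + 1) * K) :=
          add_le_add (key x hyx le_rfl) (key y le_rfl hyx)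
      _ = ENNReal.ofReal (2 * (x ^ (α + 1) * K)) := by
          rw [← ENNReal.ofReal_add (by positivity) (by positivity), two_mul]
  exact (ENNReal.ofReal_le_ofReal_iff (by positivity)).1 h1

/-- The constant in the Hölder estimate at `0` for functions in `W^{α,∞}`. -/
def holderConst (α : ℝ) : ℝ := 4 / (1 - (1 / 2) ^ α)

theorem half_rpow_lt_one {α : ℝ} (hα : 0 < α) : ((1 : ℝ) / 2) ^ α < 1 :=
  Real.rpow_lt_one (by norm_num) (by norm_num) hα

/-- The fixed-point identity that closes the dyadic induction in `WBound.abs_sub_le`. -/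
theorem holderConst_eq {α : ℝ} (hα : 0 < α) :
    4 + holderConst α * (1 / 2) ^ α = holderConst α := by
  have := half_rpow_lt_one hα
  have h2 : 1 - ((1 : ℝ) / 2) ^ α ≠ 0 := by linarith
  rw [holderConst]
  field_simp
  ring

theorem four_le_holderConst {α : ℝ} (hα : 0 < α) : 4 ≤ holderConst α := by
  have := half_rpow_lt_one hα
  have h3 : (0 : ℝ) < (1 / 2) ^ α := by positivity
  rw [holderConst, le_div_iff₀ (by linarith)]
  nlinarith

/-- For `y ≤ x ≤ 2y` the averaged bound divided by `y` gives `4 K x^α`. In general `x` is halved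
until it is within a factor `2` of `y`; the errors form a geometric series of ratio `2^(-α)`. -/
theorem WBound.abs_sub_le {α K : ℝ} (hα : 0 < α) {f : ℝ → ℝ} (hf : Measurable f)
    (h : WBound α K f) {x y : ℝ} (hy : 0 < y) (hyx : y ≤ x) (hx : x ≤ 1) :
    |f x - f y| ≤ holderConst α * K * x ^ α := by
  have hK := h.nonneg
  have hC := four_le_holderConst hα
  have near : ∀ x y : ℝ, 0 < y → y ≤ x → x ≤ 1 → x ≤ 2 * y → |f x - f y| ≤ 4 * K * x ^ α := by
    intro x y hy hyx hx h2
    have hx0 : 0 < x := hy.trans_le hyx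
    have h1 := h.abs_sub_mul_le hα hf hy hyx hx
    rw [Real.rpow_add hx0, Real.rpow_one] at h1
    have h3 : 0 ≤ x ^ α * K := by positivity
    have h4 : |f x - f y| * y ≤ (4 * K * x ^ α) * y := by nlinarith
    exact le_of_mul_le_mul_right h4 hy
  have main : ∀ n : ℕ, ∀ x : ℝ, y ≤ x → x ≤ 1 → x ≤ 2 ^ (n + 1) * y →
      |f x - f y| ≤ holderConst α * K * x ^ α := by
    intro n
    induction n with
    | zero =>
      intro x hyx hx h2
      have hx0 : 0 < x := hy.trans_le hyx
      have h3 : 0 ≤ K * x ^ α := by positivity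
      have h4 := near x y hy hyx hx (by simpa using h2)
      nlinarith
    | succ n ih =>
      intro x hyx hx h2
      have hx0 : 0 < x := hy.trans_le hyx
      have h3 : 0 ≤ K * x ^ α := by positivity
      rcases le_or_gt x (2 * y) with h4 | h4
      · have h5 := near x y hy hyx hx h4
        nlinarith
      · have h5 := near x (x / 2) (by linarith) (by linarith) hx (by linarith)
        have h6 := ih (x / 2) (by linarith) (by linarith) (by rw [pow_succ] at h2; linarith)
        have e : (x / 2) ^ α = x ^ α * (1 / 2) ^ α := by
          rw [← Real.mul_rpow hx0.le (by norm_num)]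
          congr 1
          ring
        rw [e] at h6
        calc |f x - f y| ≤ |f x - f (x / 2)| + |f (x / 2) - f y| := _root_.abs_sub_le _ _ _
          _ ≤ 4 * K * x ^ α + holderConst α * K * (x ^ α * (1 / 2) ^ α) := add_le_add h5 h6
          _ = (4 + holderConst α * (1 / 2) ^ α) * K * x ^ α := by ring
          _ = holderConst α * K * x ^ α := by rw [holderConst_eq hα]
  obtain ⟨n, hn⟩ := pow_unbounded_of_one_lt (x / y) (one_lt_two (α := ℝ))
  refine main n x hyx hx ?_
  have h1 : x < 2 ^ n * y := (div_lt_iff₀ hy).1 hn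
  rw [pow_succ]
  have : 0 < (2 : ℝ) ^ n * y := by positivity
  linarith

/-- Measurable functions bounded in `W^{α,∞}` by `K` and right-continuous at `0`. -/
structure LeftReg (α K : ℝ) (f : ℝ → ℝ) : Prop where
  meas : Measurable f
  lim : Tendsto f (𝓝[>] 0) (𝓝 (f 0))
  bound : WBound α K f

theorem LeftReg.sub {α K₁ K₂ K : ℝ} {f₁ f₂ : ℝ → ℝ} (h₁ : LeftReg α K₁ f₁)
    (h₂ : LeftReg α K₂ f₂) (h : WBound α K fun x => f₁ x - f₂ x) :
    LeftReg α K fun x => f₁ x - f₂ x :=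
  ⟨h₁.meas.sub h₂.meas, h₁.lim.sub h₂.lim, h⟩

theorem LeftReg.abs_zero_le {α K : ℝ} {f : ℝ → ℝ} (h : LeftReg α K f) : |f 0| ≤ K := by
  refine le_of_tendsto h.lim.abs ?_
  filter_upwards [Ioc_mem_nhdsGT one_pos] with x hx using (h.bound x hx).1

theorem LeftReg.abs_sub_zero_le {α K : ℝ} (hα : 0 < α) {f : ℝ → ℝ} (h : LeftReg α K f)
    {x : ℝ} (hx : x ∈ Ioc (0 : ℝ) 1) : |f x - f 0| ≤ holderConst α * K * x ^ α := by
  refine le_of_tendsto (h.lim.const_sub (f x)).abs ?_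
  filter_upwards [Ioc_mem_nhdsGT hx.1] with y hy
    using h.bound.abs_sub_le hα h.meas hy.1 hy.2 hx.2

/-- The Weyl derivative of `f - f 0` at `0`. -/
def leftDer (α : ℝ) (f : ℝ → ℝ) : ℝ → ℝ := weylDer α fun z => f z - f 0

theorem LeftReg.measurable_leftDer {α K : ℝ} {f : ℝ → ℝ} (h : LeftReg α K f) :
    Measurable (leftDer α f) := measurable_weylDer (h.meas.sub_const _)

/-- The constant in the bound for the Weyl derivative of a function in `W^{α,∞}`. -/
def derConst (α : ℝ) : ℝ := (Real.Gamma (1 - α))⁻¹ * (2 * holderConst α) + 1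

/-- The summand `1` in `derConst` serves this bound, which lets `|f 0| ≤ K` be absorbed into
`derConst α * K`. -/
theorem one_le_derConst {α : ℝ} (hα : 0 < α) (hα' : α < 1) : 1 ≤ derConst α := by
  have hG : 0 < Real.Gamma (1 - α) := Real.Gamma_pos_of_pos (by linarith)
  have := four_le_holderConst hα
  have : 0 ≤ (Real.Gamma (1 - α))⁻¹ * (2 * holderConst α) := by positivity
  rw [derConst]
  linarith

theorem LeftReg.lintegral_centered_le {α K : ℝ} (hα : 0 < α) {f : ℝ → ℝ} (h : LeftReg α K f)
    {x : ℝ} (hx : x ∈ Ioc (0 : ℝ) 1) :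
    ∫⁻ s in Ioo 0 x, ENNReal.ofReal (|(f x - f 0) - (f s - f 0)| / (x - s) ^ (α + 1)) ≤
      ENNReal.ofReal (holderConst α * K) := by
  simp only [sub_sub_sub_cancel_right]
  refine (h.bound x hx).2.trans (ENNReal.ofReal_le_ofReal ?_)
  have := four_le_holderConst hα
  have := h.bound.nonneg
  nlinarith

theorem LeftReg.abs_leftDer_le {α K : ℝ} (hα : 0 < α) (hα' : α < 1) {f : ℝ → ℝ}
    (h : LeftReg α K f) {x : ℝ} (hx : x ∈ Ioc (0 : ℝ) 1) :
    |leftDer α f x| ≤ derConst α * K := by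
  have := abs_weylDer_le hα hα' hx.1 (f := fun z => f z - f 0) (h.abs_sub_zero_le hα hx)
    (h.lintegral_centered_le hα hx)
  have hK := h.bound.nonneg
  rw [leftDer, derConst]
  linarith

theorem integrableOn_of_lintegral_le {F : ℝ → ℝ} {s : Set ℝ} {K : ℝ} (hF : Measurable F)
    (h : ∫⁻ y in s, ENNReal.ofReal |F y| ≤ ENNReal.ofReal K) : IntegrableOn F s := by
  refine ⟨hF.aestronglyMeasurable, ?_⟩
  rw [hasFiniteIntegral_iff_norm]
  exact h.trans_lt ENNReal.ofReal_lt_top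

theorem LeftReg.integrableOn_kernel {α K : ℝ} {f : ℝ → ℝ} (h : LeftReg α K f)
    {x : ℝ} (hx : x ∈ Ioc (0 : ℝ) 1) :
    IntegrableOn (fun y => (f x - f y) / (x - y) ^ (α + 1)) (Ioo 0 x) := by
  have := h.meas
  refine integrableOn_of_lintegral_le (K := K) (by fun_prop) (le_of_eq_of_le ?_ (h.bound x hx).2)
  refine setLIntegral_congr_fun measurableSet_Ioo fun y hy => ?_
  rw [abs_div, abs_of_nonneg (Real.rpow_nonneg (sub_pos.2 hy.2).le _)]

theorem LeftReg.leftDer_sub {α K₁ K₂ : ℝ} {f₁ f₂ : ℝ → ℝ} (h₁ : LeftReg α K₁ f₁)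
    (h₂ : LeftReg α K₂ f₂) {x : ℝ} (hx : x ∈ Ioc (0 : ℝ) 1) :
    leftDer α (fun z => f₁ z - f₂ z) x = leftDer α f₁ x - leftDer α f₂ x := by
  simp only [leftDer, weylDer, sub_sub_sub_cancel_right]
  have : ∀ y, (f₁ x - f₂ x - (f₁ y - f₂ y)) / (x - y) ^ (α + 1) =
      (f₁ x - f₁ y) / (x - y) ^ (α + 1) - (f₂ x - f₂ y) / (x - y) ^ (α + 1) := fun y => by ring
  simp only [this]
  rw [integral_sub (h₁.integrableOn_kernel hx) (h₂.integrableOn_kernel hx)]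
  ring

/-! ### Integrators of class `W_0^{1-α,∞}` -/

/-- Measurable functions bounded in `W_0^{1-α,∞}` by `Λ`, up to the closed interval `[0,1]`. -/
structure RightReg (α Λ : ℝ) (g : ℝ → ℝ) : Prop where
  meas : Measurable g
  holder : ∀ η ξ : ℝ, 0 ≤ η → η ≤ ξ → ξ ≤ 1 → |g ξ - g η| ≤ Λ * (ξ - η) ^ (1 - α)
  kernel : ∀ η ξ : ℝ, 0 < η → η < ξ → ξ ≤ 1 →
    ∫⁻ y in Ioo η ξ, ENNReal.ofReal (|g η - g y| / (y - η) ^ (1 - α + 1)) ≤ ENNReal.ofReal Λ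

theorem RightReg.nonneg {α Λ : ℝ} {g : ℝ → ℝ} (h : RightReg α Λ g) : 0 ≤ Λ := by
  have := (abs_nonneg _).trans (h.holder 0 1 le_rfl zero_le_one le_rfl)
  simpa using this

/-- The right Weyl derivative of order `1-α` of `g - g ξ`, based at `ξ`. -/
def rightDer (α : ℝ) (g : ℝ → ℝ) (ξ x : ℝ) : ℝ :=
  (Real.Gamma α)⁻¹ * ((g x - g ξ) / (ξ - x) ^ (1 - α) +
    (1 - α) * ∫ y in Ioo x ξ, (g x - g y) / (y - x) ^ (1 - α + 1))

/-- The reflection `z ↦ ξ - z` exchanges right and left derivatives, so the bounds and the inversion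
theorem at `0` apply to `g` at `ξ`. -/
theorem rightDer_eq_weylDer (α : ℝ) (g : ℝ → ℝ) {ξ x : ℝ} (hx : x < ξ) :
    rightDer α g ξ x = weylDer (1 - α) (fun z => g (ξ - z) - g ξ) (ξ - x) := by
  simp only [rightDer, weylDer, sub_sub_cancel, sub_sub_sub_cancel_right]
  have := integral_Ioo_comp_sub_left (fun y => (g x - g y) / (y - x) ^ (1 - α + 1))
    (a := 0) (b := ξ - x) (by linarith) ξ
  simp only [sub_sub_cancel, sub_zero] at this
  rw [← this]
  simp only [sub_right_comm]

theorem lintegral_Ioo_comp_sub_left (F : ℝ → ℝ≥0∞) (a b c : ℝ) :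
    ∫⁻ y in Ioo a b, F (c - y) = ∫⁻ y in Ioo (c - b) (c - a), F y := by
  rw [← lintegral_indicator measurableSet_Ioo, ← lintegral_indicator measurableSet_Ioo,
    ← lintegral_sub_left_eq_self _ c]
  congr 1
  ext y
  simp only [indicator_apply, mem_Ioo, sub_sub_cancel]
  congr 1
  rw [eq_iff_iff]
  constructor
  · rintro ⟨h1, h2⟩
    constructor <;> linarith
  · rintro ⟨h1, h2⟩
    constructor <;> linarith

theorem RightReg.abs_reflect_le {α Λ : ℝ} {g : ℝ → ℝ} (h : RightReg α Λ g) {ξ z : ℝ}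
    (hξ : ξ ≤ 1) (hz : z ∈ Ioo 0 ξ) : |g (ξ - z) - g ξ| ≤ Λ * z ^ (1 - α) := by
  have := h.holder (ξ - z) ξ (by linarith [hz.2]) (by linarith [hz.1]) hξ
  rwa [sub_sub_cancel, abs_sub_comm] at this

theorem RightReg.lintegral_reflect_le {α Λ : ℝ} {g : ℝ → ℝ} (h : RightReg α Λ g) {ξ z : ℝ}
    (hξ : ξ ≤ 1) (hz : z ∈ Ioo 0 ξ) :
    ∫⁻ s in Ioo 0 z, ENNReal.ofReal
      (|(g (ξ - z) - g ξ) - (g (ξ - s) - g ξ)| / (z - s) ^ (1 - α + 1)) ≤ ENNReal.ofReal Λ := by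
  have := lintegral_Ioo_comp_sub_left
    (fun y => ENNReal.ofReal (|g (ξ - z) - g y| / (y - (ξ - z)) ^ (1 - α + 1))) 0 z ξ
  rw [sub_zero] at this
  have h2 := h.kernel (ξ - z) ξ (by linarith [hz.2]) (by linarith [hz.1]) hξ
  rw [← this] at h2
  simp only [sub_sub_sub_cancel_right]
  simpa only [sub_sub_sub_cancel_left] using h2

theorem RightReg.integrableOn_kernel {α Λ : ℝ} {g : ℝ → ℝ} (h : RightReg α Λ g) {ξ x : ℝ}
    (hξ : ξ ≤ 1) (hx : x ∈ Ioo 0 ξ) :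
    IntegrableOn (fun y => (g x - g y) / (y - x) ^ (1 - α + 1)) (Ioo x ξ) := by
  have := h.meas
  refine integrableOn_of_lintegral_le (K := Λ) (by fun_prop)
    (le_of_eq_of_le ?_ (h.kernel x ξ hx.1 hx.2 hξ))
  refine setLIntegral_congr_fun measurableSet_Ioo fun y hy => ?_
  rw [abs_div, abs_of_nonneg (Real.rpow_nonneg (sub_pos.2 hy.1).le _)]

theorem RightReg.abs_rightDer_le {α Λ : ℝ} (hα : 0 < α) (hα' : α < 1) {g : ℝ → ℝ}
    (h : RightReg α Λ g) {ξ x : ℝ} (hξ : ξ ≤ 1) (hx : x ∈ Ioo 0 ξ) :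
    |rightDer α g ξ x| ≤ (Real.Gamma α)⁻¹ * (2 * Λ) := by
  have hz : ξ - x ∈ Ioo 0 ξ := ⟨by linarith [hx.2], by linarith [hx.1]⟩
  rw [rightDer_eq_weylDer α g hx.2]
  have := abs_weylDer_le (sub_pos.2 hα') (by linarith) hz.1 (f := fun z => g (ξ - z) - g ξ)
    (h.abs_reflect_le hξ hz) (h.lintegral_reflect_le hξ hz)
  rwa [sub_sub_cancel] at this

/-- Split the kernel integral at `η` and write `g x - g y = (g x - g η) - (g y - g η)` beyond `η`.
The explicit integral of the `g x - g η` part absorbs the boundary terms, and only increments of `g`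
inside `[η,ξ]` survive. -/
theorem RightReg.rightDer_sub_rightDer {α Λ : ℝ} (hα : 0 < α) (hα' : α < 1) {g : ℝ → ℝ}
    (h : RightReg α Λ g) {ξ η x : ℝ} (hx : x ∈ Ioo 0 η) (hηξ : η ≤ ξ) (hξ : ξ ≤ 1) :
    rightDer α g ξ x - rightDer α g η x = -((Real.Gamma α)⁻¹ *
      ((g ξ - g η) / (ξ - x) ^ (1 - α) +
        (1 - α) * ∫ y in Ioo η ξ, (g y - g η) / (y - x) ^ (1 - α + 1))) := by
  have hi := h.integrableOn_kernel hξ ⟨hx.1, hx.2.trans_le hηξ⟩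
  have hiη := h.integrableOn_kernel (hηξ.trans hξ) hx
  have hβ : 0 < 1 - α := sub_pos.2 hα'
  have split : ∫ y in Ioo x ξ, (g x - g y) / (y - x) ^ (1 - α + 1) =
      (∫ y in Ioo x η, (g x - g y) / (y - x) ^ (1 - α + 1)) +
        ∫ y in Ioo η ξ, (g x - g y) / (y - x) ^ (1 - α + 1) := by
    have hi' := (intervalIntegrable_iff_integrableOn_Ioo_of_le (hx.2.le.trans hηξ)).2 hi
    simp only [← integral_Ioc_eq_integral_Ioo]
    rw [← intervalIntegral.integral_of_le hx.2.le, ← intervalIntegral.integral_of_le hηξ,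
      ← intervalIntegral.integral_of_le (hx.2.le.trans hηξ)]
    refine (intervalIntegral.integral_add_adjacent_intervals ?_ ?_).symm
    · exact hi'.mono_set (by
        rw [uIcc_of_le hx.2.le, uIcc_of_le (hx.2.le.trans hηξ)]
        exact Icc_subset_Icc_right hηξ)
    · exact hi'.mono_set (by
        rw [uIcc_of_le hηξ, uIcc_of_le (hx.2.le.trans hηξ)]
        exact Icc_subset_Icc_left hx.2.le)
  have hi2 : IntegrableOn (fun y => (g x - g y) / (y - x) ^ (1 - α + 1)) (Ioo η ξ) :=
    hi.mono_set (Ioo_subset_Ioo_left hx.2.le)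
  have hk := integral_one_div_sub_rpow hβ hηξ hx.2
  have hki : IntegrableOn (fun y => 1 / (y - x) ^ (1 - α + 1)) (Ioo η ξ) :=
    integrableOn_one_div_sub_rpow hx.2 _
  have e : ∫ y in Ioo η ξ, (g y - g η) / (y - x) ^ (1 - α + 1) =
      (g x - g η) * (∫ y in Ioo η ξ, 1 / (y - x) ^ (1 - α + 1)) -
        ∫ y in Ioo η ξ, (g x - g y) / (y - x) ^ (1 - α + 1) := by
    rw [← integral_const_mul, ← integral_sub (hki.const_mul _) hi2]
    congr 1
    ext y
    ring
  rw [rightDer, rightDer, split, e, hk, Real.rpow_neg (by linarith [hx.2]),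
    Real.rpow_neg (by linarith [hx.2])]
  field_simp
  ring

/-- The increments of `g` supply the factor `(ξ-η)^(1-α)`; the remaining singularity `(η-x)^(α-1)`
is integrable in `x` since `α > 0`. -/
theorem RightReg.abs_rightDer_sub_le {α Λ : ℝ} (hα : 0 < α) (hα' : α < 1) {g : ℝ → ℝ}
    (h : RightReg α Λ g) {ξ η x : ℝ} (hx : x ∈ Ioo 0 η) (hηξ : η ≤ ξ) (hξ : ξ ≤ 1) :
    |rightDer α g ξ x - rightDer α g η x| ≤
      2 * (Real.Gamma α)⁻¹ * Λ * (ξ - η) ^ (1 - α) * (η - x) ^ (α - 1) := by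
  have hG : 0 < (Real.Gamma α)⁻¹ := inv_pos.2 (Real.Gamma_pos_of_pos hα)
  have hβ : 0 < 1 - α := sub_pos.2 hα'
  have hΛ := h.nonneg
  have hη0 : 0 < η - x := sub_pos.2 hx.2
  have hξ0 : 0 < ξ - x := by linarith
  have hd : 0 ≤ (ξ - η) ^ (1 - α) := Real.rpow_nonneg (by linarith) _
  have hpow : (ξ - x) ^ (1 - α) = ((ξ - x) ^ (α - 1))⁻¹ := by
    rw [← Real.rpow_neg hξ0.le, neg_sub]
  have hle : (ξ - x) ^ (α - 1) ≤ (η - x) ^ (α - 1) :=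
    Real.rpow_le_rpow_of_nonpos hη0 (by linarith) (by linarith)
  have t1 : |(g ξ - g η) / (ξ - x) ^ (1 - α)| ≤ Λ * (ξ - η) ^ (1 - α) * (η - x) ^ (α - 1) := by
    rw [hpow, div_inv_eq_mul, abs_mul, abs_of_nonneg (Real.rpow_nonneg hξ0.le _)]
    exact mul_le_mul (h.holder η ξ (hx.1.trans hx.2).le hηξ hξ) hle
      (Real.rpow_nonneg hξ0.le _) (by positivity)
  have hk := integral_one_div_sub_rpow hβ hηξ hx.2
  have hki : IntegrableOn (fun y => 1 / (y - x) ^ (1 - α + 1)) (Ioo η ξ) :=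
    integrableOn_one_div_sub_rpow hx.2 _
  have t2 : |∫ y in Ioo η ξ, (g y - g η) / (y - x) ^ (1 - α + 1)| ≤
      Λ * (ξ - η) ^ (1 - α) * (((η - x) ^ (-(1 - α)) - (ξ - x) ^ (-(1 - α))) / (1 - α)) := by
    rw [← hk, ← integral_const_mul, ← Real.norm_eq_abs]
    refine norm_integral_le_of_norm_le (Integrable.const_mul hki _) ?_
    refine (ae_restrict_iff' measurableSet_Ioo).2 (Eventually.of_forall fun y hy => ?_)
    have h0 : 0 < y - x := by linarith [hx.2, hy.1]
    have hp : 0 ≤ 1 / (y - x) ^ (1 - α + 1) := by positivity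
    rw [Real.norm_eq_abs, div_eq_mul_one_div, abs_mul, abs_of_nonneg hp]
    refine mul_le_mul_of_nonneg_right ?_ hp
    refine (h.holder η y (hx.1.trans hx.2).le hy.1.le (hy.2.le.trans hξ)).trans ?_
    exact mul_le_mul_of_nonneg_left
      (Real.rpow_le_rpow (by linarith [hy.1]) (by linarith [hy.2]) hβ.le) hΛ
  have t3 : |(1 - α) * ∫ y in Ioo η ξ, (g y - g η) / (y - x) ^ (1 - α + 1)| ≤
      Λ * (ξ - η) ^ (1 - α) * (η - x) ^ (α - 1) := by
    rw [abs_mul, abs_of_pos hβ]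
    refine (mul_le_mul_of_nonneg_left t2 hβ.le).trans ?_
    have e : (1 - α) * (Λ * (ξ - η) ^ (1 - α) *
        (((η - x) ^ (-(1 - α)) - (ξ - x) ^ (-(1 - α))) / (1 - α))) =
        Λ * (ξ - η) ^ (1 - α) * ((η - x) ^ (α - 1) - (ξ - x) ^ (α - 1)) := by
      rw [neg_sub]
      field_simp
    rw [e]
    refine mul_le_mul_of_nonneg_left ?_ (by positivity)
    have : 0 ≤ (ξ - x) ^ (α - 1) := Real.rpow_nonneg hξ0.le _
    linarith
  rw [h.rightDer_sub_rightDer hα hα' hx hηξ hξ, abs_neg, abs_mul, abs_of_pos hG]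
  refine (mul_le_mul_of_nonneg_left ((abs_add_le _ _).trans (add_le_add t1 t3)) hG.le).trans ?_
  apply le_of_eq
  ring

theorem measurable_rightDer {α : ℝ} {g : ℝ → ℝ → ℝ} (hg : Measurable (Function.uncurry g)) :
    Measurable fun z : ℝ × ℝ × ℝ => rightDer α (g z.1) z.2.1 z.2.2 := by
  have hgc : ∀ {X : Type} [MeasurableSpace X] {a b : X → ℝ}, Measurable a → Measurable b →
      Measurable fun x => g (a x) (b x) := fun ha hb => hg.comp (ha.prodMk hb)
  have := measurable_integral_Ioo (X := ℝ × ℝ × ℝ) (a := fun z => z.2.2) (b := fun z => z.2.1)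
    (F := fun z y => (g z.1 z.2.2 - g z.1 y) / (y - z.2.2) ^ (1 - α + 1)) (by fun_prop)
    (by fun_prop) (Measurable.div (Measurable.sub (hgc (by fun_prop) (by fun_prop))
      (hgc (by fun_prop) (by fun_prop))) (by fun_prop))
  unfold rightDer
  refine Measurable.const_mul (Measurable.add (Measurable.div (Measurable.sub
    (hgc (by fun_prop) (by fun_prop)) (hgc (by fun_prop) (by fun_prop))) (by fun_prop))
    (this.const_mul _)) _

theorem RightReg.measurable_rightDer {α Λ : ℝ} {g : ℝ → ℝ} (h : RightReg α Λ g) (ξ : ℝ) :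
    Measurable (rightDer α g ξ) :=
  (FracVortex.measurable_rightDer (α := α) (g := fun _ => g)
    (h.meas.comp measurable_snd)).comp (f := fun x => ((0 : ℝ), ξ, x)) (by fun_prop)

theorem measurable_leftDer {α : ℝ} {f : ℝ → ℝ → ℝ} (hf : Measurable (Function.uncurry f)) :
    Measurable fun z : ℝ × ℝ => leftDer α (f z.1) z.2 := by
  have hfc : ∀ {X : Type} [MeasurableSpace X] {a b : X → ℝ}, Measurable a → Measurable b →
      Measurable fun x => f (a x) (b x) := fun ha hb => hf.comp (ha.prodMk hb)
  have := measurable_integral_Ioo (X := ℝ × ℝ) (a := fun z => 0) (b := fun z => z.2)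
    (F := fun z y => (f z.1 z.2 - f z.1 0 - (f z.1 y - f z.1 0)) / (z.2 - y) ^ (α + 1))
    (by fun_prop) (by fun_prop) (Measurable.div (Measurable.sub (Measurable.sub
      (hfc (by fun_prop) (by fun_prop)) (hfc (by fun_prop) (by fun_prop)))
      (Measurable.sub (hfc (by fun_prop) (by fun_prop)) (hfc (by fun_prop) (by fun_prop))))
      (by fun_prop))
  unfold leftDer weylDer
  refine Measurable.const_mul (Measurable.add (Measurable.div (Measurable.sub
    (hfc (by fun_prop) (by fun_prop)) (hfc (by fun_prop) (by fun_prop))) (by fun_prop))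
    (this.const_mul _)) _

/-! ### The generalized Stieltjes integral of regular functions -/

/-- The generalized Stieltjes integral over `(0,ξ)` of functions with no jumps at the endpoints. -/
def stieltjesReg (α : ℝ) (f g : ℝ → ℝ) (ξ : ℝ) : ℝ :=
  -(∫ x in Ioo 0 ξ, leftDer α f x * rightDer α g ξ x) + f 0 * (g ξ - g 0)

@[simp]
theorem stieltjesReg_zero (α : ℝ) (f g : ℝ → ℝ) : stieltjesReg α f g 0 = 0 := by
  simp [stieltjesReg]

theorem RightReg.tendsto_right {α Λ : ℝ} (hα' : α < 1) {g : ℝ → ℝ} (h : RightReg α Λ g) :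
    Tendsto g (𝓝[>] 0) (𝓝 (g 0)) := by
  rw [tendsto_iff_dist_tendsto_zero]
  have hc : Tendsto (fun x : ℝ => Λ * x ^ (1 - α)) (𝓝[>] 0) (𝓝 (Λ * (0 : ℝ) ^ (1 - α))) :=
    (((Real.continuous_rpow_const (sub_pos.2 hα').le).tendsto 0).mono_left
      nhdsWithin_le_nhds).const_mul Λ
  rw [Real.zero_rpow (sub_pos.2 hα').ne', mul_zero] at hc
  refine squeeze_zero' (Eventually.of_forall fun _ => dist_nonneg) ?_ hc
  filter_upwards [Ioc_mem_nhdsGT one_pos] with x hx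
  simpa [Real.dist_eq] using h.holder 0 x le_rfl hx.1.le hx.2

theorem RightReg.tendsto_left {α Λ : ℝ} (hα' : α < 1) {g : ℝ → ℝ} (h : RightReg α Λ g) {ξ : ℝ}
    (hξ : ξ ∈ Ioc (0 : ℝ) 1) : Tendsto g (𝓝[<] ξ) (𝓝 (g ξ)) := by
  rw [tendsto_iff_dist_tendsto_zero]
  have hc : Tendsto (fun x : ℝ => Λ * (ξ - x) ^ (1 - α)) (𝓝[<] ξ)
      (𝓝 (Λ * (ξ - ξ) ^ (1 - α))) := by
    refine Tendsto.const_mul Λ (Tendsto.mono_left ?_ nhdsWithin_le_nhds)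
    exact ((Real.continuous_rpow_const (sub_pos.2 hα').le).comp
      (continuous_const.sub continuous_id)).tendsto ξ
  rw [sub_self, Real.zero_rpow (sub_pos.2 hα').ne', mul_zero] at hc
  refine squeeze_zero' (Eventually.of_forall fun _ => dist_nonneg) ?_ hc
  filter_upwards [Ioo_mem_nhdsLT hξ.1] with x hx
  rw [Real.dist_eq, abs_sub_comm]
  exact h.holder x ξ hx.1.le hx.2.le hξ.2

section Congr

variable {α K Λ ξ : ℝ} {f g f' g' : ℝ → ℝ}

theorem LeftReg.tendsto_congr (hf : LeftReg α K f) (hξ : 0 < ξ) (hff : EqOn f' f (Ioo 0 ξ)) :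
    Tendsto f' (𝓝[>] 0) (𝓝 (f 0)) :=
  hf.lim.congr' (by filter_upwards [Ioo_mem_nhdsGT hξ] with x hx using (hff hx).symm)

theorem RightReg.tendsto_right_congr (hα' : α < 1) (hg : RightReg α Λ g) (hξ : 0 < ξ)
    (hgg : EqOn g' g (Ioo 0 ξ)) : Tendsto g' (𝓝[>] 0) (𝓝 (g 0)) :=
  (hg.tendsto_right hα').congr'
    (by filter_upwards [Ioo_mem_nhdsGT hξ] with x hx using (hgg hx).symm)

theorem RightReg.tendsto_left_congr (hα' : α < 1) (hg : RightReg α Λ g)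
    (hξ : ξ ∈ Ioc (0 : ℝ) 1) (hgg : EqOn g' g (Ioo 0 ξ)) : Tendsto g' (𝓝[<] ξ) (𝓝 (g ξ)) :=
  (hg.tendsto_left hα' hξ).congr'
    (by filter_upwards [Ioo_mem_nhdsLT hξ.1] with x hx using (hgg hx).symm)

theorem LeftReg.leftCentered_apply (hf : LeftReg α K f) (hff : EqOn f' f (Ioo 0 ξ)) {x : ℝ}
    (hx : x ∈ Ioo 0 ξ) : leftCentered 0 ξ f' x = f x - f 0 := by
  rw [leftCentered, indicator_of_mem hx, hff hx,
    rightLim_eq_of_tendsto (hf.tendsto_congr (hx.1.trans hx.2) hff)]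

theorem RightReg.rightCentered_apply (hα' : α < 1) (hg : RightReg α Λ g) (hξ : ξ ≤ 1)
    (hgg : EqOn g' g (Ioo 0 ξ)) {x : ℝ} (hx : x ∈ Ioo 0 ξ) :
    rightCentered 0 ξ g' x = g x - g ξ := by
  rw [rightCentered, indicator_of_mem hx, hgg hx,
    leftLim_eq_of_tendsto (hg.tendsto_left_congr hα' ⟨hx.1.trans hx.2, hξ⟩ hgg)]

theorem LeftReg.weylLeft_eq (hf : LeftReg α K f) (hff : EqOn f' f (Ioo 0 ξ)) {x : ℝ}
    (hx : x ∈ Ioo 0 ξ) : weylLeft α 0 ξ (leftCentered 0 ξ f') x = leftDer α f x := by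
  rw [weylLeft, indicator_of_mem hx, hf.leftCentered_apply hff hx, leftDer, weylDer, sub_zero]
  congr 3
  refine setIntegral_congr_fun measurableSet_Ioo fun y hy => ?_
  rw [hf.leftCentered_apply hff ⟨hy.1, hy.2.trans hx.2⟩]

theorem RightReg.weylRight_eq (hα' : α < 1) (hg : RightReg α Λ g) (hξ : ξ ≤ 1)
    (hgg : EqOn g' g (Ioo 0 ξ)) {x : ℝ} (hx : x ∈ Ioo 0 ξ) :
    weylRight (1 - α) 0 ξ (rightCentered 0 ξ g') x = rightDer α g ξ x := by
  rw [weylRight, indicator_of_mem hx, hg.rightCentered_apply hα' hξ hgg hx, rightDer,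
    sub_sub_cancel]
  congr 3
  refine setIntegral_congr_fun measurableSet_Ioo fun y hy => ?_
  rw [hg.rightCentered_apply hα' hξ hgg ⟨hx.1.trans hy.1, hy.2⟩, sub_sub_sub_cancel_right]

theorem integrableOn_leftDer_mul_rightDer (hα : 0 < α) (hα' : α < 1) (hf : LeftReg α K f)
    (hg : RightReg α Λ g) (hξ : ξ ≤ 1) :
    IntegrableOn (fun x => leftDer α f x * rightDer α g ξ x) (Ioo 0 ξ) := by
  have hm1 := hf.measurable_leftDer
  have hm2 := hg.measurable_rightDer ξ
  refine Integrable.of_bound (C := derConst α * K * ((Real.Gamma α)⁻¹ * (2 * Λ)))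
    (hm1.mul hm2).aestronglyMeasurable ?_
  refine (ae_restrict_iff' measurableSet_Ioo).2 (Eventually.of_forall fun x hx => ?_)
  rw [Real.norm_eq_abs, abs_mul]
  have h1 := hf.abs_leftDer_le hα hα' ⟨hx.1, hx.2.le.trans hξ⟩
  exact mul_le_mul h1 (hg.abs_rightDer_le hα hα' hξ hx) (abs_nonneg _) ((abs_nonneg _).trans h1)

theorem LeftReg.memFracLeft (hα : 0 < α) (hα' : α < 1) (hf : LeftReg α K f)
    (hξ : ξ ∈ Ioc (0 : ℝ) 1) (hff : EqOn f' f (Ioo 0 ξ)) :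
    MemFracLeft α ∞ 0 ξ (leftCentered 0 ξ f') := by
  refine ⟨leftDer α f, ?_, ?_⟩
  · refine memLp_top_of_bound hf.measurable_leftDer.aestronglyMeasurable (derConst α * K) ?_
    exact (ae_restrict_iff' measurableSet_Ioo).2 (Eventually.of_forall fun x hx =>
      hf.abs_leftDer_le hα hα' ⟨hx.1, hx.2.le.trans hξ.2⟩)
  · have := eq_fracIntLeft_weylDer hα hα' hξ.1.le (hf.meas.sub_const (f 0))
      (fun x hx => hf.abs_sub_zero_le hα ⟨hx.1, hx.2.le.trans hξ.2⟩)
      (fun x hx => hf.lintegral_centered_le hα ⟨hx.1, hx.2.le.trans hξ.2⟩)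
    filter_upwards [this, ae_restrict_mem measurableSet_Ioo] with x hx hx'
    rw [hf.leftCentered_apply hff hx', hx]
    rfl

theorem RightReg.memFracRight (hα : 0 < α) (hα' : α < 1) (hg : RightReg α Λ g)
    (hξ : ξ ∈ Ioc (0 : ℝ) 1) (hgg : EqOn g' g (Ioo 0 ξ)) :
    MemFracRight (1 - α) ∞ 0 ξ (rightCentered 0 ξ g') := by
  refine ⟨rightDer α g ξ, ?_, ?_⟩
  · refine memLp_top_of_bound (hg.measurable_rightDer ξ).aestronglyMeasurable
      ((Real.Gamma α)⁻¹ * (2 * Λ)) ?_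
    exact (ae_restrict_iff' measurableSet_Ioo).2 (Eventually.of_forall fun x hx =>
      hg.abs_rightDer_le hα hα' hξ.2 hx)
  · have hm := hg.meas
    have := eq_fracIntLeft_weylDer (sub_pos.2 hα') (by linarith) hξ.1.le
      (f := fun z => g (ξ - z) - g ξ) (by fun_prop)
      (fun x hx => hg.abs_reflect_le hξ.2 hx) (fun x hx => hg.lintegral_reflect_le hξ.2 hx)
    rw [ae_restrict_iff' measurableSet_Ioo] at this ⊢
    -- The inversion formula holds only almost everywhere; reflection preserves null sets, so it
    -- transfers to `x`.
    have h2 := (Measure.measurePreserving_sub_left volume ξ).quasiMeasurePreserving.ae this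
    filter_upwards [h2] with x hx hx'
    have hx1 := hx ⟨by linarith [hx'.2], by linarith [hx'.1]⟩
    rw [hg.rightCentered_apply hα' hξ.2 hgg hx']
    rw [sub_sub_cancel] at hx1
    rw [hx1, fracIntLeft, fracIntRight]
    congr 1
    have e := integral_Ioo_comp_sub_left (fun y => weylDer (1 - α) (fun z => g (ξ - z) - g ξ) y /
      (ξ - x - y) ^ (1 - (1 - α))) hx'.2.le ξ
    rw [sub_self] at e
    rw [← e]
    refine setIntegral_congr_fun measurableSet_Ioo fun y hy => ?_
    rw [rightDer_eq_weylDer α g hy.2]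
    congr 2
    ring

/-- Both Weyl derivatives are bounded, hence `p = q = ∞`. Agreement on the open interval is enough
because the definition sees only interior values and one-sided limits. -/
theorem stieltjesIntegrable_of_reg (hα : 0 < α) (hα' : α < 1) (hf : LeftReg α K f)
    (hg : RightReg α Λ g) (hξ : ξ ∈ Ioc (0 : ℝ) 1) (hff : EqOn f' f (Ioo 0 ξ))
    (hgg : EqOn g' g (Ioo 0 ξ)) : StieltjesIntegrable α f' g' 0 ξ where
  f_right := ⟨_, hf.tendsto_congr hξ.1 hff⟩
  g_right := ⟨_, hg.tendsto_right_congr hα' hξ.1 hgg⟩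
  g_left := ⟨_, hg.tendsto_left_congr hα' hξ hgg⟩
  mem_frac := ⟨∞, ∞, le_top, le_top, by simp, hf.memFracLeft hα hα' hξ hff,
    hg.memFracRight hα hα' hξ hgg⟩
  kernel_left := by
    refine (ae_restrict_iff' measurableSet_Ioo).2 (Eventually.of_forall fun x hx => ?_)
    refine (hf.integrableOn_kernel ⟨hx.1, hx.2.le.trans hξ.2⟩).congr_fun (fun y hy => ?_)
      measurableSet_Ioo
    simp only
    rw [hff hx, hff ⟨hy.1, hy.2.trans hx.2⟩]
  kernel_right := by
    refine (ae_restrict_iff' measurableSet_Ioo).2 (Eventually.of_forall fun x hx => ?_)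
    refine (hg.integrableOn_kernel hξ.2 hx).congr_fun (fun y hy => ?_) measurableSet_Ioo
    simp only
    rw [hgg hx, hgg ⟨hx.1.trans hy.1, hy.2⟩]
  product := by
    refine (integrableOn_leftDer_mul_rightDer hα hα' hf hg hξ.2).congr_fun (fun x hx => ?_)
      measurableSet_Ioo
    simp only
    rw [hf.weylLeft_eq hff hx, hg.weylRight_eq hα' hξ.2 hgg hx]

theorem stieltjes_eq_stieltjesReg (hα' : α < 1) (hf : LeftReg α K f) (hg : RightReg α Λ g)
    (hξ : ξ ∈ Icc (0 : ℝ) 1) (hff : EqOn f' f (Ioo 0 ξ)) (hgg : EqOn g' g (Ioo 0 ξ)) :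
    stieltjes α f' g' 0 ξ = stieltjesReg α f g ξ := by
  rcases hξ.1.eq_or_lt with rfl | h0
  · simp [stieltjes]
  · rw [stieltjes, if_pos h0, stieltjesReg, rightLim_eq_of_tendsto (hf.tendsto_congr h0 hff),
      rightLim_eq_of_tendsto (hg.tendsto_right_congr hα' h0 hgg),
      leftLim_eq_of_tendsto (hg.tendsto_left_congr hα' ⟨h0, hξ.2⟩ hgg)]
    congr 2
    refine setIntegral_congr_fun measurableSet_Ioo fun x hx => ?_
    rw [hf.weylLeft_eq hff hx, hg.weylRight_eq hα' hξ.2 hgg hx]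

end Congr

theorem stieltjesReg_sub {α K₁ K₂ Λ ξ : ℝ} (hα : 0 < α) (hα' : α < 1) {f₁ f₂ g : ℝ → ℝ}
    (h₁ : LeftReg α K₁ f₁) (h₂ : LeftReg α K₂ f₂) (hg : RightReg α Λ g) (hξ : ξ ≤ 1) :
    stieltjesReg α (fun x => f₁ x - f₂ x) g ξ = stieltjesReg α f₁ g ξ - stieltjesReg α f₂ g ξ := by
  have e : ∫ x in Ioo 0 ξ, leftDer α (fun x => f₁ x - f₂ x) x * rightDer α g ξ x =
      (∫ x in Ioo 0 ξ, leftDer α f₁ x * rightDer α g ξ x) -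
        ∫ x in Ioo 0 ξ, leftDer α f₂ x * rightDer α g ξ x := by
    rw [← integral_sub (integrableOn_leftDer_mul_rightDer hα hα' h₁ hg hξ)
      (integrableOn_leftDer_mul_rightDer hα hα' h₂ hg hξ)]
    refine setIntegral_congr_fun measurableSet_Ioo fun x hx => ?_
    rw [h₁.leftDer_sub h₂ ⟨hx.1, hx.2.le.trans hξ⟩]
    ring
  simp only [stieltjesReg]
  rw [e]
  ring

/-- The constant in the Hölder estimate of the indefinite Stieltjes integral. -/
def stieltjesConst (α : ℝ) : ℝ :=
  derConst α * (2 * (Real.Gamma α)⁻¹ + 2 * (Real.Gamma α)⁻¹ / α + 1)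

theorem stieltjesConst_pos {α : ℝ} (hα : 0 < α) (hα' : α < 1) : 0 < stieltjesConst α := by
  have h1 := one_le_derConst hα hα'
  have h2 : 0 < (Real.Gamma α)⁻¹ := inv_pos.2 (Real.Gamma_pos_of_pos hα)
  rw [stieltjesConst]
  positivity

/-- The increment has three parts, matching the summands of `stieltjesConst`: the new interval
`(η,ξ)`, where the integrand is bounded and `ξ-η ≤ (ξ-η)^(1-α)`; the change of base point of the
right derivative, where `∫ (η-x)^(α-1) ≤ 1/α`; and the boundary term `f 0 (g ξ - g η)`. -/
theorem abs_stieltjesReg_sub_le {α K Λ ξ η : ℝ} (hα : 0 < α) (hα' : α < 1) {f g : ℝ → ℝ}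
    (hf : LeftReg α K f) (hg : RightReg α Λ g) (hη : 0 ≤ η) (hηξ : η ≤ ξ) (hξ : ξ ≤ 1) :
    |stieltjesReg α f g ξ - stieltjesReg α f g η| ≤
      stieltjesConst α * Λ * K * (ξ - η) ^ (1 - α) := by
  have hΛ := hg.nonneg
  have hK := hf.bound.nonneg
  have hc := one_le_derConst hα hα'
  have hG : 0 < (Real.Gamma α)⁻¹ := inv_pos.2 (Real.Gamma_pos_of_pos hα)
  set ν := derConst α * K with hν
  have hν0 : 0 ≤ ν := by positivity
  set d := (ξ - η) ^ (1 - α) with hd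
  have hd0 : 0 ≤ d := Real.rpow_nonneg (by linarith) _
  have hdle : ξ - η ≤ d := by
    rcases (sub_nonneg.2 hηξ).eq_or_lt with h | h
    · rw [← h]
      exact hd0
    · calc ξ - η = (ξ - η) ^ (1 : ℝ) := (Real.rpow_one _).symm
        _ ≤ d := Real.rpow_le_rpow_of_exponent_ge h (by linarith) (by linarith)
  have hu : ∀ x ∈ Ioc (0 : ℝ) 1, |leftDer α f x| ≤ ν := fun x hx => hf.abs_leftDer_le hα hα' hx
  have iξ := integrableOn_leftDer_mul_rightDer hα hα' hf hg hξ
  have iη := integrableOn_leftDer_mul_rightDer hα hα' hf hg (hηξ.trans hξ)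
  have iξη : IntegrableOn (fun x => leftDer α f x * rightDer α g ξ x) (Ioo 0 η) :=
    iξ.mono_set (Ioo_subset_Ioo_right hηξ)
  have split : ∫ x in Ioo 0 ξ, leftDer α f x * rightDer α g ξ x =
      (∫ x in Ioo 0 η, leftDer α f x * rightDer α g ξ x) +
        ∫ x in Ioo η ξ, leftDer α f x * rightDer α g ξ x := by
    have hi' := (intervalIntegrable_iff_integrableOn_Ioo_of_le (hη.trans hηξ)).2 iξ
    simp only [← integral_Ioc_eq_integral_Ioo]
    rw [← intervalIntegral.integral_of_le hη, ← intervalIntegral.integral_of_le hηξ,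
      ← intervalIntegral.integral_of_le (hη.trans hηξ)]
    refine (intervalIntegral.integral_add_adjacent_intervals ?_ ?_).symm
    · exact hi'.mono_set (by
        rw [uIcc_of_le hη, uIcc_of_le (hη.trans hηξ)]
        exact Icc_subset_Icc_right hηξ)
    · exact hi'.mono_set (by
        rw [uIcc_of_le hηξ, uIcc_of_le (hη.trans hηξ)]
        exact Icc_subset_Icc_left hη)
  have t1 : |∫ x in Ioo η ξ, leftDer α f x * rightDer α g ξ x| ≤
      ν * ((Real.Gamma α)⁻¹ * (2 * Λ)) * d := by
    have h1 : ‖∫ x in Ioo η ξ, leftDer α f x * rightDer α g ξ x‖ ≤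
        ν * ((Real.Gamma α)⁻¹ * (2 * Λ)) * volume.real (Ioo η ξ) := by
      refine norm_setIntegral_le_of_norm_le_const (by simp) fun x hx => ?_
      have hx0 : 0 < x := hη.trans_lt hx.1
      rw [Real.norm_eq_abs, abs_mul]
      exact mul_le_mul (hu x ⟨hx0, hx.2.le.trans hξ⟩)
        (hg.abs_rightDer_le hα hα' hξ ⟨hx0, hx.2⟩) (abs_nonneg _) hν0
    rw [Real.volume_real_Ioo_of_le hηξ] at h1
    exact h1.trans (mul_le_mul_of_nonneg_left hdle (by positivity))
  have t2 : |(∫ x in Ioo 0 η, leftDer α f x * rightDer α g ξ x) -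
      ∫ x in Ioo 0 η, leftDer α f x * rightDer α g η x| ≤
      ν * (2 * (Real.Gamma α)⁻¹ * Λ * d) * (1 / α) := by
    rw [← integral_sub iξη iη, ← Real.norm_eq_abs]
    have hki : IntegrableOn (fun x => ν * (2 * (Real.Gamma α)⁻¹ * Λ * d) * (η - x) ^ (α - 1))
        (Ioo 0 η) := Integrable.const_mul (integrableOn_sub_rpow (by linarith) hη) _
    refine (norm_integral_le_of_norm_le hki ?_).trans ?_
    · refine (ae_restrict_iff' measurableSet_Ioo).2 (Eventually.of_forall fun x hx => ?_)
      rw [← mul_sub, Real.norm_eq_abs, abs_mul, mul_assoc]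
      exact mul_le_mul (hu x ⟨hx.1, by linarith [hx.2]⟩)
        (hg.abs_rightDer_sub_le hα hα' hx hηξ hξ) (abs_nonneg _) hν0
    · rw [integral_const_mul, integral_sub_rpow (by linarith) hη]
      refine mul_le_mul_of_nonneg_left ?_ (by positivity)
      rw [sub_add_cancel, sub_zero]
      exact div_le_div_of_nonneg_right (Real.rpow_le_one hη (hηξ.trans hξ) hα.le) hα.le
  have t3 : |f 0 * (g ξ - g η)| ≤ ν * (Λ * d) := by
    rw [abs_mul]
    refine mul_le_mul (hf.abs_zero_le.trans ?_) (hg.holder η ξ hη hηξ hξ) (abs_nonneg _) hν0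
    rw [hν]
    nlinarith
  have e : stieltjesReg α f g ξ - stieltjesReg α f g η =
      -(∫ x in Ioo η ξ, leftDer α f x * rightDer α g ξ x) -
      ((∫ x in Ioo 0 η, leftDer α f x * rightDer α g ξ x) -
        ∫ x in Ioo 0 η, leftDer α f x * rightDer α g η x) + f 0 * (g ξ - g η) := by
    rw [stieltjesReg, stieltjesReg, split]
    ring
  rw [e]
  refine (abs_add_le _ _).trans ((add_le_add ((abs_sub _ _).trans (add_le_add
    ((abs_neg _).trans_le t1) t2)) t3).trans (le_of_eq ?_))
  rw [stieltjesConst, hν]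
  ring

theorem measurable_stieltjesReg {α : ℝ} {f g : ℝ → ℝ → ℝ} (hf : Measurable (Function.uncurry f))
    (hg : Measurable (Function.uncurry g)) :
    Measurable fun z : ℝ × ℝ => stieltjesReg α (f z.1) (g z.1) z.2 := by
  have hfc : ∀ {X : Type} [MeasurableSpace X] {a b : X → ℝ}, Measurable a → Measurable b →
      Measurable fun x => f (a x) (b x) := fun ha hb => hf.comp (ha.prodMk hb)
  have hgc : ∀ {X : Type} [MeasurableSpace X] {a b : X → ℝ}, Measurable a → Measurable b →
      Measurable fun x => g (a x) (b x) := fun ha hb => hg.comp (ha.prodMk hb)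
  have h1 := measurable_leftDer (α := α) hf
  have h2 := measurable_rightDer (α := α) hg
  have := measurable_integral_Ioo (X := ℝ × ℝ) (a := fun z => 0) (b := fun z => z.2)
    (F := fun z x => leftDer α (f z.1) x * rightDer α (g z.1) z.2 x) (by fun_prop) (by fun_prop)
    (Measurable.mul (h1.comp (f := fun z : (ℝ × ℝ) × ℝ => (z.1.1, z.2)) (by fun_prop))
      (h2.comp (f := fun z : (ℝ × ℝ) × ℝ => (z.1.1, z.1.2, z.2)) (by fun_prop)))
  unfold stieltjesReg
  exact this.neg.add ((hfc (by fun_prop) (by fun_prop)).mul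
    ((hgc (by fun_prop) (by fun_prop)).sub (hgc (by fun_prop) (by fun_prop))))

/-! ### Regularization at the endpoints -/

theorem measurable_indicator_of_domRestrict {X : Type*} [MeasurableSpace X] {s : Set X}
    {f : X → ℝ} (hs : MeasurableSet s) (hf : Measurable (s.domRestrict f)) :
    Measurable (s.indicator f) := by
  refine measurable_of_restrict_of_restrict_compl hs ?_ ?_
  · convert hf using 1
    ext x
    simp
  · convert (measurable_const : Measurable fun _ : ↥sᶜ => (0 : ℝ)) using 1
    ext x
    simpa using fun h => absurd h x.2

theorem exists_tendsto_nhdsGT_zero {f : ℝ → ℝ} {C p : ℝ} (hp : 0 < p)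
    (h : ∀ x y : ℝ, 0 < y → y ≤ x → x < 1 → |f x - f y| ≤ C * x ^ p) :
    ∃ l, Tendsto f (𝓝[>] 0) (𝓝 l) := by
  rw [← cauchy_map_iff_exists_tendsto, Metric.cauchy_iff]
  refine ⟨inferInstance, fun ε hε => ?_⟩
  have hC : 0 ≤ C := by
    have h1 := (abs_nonneg _).trans (h (1 / 2) (1 / 2) (by norm_num) le_rfl (by norm_num))
    by_contra h2
    have : (0 : ℝ) < (1 / 2) ^ p := by positivity
    nlinarith
  have hc : Tendsto (fun x : ℝ => C * x ^ p) (𝓝[>] 0) (𝓝 (C * (0 : ℝ) ^ p)) :=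
    (((Real.continuous_rpow_const hp.le).tendsto 0).mono_left nhdsWithin_le_nhds).const_mul C
  rw [Real.zero_rpow hp.ne', mul_zero] at hc
  obtain ⟨δ, hδ1, hδ2⟩ := ((hc.eventually (gt_mem_nhds hε)).and (Ioo_mem_nhdsGT one_pos)).exists
  refine ⟨f '' Ioc 0 δ, image_mem_map (Ioc_mem_nhdsGT hδ2.1), ?_⟩
  have key : ∀ x ∈ Ioc 0 δ, ∀ y ∈ Ioc 0 δ, y ≤ x → |f x - f y| < ε := by
    intro x hx y hy hyx
    refine (h x y hy.1 hyx (hx.2.trans_lt hδ2.2)).trans_lt (lt_of_le_of_lt ?_ hδ1)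
    exact mul_le_mul_of_nonneg_left (Real.rpow_le_rpow hx.1.le hx.2 hp.le) hC
  rintro _ ⟨x, hx, rfl⟩ _ ⟨y, hy, rfl⟩
  rw [Real.dist_eq]
  rcases le_total y x with hyx | hxy
  · exact key x hx y hy hyx
  · rw [abs_sub_comm]
    exact key y hy x hx hxy

/-- A countable sequence approaching `0` from inside `(0,1)`; along it the one-sided limits become
sequential, hence measurable in `s`. -/
theorem tendsto_one_div_add_two_nhdsGT :
    Tendsto (fun n : ℕ => 1 / ((n : ℝ) + 2)) atTop (𝓝[>] 0) := by
  refine tendsto_nhdsWithin_iff.2 ⟨?_, Eventually.of_forall fun n => ?_⟩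
  · have := (tendsto_add_atTop_iff_nat 1).2 (tendsto_one_div_add_atTop_nhds_zero_nat (𝕜 := ℝ))
    refine this.congr fun n => ?_
    push_cast
    congr 1
    ring
  · have : (0 : ℝ) < 1 / ((n : ℝ) + 2) := by positivity
    exact this

theorem WBound.of_normW_le {α K : ℝ} {f : ℝ → ℝ} (h : normW α f ≤ ENNReal.ofReal K)
    (hK : 0 ≤ K) : WBound α K f := by
  intro x hx
  have h1 := (le_iSup₂ (f := fun ξ (_ : ξ ∈ Icc (0 : ℝ) 1) => ENNReal.ofReal |f ξ| +
    ∫⁻ η in Ioo 0 ξ, ENNReal.ofReal (|f ξ - f η| / (ξ - η) ^ (α + 1))) x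
    ⟨hx.1.le, hx.2⟩).trans h
  exact ⟨(ENNReal.ofReal_le_ofReal_iff hK).1 (le_self_add.trans h1), le_add_self.trans h1⟩

theorem WBound.normW_le {α K : ℝ} {f : ℝ → ℝ} (h : WBound α K f) :
    normW α f ≤ ENNReal.ofReal (|f 0| + 2 * K) := by
  have hK := h.nonneg
  refine iSup₂_le fun x hx => ?_
  rcases hx.1.eq_or_lt with rfl | h0
  · simp only [Ioo_self, Measure.restrict_empty, lintegral_zero_measure, add_zero]
    exact ENNReal.ofReal_le_ofReal (by linarith)
  · refine (add_le_add (ENNReal.ofReal_le_ofReal (h x ⟨h0, hx.2⟩).1) (h x ⟨h0, hx.2⟩).2).trans ?_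
    rw [← ENNReal.ofReal_add hK hK]
    exact ENNReal.ofReal_le_ofReal (by linarith [abs_nonneg (f 0)])

theorem normW_congr {α : ℝ} {f f' : ℝ → ℝ} (h : EqOn f' f (Icc 0 1)) :
    normW α f' = normW α f := by
  refine iSup_congr fun x => iSup_congr fun hx => ?_
  rw [h hx]
  congr 1
  refine setLIntegral_congr_fun measurableSet_Ioo fun y hy => ?_
  rw [h ⟨hy.1.le, hy.2.le.trans hx.2⟩]

/-- `Y` is cut off to `0` outside `[0,T] × [0,1]`, making it jointly measurable on the plane, and
then redefined for `x ≤ 0` by its right limit at `0`. The bound concerns only `(0,1]` and is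
unaffected. -/
theorem MemCW.exists_leftReg {α T : ℝ} (hα : 0 < α) {Y : ℝ → ℝ → ℝ} (hY : MemCW α T Y) :
    ∃ (Y' : ℝ → ℝ → ℝ) (K : ℝ), Measurable (Function.uncurry Y') ∧
      (∀ s ∈ Icc 0 T, ∀ x ∈ Ioc (0 : ℝ) 1, Y' s x = Y s x) ∧ ∀ s, LeftReg α K (Y' s) := by
  set K := (⨆ t ∈ Icc 0 T, normW α (Y t)).toReal with hK
  have hK0 : 0 ≤ K := ENNReal.toReal_nonneg
  let Y₁ : ℝ → ℝ → ℝ := fun s x =>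
    (Icc 0 T ×ˢ Icc (0 : ℝ) 1).indicator (fun p : ℝ × ℝ => Y p.1 p.2) (s, x)
  have hm : Measurable (Function.uncurry Y₁) :=
    measurable_indicator_of_domRestrict (measurableSet_Icc.prod measurableSet_Icc) hY.1
  have hms : ∀ s, Measurable (Y₁ s) := fun s => hm.comp (f := fun x => (s, x)) (by fun_prop)
  have hin : ∀ s ∈ Icc 0 T, EqOn (Y₁ s) (Y s) (Icc 0 1) := fun s hs x hx =>
    indicator_of_mem (show (s, x) ∈ Icc 0 T ×ˢ Icc (0 : ℝ) 1 from ⟨hs, hx⟩) _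
  have hW : ∀ s, WBound α K (Y₁ s) := by
    intro s
    by_cases hs : s ∈ Icc 0 T
    · refine WBound.of_normW_le ?_ hK0
      rw [normW_congr (hin s hs), hK, ENNReal.ofReal_toReal hY.2.ne]
      exact le_iSup₂ (f := fun t (_ : t ∈ Icc 0 T) => normW α (Y t)) s hs
    · have : ∀ x, Y₁ s x = 0 := fun x => indicator_of_notMem (fun h => hs h.1) _
      intro x _
      simp [this, hK0]
  choose l hl using fun s => exists_tendsto_nhdsGT_zero hα
    (fun x y hy hyx hx => (hW s).abs_sub_le hα (hms s) hy hyx hx.le)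
  have hlm : Measurable l := by
    refine measurable_of_tendsto_metrizable (f := fun (n : ℕ) s => Y₁ s (1 / ((n : ℝ) + 2)))
      (fun n => hm.comp (f := fun s => (s, 1 / ((n : ℝ) + 2))) (by fun_prop)) ?_
    rw [tendsto_pi_nhds]
    exact fun s => (hl s).comp tendsto_one_div_add_two_nhdsGT
  have hpos : ∀ s x : ℝ, 0 < x → (if x ≤ 0 then l s else Y₁ s x) = Y₁ s x := fun s x hx =>
    if_neg (not_le.2 hx)
  refine ⟨fun s x => if x ≤ 0 then l s else Y₁ s x, K, ?_, ?_, ?_⟩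
  · refine Measurable.ite (measurableSet_le measurable_snd measurable_const) ?_ hm
    exact hlm.comp measurable_fst
  · intro s hs x hx
    simp only [hpos s x hx.1]
    exact hin s hs ⟨hx.1.le, hx.2⟩
  · intro s
    refine ⟨Measurable.ite measurableSet_Iic measurable_const (hms s), ?_,
      (hW s).congr fun x hx => hpos s x hx.1⟩
    simp only [le_refl, if_true]
    refine (hl s).congr' ?_
    filter_upwards [self_mem_nhdsWithin] with x hx using (hpos s x hx).symm

theorem MemW.exists_leftReg {α : ℝ} (hα : 0 < α) {φ : ℝ → ℝ} (hφ : MemW α φ) :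
    ∃ (φ' : ℝ → ℝ) (K : ℝ), (∀ x ∈ Ioc (0 : ℝ) 1, φ' x = φ x) ∧ LeftReg α K φ' := by
  -- `φ` is treated as a time-independent function on the degenerate time interval `[0,0]`.
  have h : MemCW α 0 fun _ => φ := by
    refine ⟨?_, ?_⟩
    · exact hφ.1.comp (f := fun p : ↥(Icc (0 : ℝ) 0 ×ˢ Icc (0 : ℝ) 1) =>
        (⟨p.1.2, p.2.2⟩ : ↥(Icc (0 : ℝ) 1)))
        ((measurable_snd.comp measurable_subtype_coe).subtype_mk)
    · simpa using hφ.2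
  obtain ⟨Y', K, -, h2, h3⟩ := h.exists_leftReg hα
  exact ⟨Y' 0, K, h2 0 (by simp), h3 0⟩

/-- The Hölder bound passes to the endpoints by continuity there, and the kernel bound passes to `ξ
= 1` by monotone convergence. -/
theorem RightReg.of_interior {α Λ : ℝ} (hα' : α < 1) {g : ℝ → ℝ} (hm : Measurable g) (hΛ : 0 ≤ Λ)
    (h0 : Tendsto g (𝓝[>] 0) (𝓝 (g 0))) (h1 : Tendsto g (𝓝[<] 1) (𝓝 (g 1)))
    (hh : ∀ η ξ : ℝ, 0 < η → η < ξ → ξ < 1 → |g ξ - g η| ≤ Λ * (ξ - η) ^ (1 - α))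
    (hk : ∀ η ξ : ℝ, 0 < η → η < ξ → ξ < 1 →
      ∫⁻ y in Ioo η ξ, ENNReal.ofReal (|g η - g y| / (y - η) ^ (1 - α + 1)) ≤
        ENNReal.ofReal Λ) : RightReg α Λ g := by
  have hβ : 0 < 1 - α := sub_pos.2 hα'
  have hleft : ∀ η ξ : ℝ, 0 ≤ η → η < ξ → ξ < 1 → |g ξ - g η| ≤ Λ * (ξ - η) ^ (1 - α) := by
    intro η ξ hη hηξ hξ
    rcases hη.eq_or_lt with rfl | hη
    · refine le_of_tendsto_of_tendsto (h0.const_sub (g ξ)).abs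
        (g := fun y => Λ * (ξ - y) ^ (1 - α)) (b := 𝓝[>] 0) ?_ ?_
      · refine Tendsto.const_mul Λ (Tendsto.mono_left ?_ nhdsWithin_le_nhds)
        exact ((Real.continuous_rpow_const hβ.le).comp
          (continuous_const.sub continuous_id)).tendsto 0
      · filter_upwards [Ioo_mem_nhdsGT hηξ] with y hy using hh y ξ hy.1 hy.2 hξ
    · exact hh η ξ hη hηξ hξ
  refine ⟨hm, fun η ξ hη hηξ hξ => ?_, fun η ξ hη hηξ hξ => ?_⟩
  · rcases hηξ.eq_or_lt with rfl | hηξ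
    · rw [sub_self, abs_zero]
      exact mul_nonneg hΛ (Real.rpow_nonneg (by simp) _)
    rcases hξ.eq_or_lt with rfl | hξ
    · refine le_of_tendsto_of_tendsto (h1.sub_const (g η)).abs
        (g := fun y => Λ * (y - η) ^ (1 - α)) (b := 𝓝[<] 1) ?_ ?_
      · refine Tendsto.const_mul Λ (Tendsto.mono_left ?_ nhdsWithin_le_nhds)
        exact ((Real.continuous_rpow_const hβ.le).comp
          (continuous_id.sub continuous_const)).tendsto 1
      · filter_upwards [Ioo_mem_nhdsLT hηξ] with y hy using hleft η y hη hy.1 hy.2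
    · exact hleft η ξ hη hηξ hξ
  · rcases hξ.eq_or_lt with rfl | hξ
    · set F : ℝ → ℝ≥0∞ := fun y => ENNReal.ofReal (|g η - g y| / (y - η) ^ (1 - α + 1))
      have hU : Ioo η 1 = ⋃ n : ℕ, Ioo η (1 - 1 / ((n : ℝ) + 1)) := by
        ext y
        simp only [mem_Ioo, mem_iUnion]
        constructor
        · rintro ⟨hy1, hy2⟩
          obtain ⟨n, hn⟩ := exists_nat_one_div_lt (sub_pos.2 hy2)
          exact ⟨n, hy1, by linarith⟩
        · rintro ⟨n, hy1, hy2⟩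
          have : (0 : ℝ) < 1 / ((n : ℝ) + 1) := by positivity
          exact ⟨hy1, by linarith⟩
      have hmono : Monotone fun n : ℕ => Ioo η (1 - 1 / ((n : ℝ) + 1)) := by
        intro n m hnm
        refine Ioo_subset_Ioo_right ?_
        have := Nat.one_div_le_one_div (α := ℝ) hnm
        linarith
      -- Viewing `F` as a density turns the monotone limit into continuity of a measure along an
      -- increasing union.
      rw [← withDensity_apply F measurableSet_Ioo, hU, hmono.measure_iUnion]
      refine iSup_le fun n => ?_
      rw [withDensity_apply F measurableSet_Ioo]
      rcases lt_or_ge η (1 - 1 / ((n : ℝ) + 1)) with h | h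
      · have : (0 : ℝ) < 1 / ((n : ℝ) + 1) := by positivity
        exact hk η _ hη h (by linarith)
      · rw [Ioo_eq_empty (not_lt.2 h)]
        simp
    · exact hk η ξ hη hηξ hξ

theorem MemCW0.exists_rightReg {α T : ℝ} (hα' : α < 1) {g : ℝ → ℝ → ℝ} (hg : MemCW0 α T g) :
    ∃ (g' : ℝ → ℝ → ℝ) (Λ : ℝ), Measurable (Function.uncurry g') ∧
      (∀ s ∈ Icc 0 T, ∀ x ∈ Ioo (0 : ℝ) 1, g' s x = g s x) ∧ ∀ s, RightReg α Λ (g' s) := by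
  have hβ : 0 < 1 - α := sub_pos.2 hα'
  set Λ := (⨆ t ∈ Icc 0 T, normW0 α (g t)).toReal with hΛ
  have hΛ0 : 0 ≤ Λ := ENNReal.toReal_nonneg
  let g₁ : ℝ → ℝ → ℝ := fun s x =>
    (Icc 0 T ×ˢ Icc (0 : ℝ) 1).indicator (fun p : ℝ × ℝ => g p.1 p.2) (s, x)
  have hm : Measurable (Function.uncurry g₁) :=
    measurable_indicator_of_domRestrict (measurableSet_Icc.prod measurableSet_Icc) hg.1
  have hms : ∀ s, Measurable (g₁ s) := fun s => hm.comp (f := fun x => (s, x)) (by fun_prop)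
  have hin : ∀ s ∈ Icc 0 T, EqOn (g₁ s) (g s) (Icc 0 1) := fun s hs x hx =>
    indicator_of_mem (show (s, x) ∈ Icc 0 T ×ˢ Icc (0 : ℝ) 1 from ⟨hs, hx⟩) _
  have hW : ∀ s, ∀ η ξ : ℝ, 0 < η → η < ξ → ξ < 1 →
      |g₁ s ξ - g₁ s η| ≤ Λ * (ξ - η) ^ (1 - α) ∧
      ∫⁻ y in Ioo η ξ, ENNReal.ofReal (|g₁ s η - g₁ s y| / (y - η) ^ (1 - α + 1)) ≤
        ENNReal.ofReal Λ := by
    intro s η ξ hη hηξ hξ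
    have hp : 0 < (ξ - η) ^ (1 - α) := Real.rpow_pos_of_pos (sub_pos.2 hηξ) _
    by_cases hs : s ∈ Icc 0 T
    · have h1 : ENNReal.ofReal (|g s ξ - g s η| / (ξ - η) ^ (1 - α)) +
          ∫⁻ γ in Ioo η ξ, ENNReal.ofReal (|g s γ - g s η| / (γ - η) ^ (2 - α)) ≤
          ENNReal.ofReal Λ := by
        rw [hΛ, ENNReal.ofReal_toReal hg.2.ne]
        refine le_trans ?_ (le_iSup₂ (f := fun t (_ : t ∈ Icc 0 T) => normW0 α (g t)) s hs)
        exact le_iSup_of_le ξ (le_iSup_of_le η (le_iSup_of_le ⟨hη, hηξ, hξ⟩ le_rfl))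
      constructor
      · have h2 := (ENNReal.ofReal_le_ofReal_iff hΛ0).1 (le_self_add.trans h1)
        rw [div_le_iff₀ hp] at h2
        rwa [hin s hs ⟨(hη.trans hηξ).le, hξ.le⟩, hin s hs ⟨hη.le, (hηξ.trans hξ).le⟩]
      · refine le_trans (le_of_eq ?_) (le_add_self.trans h1)
        refine setLIntegral_congr_fun measurableSet_Ioo fun y hy => ?_
        have e : 1 - α + 1 = 2 - α := by ring
        rw [hin s hs ⟨hη.le, (hηξ.trans hξ).le⟩,
          hin s hs ⟨(hη.trans hy.1).le, (hy.2.trans hξ).le⟩, abs_sub_comm, e]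
    · have : ∀ x, g₁ s x = 0 := fun x => indicator_of_notMem (fun h => hs h.1) _
      simp only [this, sub_self, abs_zero, zero_div, ENNReal.ofReal_zero, lintegral_zero,
        zero_le, and_true]
      positivity
  have hW' : ∀ s, ∀ η ξ : ℝ, 0 < η → η ≤ ξ → ξ < 1 →
      |g₁ s ξ - g₁ s η| ≤ Λ * (ξ - η) ^ (1 - α) := by
    intro s η ξ hη hηξ hξ
    rcases hηξ.eq_or_lt with rfl | h
    · rw [sub_self, abs_zero]
      exact mul_nonneg hΛ0 (Real.rpow_nonneg (by simp) _)
    · exact (hW s η ξ hη h hξ).1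
  choose l hl using fun s => exists_tendsto_nhdsGT_zero hβ (f := g₁ s) (C := Λ)
    (fun x y hy hyx hx => (hW' s y x hy hyx hx).trans (mul_le_mul_of_nonneg_left
      (Real.rpow_le_rpow (by linarith) (by linarith) hβ.le) hΛ0))
  choose r hr using fun s => exists_tendsto_nhdsGT_zero hβ (f := fun x => g₁ s (1 - x)) (C := Λ)
    (fun x y hy hyx hx => by
      rw [abs_sub_comm]
      refine (hW' s (1 - x) (1 - y) (by linarith) (by linarith) (by linarith)).trans
        (mul_le_mul_of_nonneg_left (Real.rpow_le_rpow (by linarith) (by linarith) hβ.le) hΛ0))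
  have hlm : Measurable l := by
    refine measurable_of_tendsto_metrizable (f := fun (n : ℕ) s => g₁ s (1 / ((n : ℝ) + 2)))
      (fun n => hm.comp (f := fun s => (s, 1 / ((n : ℝ) + 2))) (by fun_prop)) ?_
    rw [tendsto_pi_nhds]
    exact fun s => (hl s).comp tendsto_one_div_add_two_nhdsGT
  have hrm : Measurable r := by
    refine measurable_of_tendsto_metrizable (f := fun (n : ℕ) s => g₁ s (1 - 1 / ((n : ℝ) + 2)))
      (fun n => hm.comp (f := fun s => (s, 1 - 1 / ((n : ℝ) + 2))) (by fun_prop)) ?_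
    rw [tendsto_pi_nhds]
    exact fun s => (hr s).comp tendsto_one_div_add_two_nhdsGT
  let g' : ℝ → ℝ → ℝ := fun s x => if x ≤ 0 then l s else if 1 ≤ x then r s else g₁ s x
  have hmid : ∀ s, ∀ x ∈ Ioo (0 : ℝ) 1, g' s x = g₁ s x := fun s x hx => by
    simp only [g', if_neg (not_le.2 hx.1), if_neg (not_le.2 hx.2)]
  have hm' : Measurable (Function.uncurry g') := by
    refine Measurable.ite (measurableSet_le measurable_snd measurable_const)
      (hlm.comp measurable_fst) ?_
    exact Measurable.ite (measurableSet_le measurable_const measurable_snd)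
      (hrm.comp measurable_fst) hm
  refine ⟨g', Λ, hm', ?_, ?_⟩
  · intro s hs x hx
    rw [hmid s x hx]
    exact hin s hs ⟨hx.1.le, hx.2.le⟩
  · intro s
    refine RightReg.of_interior hα' (hm'.comp (f := fun x => (s, x)) (by fun_prop)) hΛ0 ?_ ?_ ?_ ?_
    · have e : g' s 0 = l s := by simp [g']
      rw [e]
      refine (hl s).congr' ?_
      filter_upwards [Ioo_mem_nhdsGT one_pos] with x hx using (hmid s x hx).symm
    · have e : g' s 1 = r s := by simp [g']
      rw [e]
      have ht : Tendsto (fun x : ℝ => 1 - x) (𝓝[<] 1) (𝓝[>] 0) := by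
        refine tendsto_nhdsWithin_iff.2 ⟨?_, ?_⟩
        · have : Tendsto (fun x : ℝ => 1 - x) (𝓝 1) (𝓝 (1 - 1)) :=
            tendsto_const_nhds.sub tendsto_id
          rw [sub_self] at this
          exact this.mono_left nhdsWithin_le_nhds
        · filter_upwards [self_mem_nhdsWithin] with x hx
          simpa using hx
      refine ((hr s).comp ht).congr' ?_
      filter_upwards [Ioo_mem_nhdsLT one_pos] with x hx
      simp only [Function.comp, sub_sub_cancel]
      exact (hmid s x hx).symm
    · intro η ξ hη hηξ hξ
      rw [hmid s η ⟨hη, hηξ.trans hξ⟩, hmid s ξ ⟨hη.trans hηξ, hξ⟩]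
      exact (hW s η ξ hη hηξ hξ).1
    · intro η ξ hη hηξ hξ
      refine le_trans (le_of_eq ?_) (hW s η ξ hη hηξ hξ).2
      refine setLIntegral_congr_fun measurableSet_Ioo fun y hy => ?_
      rw [hmid s η ⟨hη, hηξ.trans hξ⟩, hmid s y ⟨hη.trans hy.1, hy.2.trans hξ⟩]

/-! ### Composition with the nonlinearity -/

/-- One mean value theorem, applied to the difference of `A` along the segments from `c` to `a` and
from `d` to `b`, yields a common `θ`. The local Lipschitz bound on `A'` then compares the two
derivatives at corresponding points. -/
theorem abs_comp_second_difference_le {A : ℝ → ℝ} (hA : Differentiable ℝ A) {M₁ M N : ℝ}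
    (hM₁ : 0 < M₁) (hL : ∀ x y : ℝ, |A x - A y| ≤ M₁ * |x - y|) (hM : 0 ≤ M)
    (hd : ∀ x y : ℝ, |x| ≤ N → |y| ≤ N → |deriv A x - deriv A y| ≤ M * |x - y|)
    {a b c d : ℝ} (ha : |a| ≤ N) (hb : |b| ≤ N) (hc : |c| ≤ N) (hd' : |d| ≤ N) :
    |(A a - A c) - (A b - A d)| ≤
      M₁ * |(a - c) - (b - d)| + M * |a - c| * (|a - b| + |c - d|) := by
  have hder : ∀ θ : ℝ, HasDerivAt (fun θ => A (c + θ * (a - c)) - A (d + θ * (b - d)))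
      (deriv A (c + θ * (a - c)) * (a - c) - deriv A (d + θ * (b - d)) * (b - d)) θ := by
    intro θ
    have h1 : ∀ p q : ℝ, HasDerivAt (fun θ => p + θ * q) q θ := fun p q => by
      simpa using ((hasDerivAt_id θ).mul_const q).const_add p
    exact ((hA _).hasDerivAt.comp θ (h1 c (a - c))).sub ((hA _).hasDerivAt.comp θ (h1 d (b - d)))
  obtain ⟨θ, hθ, e⟩ := exists_hasDerivAt_eq_slope
    (fun θ => A (c + θ * (a - c)) - A (d + θ * (b - d))) _ zero_lt_one
    (fun θ _ => (hder θ).continuousAt.continuousWithinAt) (fun θ _ => hder θ)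
  set p := c + θ * (a - c) with hp
  set q := d + θ * (b - d) with hq
  have hconv : ∀ u v : ℝ, |u| ≤ N → |v| ≤ N → |u + θ * (v - u)| ≤ N := by
    intro u v hu hv
    rw [abs_le] at hu hv ⊢
    have h1 := hθ.1
    have h2 := hθ.2
    constructor <;> nlinarith
  have hq1 : |deriv A q| ≤ M₁ := by
    rw [← Real.norm_eq_abs]
    refine norm_deriv_le_of_lip' hM₁.le (Eventually.of_forall fun x => ?_)
    simpa using hL x q
  have hpq : |deriv A p - deriv A q| ≤ M * (|a - b| + |c - d|) := by
    refine (hd p q (hconv c a hc ha) (hconv d b hd' hb)).trans (mul_le_mul_of_nonneg_left ?_ hM)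
    have e2 : p - q = θ * (a - b) + (1 - θ) * (c - d) := by rw [hp, hq]; ring
    have h1 := hθ.1
    have h2 := hθ.2
    rw [e2]
    refine (abs_add_le _ _).trans ?_
    rw [abs_mul, abs_mul, abs_of_pos h1, abs_of_pos (sub_pos.2 h2)]
    have := abs_nonneg (a - b)
    have := abs_nonneg (c - d)
    nlinarith
  have e3 : (A a - A c) - (A b - A d) =
      deriv A q * ((a - c) - (b - d)) + (deriv A p - deriv A q) * (a - c) := by
    simp only [one_mul, zero_mul, add_zero, sub_zero, div_one, add_sub_cancel] at e
    linear_combination -e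
  rw [e3]
  refine (abs_add_le _ _).trans ?_
  rw [abs_mul, abs_mul]
  refine add_le_add (mul_le_mul_of_nonneg_right hq1 (abs_nonneg _)) ?_
  refine (mul_le_mul_of_nonneg_right hpq (abs_nonneg _)).trans (le_of_eq ?_)
  ring

/-- The bound is affine in `K`, which is what excludes blow-up of the Picard iterates on `[0,T]`. -/
theorem LeftReg.comp {α K M₁ M₂ : ℝ} {A f : ℝ → ℝ} (hA : Continuous A) (hM₁ : 0 < M₁)
    (hL : ∀ x y : ℝ, |A x - A y| ≤ M₁ * |x - y|) (hM₂ : ∀ x : ℝ, |A x| ≤ M₂)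
    (hf : LeftReg α K f) : LeftReg α (M₂ + M₁ * K) fun x => A (f x) := by
  have hK := hf.bound.nonneg
  have hM₂0 : 0 ≤ M₂ := (abs_nonneg _).trans (hM₂ 0)
  refine ⟨hA.measurable.comp hf.meas, (hA.tendsto _).comp hf.lim, ?_⟩
  refine WBound.of_abs_le hf.meas hf.bound hf.bound hM₁.le le_rfl (by linarith) ?_ ?_
  · intro x _
    exact (hM₂ _).trans (le_add_of_nonneg_right (by positivity))
  · intro x _ y _
    simpa using hL (f x) (f y)

theorem WBound.comp_sub {α N D M₁ M : ℝ} {A f h : ℝ → ℝ} (hA : Differentiable ℝ A)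
    (hM₁ : 0 < M₁) (hL : ∀ x y : ℝ, |A x - A y| ≤ M₁ * |x - y|) (hM : 0 ≤ M)
    (hd : ∀ x y : ℝ, |x| ≤ N → |y| ≤ N → |deriv A x - deriv A y| ≤ M * |x - y|)
    (hf : LeftReg α N f) (hh : LeftReg α N h) (hD : WBound α D fun x => f x - h x) :
    WBound α ((M₁ + 4 * M * N) * D) fun x => A (f x) - A (h x) := by
  have hN := hf.bound.nonneg
  have hD0 := hD.nonneg
  refine WBound.of_abs_le (hf.meas.sub hh.meas) hD hf.bound (c₁ := M₁ + 2 * M * N)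
    (c₂ := 2 * M * D) (by positivity) (by positivity) (le_of_eq (by ring)) ?_ ?_
  · intro x hx
    refine (hL _ _).trans ?_
    have h1 := (hD x hx).1
    have h2 : 0 ≤ 4 * M * N * D := by positivity
    nlinarith
  · intro x hx y hy
    have hy' : y ∈ Ioc (0 : ℝ) 1 := ⟨hy.1, hy.2.le.trans hx.2⟩
    refine (abs_comp_second_difference_le hA hM₁ hL hM hd (hf.bound x hx).1 (hf.bound y hy').1
      (hh.bound x hx).1 (hh.bound y hy').1).trans ?_
    -- `|f x - h x|` is bounded by `D` where it multiplies increments of `f`, and by `2N` where it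
    -- multiplies increments of `f - h`, so that every term is linear in the size `D` of the
    -- difference.
    have t1 : |f x - h x| ≤ D := (hD x hx).1
    have t2 : |f x - h x| ≤ 2 * N := (abs_sub _ _).trans (by
      linarith [(hf.bound x hx).1, (hh.bound x hx).1])
    have t3 : |h x - h y| ≤ |f x - f y| + |f x - h x - (f y - h y)| := by
      have : h x - h y = (f x - f y) - (f x - h x - (f y - h y)) := by ring
      rw [this]
      exact abs_sub _ _
    set X := |f x - f y|
    set Z := |f x - h x - (f y - h y)|
    have hX : 0 ≤ X := abs_nonneg _
    have hZ : 0 ≤ Z := abs_nonneg _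
    have hw : 0 ≤ |f x - h x| := abs_nonneg _
    calc M₁ * Z + M * |f x - h x| * (X + |h x - h y|)
        ≤ M₁ * Z + M * |f x - h x| * (X + (X + Z)) := by gcongr
      _ = M₁ * Z + (2 * M * |f x - h x| * X + M * |f x - h x| * Z) := by ring
      _ ≤ M₁ * Z + (2 * M * D * X + M * (2 * N) * Z) := by gcongr
      _ = (M₁ + 2 * M * N) * Z + 2 * M * D * X := by ring

/-! ### Hölder functions vanishing at `0` -/

/-- `v` vanishes at `0` and is `(1-α)`-Hölder on `[0,1]` with constant `B`. -/
def HolderBd (α B : ℝ) (v : ℝ → ℝ) : Prop :=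
  v 0 = 0 ∧ ∀ η ξ : ℝ, 0 ≤ η → η ≤ ξ → ξ ≤ 1 → |v ξ - v η| ≤ B * (ξ - η) ^ (1 - α)

theorem HolderBd.nonneg {α B : ℝ} {v : ℝ → ℝ} (h : HolderBd α B v) : 0 ≤ B := by
  have := (abs_nonneg _).trans (h.2 0 1 le_rfl zero_le_one le_rfl)
  simpa using this

theorem HolderBd.mono {α B B' : ℝ} {v : ℝ → ℝ} (h : HolderBd α B v) (hB : B ≤ B') :
    HolderBd α B' v :=
  ⟨h.1, fun η ξ hη hηξ hξ => (h.2 η ξ hη hηξ hξ).trans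
    (mul_le_mul_of_nonneg_right hB (Real.rpow_nonneg (by linarith) _))⟩

theorem HolderBd.abs_le {α B : ℝ} {v : ℝ → ℝ} (hα' : α < 1) (h : HolderBd α B v) {x : ℝ}
    (hx : x ∈ Icc (0 : ℝ) 1) : |v x| ≤ B := by
  have := h.2 0 x le_rfl hx.1 hx.2
  rw [h.1, sub_zero, sub_zero] at this
  exact this.trans (mul_le_of_le_one_right h.nonneg
    (Real.rpow_le_one hx.1 hx.2 (sub_pos.2 hα').le))

theorem HolderBd.tendsto {α B : ℝ} {v : ℝ → ℝ} (hα' : α < 1) (h : HolderBd α B v) :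
    Tendsto v (𝓝[>] 0) (𝓝 0) := by
  have hc : Tendsto (fun x : ℝ => B * x ^ (1 - α)) (𝓝[>] 0) (𝓝 (B * (0 : ℝ) ^ (1 - α))) :=
    (((Real.continuous_rpow_const (sub_pos.2 hα').le).tendsto 0).mono_left
      nhdsWithin_le_nhds).const_mul B
  rw [Real.zero_rpow (sub_pos.2 hα').ne', mul_zero] at hc
  refine squeeze_zero_norm' ?_ hc
  filter_upwards [Ioc_mem_nhdsGT one_pos] with x hx
  simpa [h.1] using h.2 0 x le_rfl hx.1.le hx.2

/-- Here `α < 1/2` is essential: the kernel is at most `B (x-y)^(-2α)`, which is integrable with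
integral at most `B / (1-2α)`. -/
theorem HolderBd.wBound {α B : ℝ} {v : ℝ → ℝ} (hα : 0 < α) (hα' : α < 1 / 2)
    (h : HolderBd α B v) : WBound α ((1 - 2 * α)⁻¹ * B) v := by
  have hB := h.nonneg
  have h1 : 0 < 1 - 2 * α := by linarith
  have hone : 1 ≤ (1 - 2 * α)⁻¹ := (one_le_inv₀ h1).2 (by linarith)
  intro x hx
  constructor
  · refine (h.abs_le (by linarith) ⟨hx.1.le, hx.2⟩).trans ?_
    nlinarith
  · have hi : IntegrableOn (fun y => B * (x - y) ^ (-(2 * α))) (Ioo 0 x) :=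
      Integrable.const_mul (integrableOn_sub_rpow (by linarith) hx.1.le) _
    calc ∫⁻ y in Ioo 0 x, ENNReal.ofReal (|v x - v y| / (x - y) ^ (α + 1))
        ≤ ∫⁻ y in Ioo 0 x, ENNReal.ofReal (B * (x - y) ^ (-(2 * α))) := by
          refine setLIntegral_mono' measurableSet_Ioo fun y hy => ENNReal.ofReal_le_ofReal ?_
          have h0 : 0 < x - y := sub_pos.2 hy.2
          rw [div_le_iff₀ (Real.rpow_pos_of_pos h0 _), mul_assoc, ← Real.rpow_add h0]
          have e : -(2 * α) + (α + 1) = 1 - α := by ring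
          rw [e]
          exact h.2 y x hy.1.le hy.2.le hx.2
      _ = ENNReal.ofReal (∫ y in Ioo 0 x, B * (x - y) ^ (-(2 * α))) := by
          refine (ofReal_integral_eq_lintegral_ofReal hi ?_).symm
          refine (ae_restrict_iff' measurableSet_Ioo).2 (Eventually.of_forall fun y hy => ?_)
          exact mul_nonneg hB (Real.rpow_nonneg (sub_pos.2 hy.2).le _)
      _ ≤ ENNReal.ofReal ((1 - 2 * α)⁻¹ * B) := by
          refine ENNReal.ofReal_le_ofReal ?_
          rw [integral_const_mul, integral_sub_rpow (by linarith) hx.1.le, sub_zero,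
            neg_add_eq_sub, mul_comm, div_eq_inv_mul]
          refine mul_le_mul_of_nonneg_right ?_ hB
          exact mul_le_of_le_one_right (by positivity) (Real.rpow_le_one hx.1.le hx.2 h1.le)

theorem HolderBd.integral {α t : ℝ} {w : ℝ → ℝ → ℝ} {b : ℝ → ℝ}
    (hw : ∀ s ∈ Ioo 0 t, HolderBd α (b s) (w s)) (hb : IntegrableOn b (Ioo 0 t))
    (hi : ∀ x ∈ Icc (0 : ℝ) 1, IntegrableOn (fun s => w s x) (Ioo 0 t)) :
    HolderBd α (∫ s in Ioo 0 t, b s) fun x => ∫ s in Ioo 0 t, w s x := by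
  refine ⟨?_, fun η ξ hη hηξ hξ => ?_⟩
  · exact setIntegral_eq_zero_of_forall_eq_zero fun s hs => (hw s hs).1
  · rw [← integral_sub (hi ξ ⟨hη.trans hηξ, hξ⟩) (hi η ⟨hη, hηξ.trans hξ⟩), ← integral_mul_const,
      ← Real.norm_eq_abs]
    refine norm_integral_le_of_norm_le (Integrable.mul_const hb _) ?_
    exact (ae_restrict_iff' measurableSet_Ioo).2 (Eventually.of_forall fun s hs =>
      (hw s hs).2 η ξ hη hηξ hξ)

theorem LeftReg.add_holderBd {α K B : ℝ} {φ f : ℝ → ℝ} (hα : 0 < α) (hα' : α < 1 / 2)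
    (hφ : LeftReg α K φ) (hf : Measurable f) (h : HolderBd α B fun x => f x - φ x) :
    LeftReg α (K + (1 - 2 * α)⁻¹ * B) f := by
  have e : f = fun x => φ x + (f x - φ x) := by
    ext x
    ring
  refine ⟨hf, ?_, ?_⟩
  · have h1 := hφ.lim.add (h.tendsto (by linarith))
    have h2 := h.1
    rw [add_zero, ← sub_eq_zero.1 h2] at h1
    exact h1.congr fun x => by ring
  · rw [e]
    exact hφ.bound.add hφ.meas (h.wBound hα hα')

/-! ### Picard iteration -/

/-- The data of the equation after regularization of `g` and `φ` at the endpoints. -/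
structure RegularData (α Λ K M₁ M₂ : ℝ) (A : ℝ → ℝ) (g : ℝ → ℝ → ℝ) (φ : ℝ → ℝ) : Prop where
  pos : 0 < α
  lt_half : α < 1 / 2
  diff : Differentiable ℝ A
  lip_pos : 0 < M₁
  lip : ∀ x y : ℝ, |A x - A y| ≤ M₁ * |x - y|
  bdd : ∀ x : ℝ, |A x| ≤ M₂
  meas : Measurable (Function.uncurry g)
  reg : ∀ s, RightReg α Λ (g s)
  init : LeftReg α K φ

/-- The inner integral in the equation. -/
def drift (α : ℝ) (A : ℝ → ℝ) (g Y : ℝ → ℝ → ℝ) (s x : ℝ) : ℝ :=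
  stieltjesReg α (fun z => A (Y s z)) (g s) x

/-- The right-hand side of the equation. -/
def picardStep (α : ℝ) (A : ℝ → ℝ) (g : ℝ → ℝ → ℝ) (φ : ℝ → ℝ) (Y : ℝ → ℝ → ℝ) (t x : ℝ) : ℝ :=
  φ x + ∫ s in Ioo 0 t, drift α A g Y s x

theorem integrableOn_Ioo_of_continuous {b : ℝ → ℝ} (hb : Continuous b) (a t : ℝ) :
    IntegrableOn b (Ioo a t) :=
  hb.continuousOn.integrableOn_Icc.mono_set Ioo_subset_Icc_self

theorem integral_Ioo_of_hasDerivAt {F b : ℝ → ℝ} {t : ℝ} (ht : 0 ≤ t) (hb : Continuous b)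
    (hF : ∀ s, HasDerivAt F (b s) s) : ∫ s in Ioo 0 t, b s = F t - F 0 := by
  rw [← integral_Ioc_eq_integral_Ioo, ← intervalIntegral.integral_of_le ht]
  exact intervalIntegral.integral_eq_sub_of_hasDerivAt (fun s _ => hF s)
    (hb.intervalIntegrable _ _)

theorem integral_exp_Ioo (Q : ℝ) {t : ℝ} (ht : 0 ≤ t) :
    ∫ s in Ioo 0 t, Q * Real.exp (Q * s) = Real.exp (Q * t) - 1 := by
  have := integral_Ioo_of_hasDerivAt (F := fun s => Real.exp (Q * s))
    (b := fun s => Q * Real.exp (Q * s)) ht (by fun_prop) fun s => by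
      have := ((hasDerivAt_id s).const_mul Q).exp
      simpa [mul_comm] using this
  simpa using this

theorem integral_pow_div_factorial_Ioo (L : ℝ) (n : ℕ) {t : ℝ} (ht : 0 ≤ t) :
    ∫ s in Ioo 0 t, L * ((L * s) ^ n / n.factorial) =
      (L * t) ^ (n + 1) / (n + 1).factorial := by
  have := integral_Ioo_of_hasDerivAt (F := fun s => (L * s) ^ (n + 1) / (n + 1).factorial)
    (b := fun s => L * ((L * s) ^ n / n.factorial)) ht (by fun_prop) fun s => by
      have h := (((hasDerivAt_id s).const_mul L).pow (n + 1)).div_const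
        (((n + 1).factorial : ℕ) : ℝ)
      refine h.congr_deriv ?_
      rw [Nat.factorial_succ]
      push_cast
      simp only [id, mul_one]
      field_simp
  simpa using this

namespace RegularData

variable {α Λ K M₁ M₂ : ℝ} {A : ℝ → ℝ} {g : ℝ → ℝ → ℝ} {φ : ℝ → ℝ}

theorem lt_one (h : RegularData α Λ K M₁ M₂ A g φ) : α < 1 := by linarith [h.lt_half]

theorem bdd_nonneg (h : RegularData α Λ K M₁ M₂ A g φ) : 0 ≤ M₂ :=
  (abs_nonneg _).trans (h.bdd 0)

theorem const_nonneg (h : RegularData α Λ K M₁ M₂ A g φ) : 0 ≤ stieltjesConst α * Λ :=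
  mul_nonneg (stieltjesConst_pos h.pos h.lt_one).le (h.reg 0).nonneg

theorem measurable_drift (h : RegularData α Λ K M₁ M₂ A g φ) {Y : ℝ → ℝ → ℝ}
    (hY : Measurable (Function.uncurry Y)) :
    Measurable fun z : ℝ × ℝ => drift α A g Y z.1 z.2 :=
  measurable_stieltjesReg (f := fun s z => A (Y s z)) (h.diff.continuous.measurable.comp hY) h.meas

theorem measurable_picardStep (h : RegularData α Λ K M₁ M₂ A g φ) {Y : ℝ → ℝ → ℝ}
    (hY : Measurable (Function.uncurry Y)) :
    Measurable (Function.uncurry (picardStep α A g φ Y)) := by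
  have h1 := h.measurable_drift hY
  have h2 := h.init.meas
  refine Measurable.add (by fun_prop) (measurable_integral_Ioo (X := ℝ × ℝ) (a := fun _ => 0)
    (b := fun z => z.1) (F := fun z s => drift α A g Y s z.2) (by fun_prop) (by fun_prop) ?_)
  exact h1.comp (f := fun z : (ℝ × ℝ) × ℝ => (z.2, z.1.2)) (by fun_prop)

theorem drift_holderBd (h : RegularData α Λ K M₁ M₂ A g φ) {Y : ℝ → ℝ → ℝ} {s N : ℝ}
    (hY : LeftReg α N (Y s)) :
    HolderBd α (stieltjesConst α * Λ * (M₂ + M₁ * N)) (drift α A g Y s) :=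
  ⟨stieltjesReg_zero _ _ _, fun _ _ hη hηξ hξ => abs_stieltjesReg_sub_le h.pos h.lt_one
    (hY.comp h.diff.continuous h.lip_pos h.lip h.bdd) (h.reg s) hη hηξ hξ⟩

theorem integrableOn_drift (h : RegularData α Λ K M₁ M₂ A g φ) {Y : ℝ → ℝ → ℝ} {t N x : ℝ}
    (hYm : Measurable (Function.uncurry Y)) (hY : ∀ s ∈ Icc 0 t, LeftReg α N (Y s))
    (hx : x ∈ Icc (0 : ℝ) 1) : IntegrableOn (fun s => drift α A g Y s x) (Icc 0 t) := by
  refine Integrable.of_bound (C := stieltjesConst α * Λ * (M₂ + M₁ * N))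
    ((h.measurable_drift hYm).comp (f := fun s => (s, x)) (by fun_prop)).aestronglyMeasurable ?_
  exact (ae_restrict_iff' measurableSet_Icc).2 (Eventually.of_forall fun s hs =>
    (h.drift_holderBd (hY s hs)).abs_le h.lt_one hx)

/-- The profile `P e^(Qt)` reproduces itself because `∫_0^t Q e^(Qs) ds = e^(Qt) - 1`, and the `-1`
leaves room for the initial datum. The condition `P ≥ 1` absorbs the constant `M₂` into a multiple
of the profile. -/
theorem picardStep_growth (h : RegularData α Λ K M₁ M₂ A g φ) {Y : ℝ → ℝ → ℝ} {T P Q : ℝ}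
    (hYm : Measurable (Function.uncurry Y)) (hP : 1 ≤ P) (hQ0 : 0 ≤ Q)
    (hQ : (1 - 2 * α)⁻¹ * (stieltjesConst α * Λ * (M₂ + M₁)) ≤ Q)
    (hY : ∀ s ∈ Icc 0 T, LeftReg α (P * Real.exp (Q * s)) (Y s)) {t : ℝ} (ht : t ∈ Icc 0 T) :
    HolderBd α ((1 - 2 * α) * (P * (Real.exp (Q * t) - 1)))
      fun x => picardStep α A g φ Y t x - φ x := by
  have h1 : 0 < 1 - 2 * α := by linarith [h.lt_half]
  have hM₂ := h.bdd_nonneg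
  have hM₁ := h.lip_pos
  have hc := h.const_nonneg
  have hQ' : stieltjesConst α * Λ * (M₂ + M₁) ≤ (1 - 2 * α) * Q := by
    rwa [inv_mul_le_iff₀ h1] at hQ
  have hT : ∀ s ∈ Icc 0 t, s ∈ Icc 0 T := fun s hs => ⟨hs.1, hs.2.trans ht.2⟩
  have hT' : ∀ s ∈ Ioo 0 t, s ∈ Icc 0 T := fun s hs => hT s ⟨hs.1.le, hs.2.le⟩
  have key : ∀ s ∈ Ioo 0 t,
      HolderBd α ((1 - 2 * α) * P * (Q * Real.exp (Q * s))) (drift α A g Y s) := by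
    intro s hs
    refine (h.drift_holderBd (hY s (hT' s hs))).mono ?_
    have he : 1 ≤ P * Real.exp (Q * s) := by
      have := Real.one_le_exp (mul_nonneg hQ0 hs.1.le)
      nlinarith
    calc stieltjesConst α * Λ * (M₂ + M₁ * (P * Real.exp (Q * s)))
        ≤ stieltjesConst α * Λ * ((M₂ + M₁) * (P * Real.exp (Q * s))) := by
          refine mul_le_mul_of_nonneg_left ?_ hc
          nlinarith
      _ = stieltjesConst α * Λ * (M₂ + M₁) * (P * Real.exp (Q * s)) := by ring
      _ ≤ (1 - 2 * α) * Q * (P * Real.exp (Q * s)) :=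
          mul_le_mul_of_nonneg_right hQ' (by linarith)
      _ = _ := by ring
  have hN : ∀ s ∈ Icc 0 t, LeftReg α (P * Real.exp (Q * t)) (Y s) := fun s hs => by
    have h2 := hY s (hT s hs)
    refine ⟨h2.meas, h2.lim, h2.bound.mono ?_⟩
    exact mul_le_mul_of_nonneg_left
      (Real.exp_le_exp.2 (mul_le_mul_of_nonneg_left hs.2 hQ0)) (by linarith)
  have := HolderBd.integral key (integrableOn_Ioo_of_continuous (by fun_prop) 0 t)
    (fun x hx => (h.integrableOn_drift hYm hN hx).mono_set Ioo_subset_Icc_self)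
  rw [integral_const_mul, integral_exp_Ioo Q ht.1, mul_assoc] at this
  simpa only [picardStep, add_sub_cancel_left] using this

/-- The Lipschitz constant of the right-hand side on functions of norm at most `N`. -/
def contractConst (α Λ M₁ M N : ℝ) : ℝ :=
  (1 - 2 * α)⁻¹ * (stieltjesConst α * Λ * (M₁ + 4 * M * N))

theorem drift_sub_holderBd (h : RegularData α Λ K M₁ M₂ A g φ) {Y Z : ℝ → ℝ → ℝ}
    {s N M D : ℝ} (hM : 0 ≤ M)
    (hd : ∀ x y : ℝ, |x| ≤ N → |y| ≤ N → |deriv A x - deriv A y| ≤ M * |x - y|)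
    (hY : LeftReg α N (Y s)) (hZ : LeftReg α N (Z s)) (hD : WBound α D fun x => Y s x - Z s x) :
    HolderBd α ((1 - 2 * α) * (contractConst α Λ M₁ M N * D))
      fun x => drift α A g Y s x - drift α A g Z s x := by
  have h1 : 0 < 1 - 2 * α := by linarith [h.lt_half]
  have hYA := hY.comp h.diff.continuous h.lip_pos h.lip h.bdd
  have hZA := hZ.comp h.diff.continuous h.lip_pos h.lip h.bdd
  have hsub := hYA.sub hZA (WBound.comp_sub h.diff h.lip_pos h.lip hM hd hY hZ hD)
  refine ⟨by simp [drift], fun η ξ hη hηξ hξ => ?_⟩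
  have := abs_stieltjesReg_sub_le h.pos h.lt_one hsub (h.reg s) hη hηξ hξ
  rw [stieltjesReg_sub h.pos h.lt_one hYA hZA (h.reg s) hξ,
    stieltjesReg_sub h.pos h.lt_one hYA hZA (h.reg s) (hηξ.trans hξ)] at this
  refine this.trans (le_of_eq ?_)
  rw [contractConst, mul_assoc (1 - 2 * α)⁻¹, mul_inv_cancel_left₀ h1.ne']
  ring

theorem contractConst_nonneg (h : RegularData α Λ K M₁ M₂ A g φ) {M N : ℝ} (hM : 0 ≤ M)
    (hN : 0 ≤ N) : 0 ≤ contractConst α Λ M₁ M N := by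
  have h1 : 0 < 1 - 2 * α := by linarith [h.lt_half]
  have h2 := h.const_nonneg
  have h3 := h.lip_pos
  rw [contractConst]
  positivity

/-- The time profile `D` is left free: powers of `s` give the factorial decay, and a constant
profile gives continuity of the Picard step in the final limit. -/
theorem picardStep_sub_holderBd (h : RegularData α Λ K M₁ M₂ A g φ) {Y Z : ℝ → ℝ → ℝ}
    {T N M : ℝ} {D : ℝ → ℝ} (hDc : Continuous D) (hM : 0 ≤ M)
    (hd : ∀ x y : ℝ, |x| ≤ N → |y| ≤ N → |deriv A x - deriv A y| ≤ M * |x - y|)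
    (hYm : Measurable (Function.uncurry Y)) (hZm : Measurable (Function.uncurry Z))
    (hY : ∀ s ∈ Icc 0 T, LeftReg α N (Y s)) (hZ : ∀ s ∈ Icc 0 T, LeftReg α N (Z s))
    (hD : ∀ s ∈ Icc 0 T, WBound α (D s) fun x => Y s x - Z s x) {t : ℝ} (ht : t ∈ Icc 0 T) :
    HolderBd α ((1 - 2 * α) * ∫ s in Ioo 0 t, contractConst α Λ M₁ M N * D s)
      fun x => picardStep α A g φ Y t x - picardStep α A g φ Z t x := by
  have hT : ∀ s ∈ Icc 0 t, s ∈ Icc 0 T := fun s hs => ⟨hs.1, hs.2.trans ht.2⟩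
  have hT' : ∀ s ∈ Ioo 0 t, s ∈ Icc 0 T := fun s hs => hT s ⟨hs.1.le, hs.2.le⟩
  have iY : ∀ x ∈ Icc (0 : ℝ) 1, IntegrableOn (fun s => drift α A g Y s x) (Ioo 0 t) :=
    fun x hx => (h.integrableOn_drift hYm (fun s hs => hY s (hT s hs)) hx).mono_set
      Ioo_subset_Icc_self
  have iZ : ∀ x ∈ Icc (0 : ℝ) 1, IntegrableOn (fun s => drift α A g Z s x) (Ioo 0 t) :=
    fun x hx => (h.integrableOn_drift hZm (fun s hs => hZ s (hT s hs)) hx).mono_set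
      Ioo_subset_Icc_self
  have := HolderBd.integral (fun s hs => h.drift_sub_holderBd hM hd (hY s (hT' s hs))
    (hZ s (hT' s hs)) (hD s (hT' s hs))) (integrableOn_Ioo_of_continuous (by fun_prop) 0 t)
    (fun x hx => (iY x hx).sub (iZ x hx))
  rw [integral_const_mul] at this
  have e : ∀ x ∈ Icc (0 : ℝ) 1, picardStep α A g φ Y t x - picardStep α A g φ Z t x =
      ∫ s in Ioo 0 t, (drift α A g Y s x - drift α A g Z s x) := fun x hx => by
    rw [integral_sub (iY x hx) (iZ x hx), picardStep, picardStep]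
    ring
  refine ⟨by simpa only [e 0 ⟨le_rfl, zero_le_one⟩] using this.1, fun η ξ hη hηξ hξ => ?_⟩
  beta_reduce
  rw [e η ⟨hη, hηξ.trans hξ⟩, e ξ ⟨hη.trans hηξ, hξ⟩]
  exact this.2 η ξ hη hηξ hξ

theorem picardStep_sub_holderBd_pow (h : RegularData α Λ K M₁ M₂ A g φ) {Y Z : ℝ → ℝ → ℝ}
    {T N M D : ℝ} (n : ℕ) (hM : 0 ≤ M)
    (hd : ∀ x y : ℝ, |x| ≤ N → |y| ≤ N → |deriv A x - deriv A y| ≤ M * |x - y|)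
    (hYm : Measurable (Function.uncurry Y)) (hZm : Measurable (Function.uncurry Z))
    (hY : ∀ s ∈ Icc 0 T, LeftReg α N (Y s)) (hZ : ∀ s ∈ Icc 0 T, LeftReg α N (Z s))
    (hD : ∀ s ∈ Icc 0 T, WBound α (D * ((contractConst α Λ M₁ M N * s) ^ n / n.factorial))
      fun x => Y s x - Z s x) {t : ℝ} (ht : t ∈ Icc 0 T) :
    HolderBd α ((1 - 2 * α) *
      (D * ((contractConst α Λ M₁ M N * t) ^ (n + 1) / (n + 1).factorial)))
      fun x => picardStep α A g φ Y t x - picardStep α A g φ Z t x := by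
  have := h.picardStep_sub_holderBd (by fun_prop) hM hd hYm hZm hY hZ hD ht
  have e : ∫ s in Ioo 0 t, contractConst α Λ M₁ M N *
      (D * ((contractConst α Λ M₁ M N * s) ^ n / n.factorial)) =
      D * ((contractConst α Λ M₁ M N * t) ^ (n + 1) / (n + 1).factorial) := by
    rw [← integral_pow_div_factorial_Ioo _ n ht.1, ← integral_const_mul]
    congr 1
    ext s
    ring
  rwa [e] at this

/-- Hölder constants are carried with a factor `1 - 2α` so that it cancels the embedding constant
and iteration adds no new factors. -/
theorem wBound_of_holderBd (h : RegularData α Λ K M₁ M₂ A g φ) {B : ℝ} {v : ℝ → ℝ}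
    (hv : HolderBd α ((1 - 2 * α) * B) v) : WBound α B v := by
  have h1 : 0 < 1 - 2 * α := by linarith [h.lt_half]
  have := hv.wBound h.pos h.lt_half
  rwa [inv_mul_cancel_left₀ h1.ne'] at this

/-- Two fixed points of the Picard step agree. -/
theorem eq_of_isFixed (h : RegularData α Λ K M₁ M₂ A g φ) {Y Z : ℝ → ℝ → ℝ}
    {T N M : ℝ} (hM : 0 ≤ M)
    (hd : ∀ x y : ℝ, |x| ≤ N → |y| ≤ N → |deriv A x - deriv A y| ≤ M * |x - y|)
    (hYm : Measurable (Function.uncurry Y)) (hZm : Measurable (Function.uncurry Z))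
    (hY : ∀ s ∈ Icc 0 T, LeftReg α N (Y s)) (hZ : ∀ s ∈ Icc 0 T, LeftReg α N (Z s))
    (hYf : ∀ t ∈ Icc 0 T, ∀ x ∈ Ioc (0 : ℝ) 1, Y t x = picardStep α A g φ Y t x)
    (hZf : ∀ t ∈ Icc 0 T, ∀ x ∈ Ioc (0 : ℝ) 1, Z t x = picardStep α A g φ Z t x)
    {t x : ℝ} (ht : t ∈ Icc 0 T) (hx : x ∈ Ioc (0 : ℝ) 1) : Y t x = Z t x := by
  -- The crude bound `N + N` on the difference improves by one power of `L s` and one factorial at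
  -- each use of the equation, so it tends to `0`.
  have key : ∀ n : ℕ, ∀ s ∈ Icc 0 T,
      WBound α ((N + N) * ((contractConst α Λ M₁ M N * s) ^ n / n.factorial))
        fun x => Y s x - Z s x := by
    intro n
    induction n with
    | zero =>
      intro s hs
      simpa using (hY s hs).bound.sub (hY s hs).meas (hZ s hs).bound
    | succ n ih =>
      intro s hs
      refine (h.wBound_of_holderBd
        (h.picardStep_sub_holderBd_pow n hM hd hYm hZm hY hZ ih hs)).congr fun x hx => ?_
      simp only
      rw [← hYf s hs x hx, ← hZf s hs x hx]
  have hlim : Tendsto (fun n : ℕ =>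
      (N + N) * ((contractConst α Λ M₁ M N * t) ^ n / n.factorial)) atTop (𝓝 ((N + N) * 0)) :=
    (FloorSemiring.tendsto_pow_div_factorial_atTop _).const_mul _
  rw [mul_zero] at hlim
  have := ge_of_tendsto' hlim fun n => (key n t ht x hx).1
  exact sub_eq_zero.1 (abs_nonpos_iff.1 this)

end RegularData

theorem LeftReg.mono {α K K' : ℝ} {f : ℝ → ℝ} (h : LeftReg α K f) (hK : K ≤ K') :
    LeftReg α K' f :=
  ⟨h.meas, h.lim, h.bound.mono hK⟩

/-- The Picard iterates. -/
def picardSeq (α : ℝ) (A : ℝ → ℝ) (g : ℝ → ℝ → ℝ) (φ : ℝ → ℝ) : ℕ → ℝ → ℝ → ℝ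
  | 0 => fun _ => φ
  | n + 1 => picardStep α A g φ (picardSeq α A g φ n)

namespace RegularData

variable {α Λ K M₁ M₂ : ℝ} {A : ℝ → ℝ} {g : ℝ → ℝ → ℝ} {φ : ℝ → ℝ}

theorem measurable_picardSeq (h : RegularData α Λ K M₁ M₂ A g φ) (n : ℕ) :
    Measurable (Function.uncurry (picardSeq α A g φ n)) := by
  induction n with
  | zero => exact h.init.meas.comp measurable_snd
  | succ n ih => exact h.measurable_picardStep ih

theorem picardSeq_growth (h : RegularData α Λ K M₁ M₂ A g φ) {T P Q : ℝ} (hP : 1 ≤ P)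
    (hPK : K ≤ P) (hQ0 : 0 ≤ Q)
    (hQ : (1 - 2 * α)⁻¹ * (stieltjesConst α * Λ * (M₂ + M₁)) ≤ Q) (n : ℕ) :
    ∀ t ∈ Icc 0 T, LeftReg α (P * Real.exp (Q * t)) (picardSeq α A g φ n t) ∧
      HolderBd α ((1 - 2 * α) * (P * (Real.exp (Q * t) - 1)))
        fun x => picardSeq α A g φ n t x - φ x := by
  have h1 : 0 < 1 - 2 * α := by linarith [h.lt_half]
  induction n with
  | zero =>
    intro t ht
    have he := Real.one_le_exp (mul_nonneg hQ0 ht.1)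
    refine ⟨h.init.mono (by nlinarith), by simp [picardSeq], fun η ξ hη hηξ hξ => ?_⟩
    simp only [picardSeq, sub_self, abs_zero]
    have : 0 ≤ Real.exp (Q * t) - 1 := by linarith
    have : 0 ≤ (ξ - η) ^ (1 - α) := Real.rpow_nonneg (by linarith) _
    positivity
  | succ n ih =>
    intro t ht
    have hh := h.picardStep_growth (h.measurable_picardSeq n) hP hQ0 hQ
      (fun s hs => (ih s hs).1) ht
    refine ⟨?_, hh⟩
    refine (h.init.add_holderBd h.pos h.lt_half ((h.measurable_picardSeq (n + 1)).comp
      (f := fun x => (t, x)) (by fun_prop)) hh).mono ?_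
    rw [inv_mul_cancel_left₀ h1.ne']
    linarith

theorem picardSeq_sub_holderBd (h : RegularData α Λ K M₁ M₂ A g φ) {T N M E : ℝ} (hM : 0 ≤ M)
    (hd : ∀ x y : ℝ, |x| ≤ N → |y| ≤ N → |deriv A x - deriv A y| ≤ M * |x - y|)
    (hN : ∀ n, ∀ t ∈ Icc 0 T, LeftReg α N (picardSeq α A g φ n t))
    (hE : ∀ t ∈ Icc 0 T, HolderBd α ((1 - 2 * α) * E) fun x => picardSeq α A g φ 1 t x - φ x)
    (n : ℕ) : ∀ t ∈ Icc 0 T,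
      HolderBd α ((1 - 2 * α) * (E * ((contractConst α Λ M₁ M N * t) ^ n / n.factorial)))
        fun x => picardSeq α A g φ (n + 1) t x - picardSeq α A g φ n t x := by
  induction n with
  | zero =>
    intro t ht
    simpa [picardSeq] using hE t ht
  | succ n ih =>
    intro t ht
    exact h.picardStep_sub_holderBd_pow n hM hd (h.measurable_picardSeq (n + 1))
      (h.measurable_picardSeq n) (hN (n + 1)) (hN n)
      (fun s hs => h.wBound_of_holderBd (ih s hs)) ht

/-- Successive iterates differ by at most `d n` in Hölder norm, uniformly on `[0,T]`, and `∑ d n` is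
an exponential series. The limit inherits the uniform bounds and is a fixed point by continuity of
the Picard step. -/
theorem exists_fixed (h : RegularData α Λ K M₁ M₂ A g φ) (T : ℝ)
    (hA4 : ∀ N : ℝ, ∃ M > 0, ∀ x y : ℝ, |x| ≤ N → |y| ≤ N →
      |deriv A x - deriv A y| ≤ M * |x - y|) :
    ∃ (Y : ℝ → ℝ → ℝ) (N : ℝ), Measurable (Function.uncurry Y) ∧
      (∀ t ∈ Icc 0 T, LeftReg α N (Y t)) ∧
      ∀ t ∈ Icc 0 T, ∀ x ∈ Icc (0 : ℝ) 1, Y t x = picardStep α A g φ Y t x := by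
  have h1 : 0 < 1 - 2 * α := by linarith [h.lt_half]
  have hK := h.init.bound.nonneg
  have hM₁ := h.lip_pos
  have hM₂ := h.bdd_nonneg
  have hc := h.const_nonneg
  set Q := (1 - 2 * α)⁻¹ * (stieltjesConst α * Λ * (M₂ + M₁)) with hQ
  have hQ0 : 0 ≤ Q := by positivity
  set E := (K + 1) * Real.exp (Q * T) with hE
  have hE0 : 0 ≤ E := by positivity
  set y := picardSeq α A g φ with hy
  have hm : ∀ n, Measurable (Function.uncurry (y n)) := h.measurable_picardSeq
  have hgr := h.picardSeq_growth (T := T) (P := K + 1) (by linarith) (by linarith) hQ0 le_rfl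
  have hexp : ∀ t ∈ Icc 0 T, (K + 1) * Real.exp (Q * t) ≤ E := fun t ht =>
    mul_le_mul_of_nonneg_left (Real.exp_le_exp.2 (mul_le_mul_of_nonneg_left ht.2 hQ0))
      (by linarith)
  have hN : ∀ n, ∀ t ∈ Icc 0 T, LeftReg α (K + E) (y n t) := fun n t ht =>
    (hgr n t ht).1.mono ((hexp t ht).trans (by linarith))
  have hV : ∀ n, ∀ t ∈ Icc 0 T, HolderBd α ((1 - 2 * α) * E) fun x => y n t x - φ x :=
    fun n t ht => (hgr n t ht).2.mono (mul_le_mul_of_nonneg_left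
      (by linarith [hexp t ht]) h1.le)
  -- `K + E` bounds every iterate and the limit, so a single local Lipschitz constant of `A'` serves
  -- throughout.
  obtain ⟨M, hM, hd⟩ := hA4 (K + E)
  set L := contractConst α Λ M₁ M (K + E) with hL
  have hL0 : 0 ≤ L := h.contractConst_nonneg hM.le (by linarith)
  let d : ℕ → ℝ := fun n => (1 - 2 * α) * (E * ((L * T) ^ n / n.factorial))
  have hds : Summable d := ((Real.summable_pow_div_factorial (L * T)).mul_left E).mul_left _
  have hdiff : ∀ n, ∀ t ∈ Icc 0 T, HolderBd α (d n) fun x => y (n + 1) t x - y n t x := by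
    intro n t ht
    refine (h.picardSeq_sub_holderBd hM.le hd hN (hV 1) n t ht).mono ?_
    have := mul_nonneg hL0 ht.1
    have := mul_le_mul_of_nonneg_left ht.2 hL0
    simp only [d]
    gcongr
  set S : Set (ℝ × ℝ) := Icc 0 T ×ˢ Icc (0 : ℝ) 1
  -- The indicator makes the sequence converge at every point of the plane, so the limit is globally
  -- measurable.
  have hex : ∀ z : ℝ × ℝ, ∃ l, Tendsto (fun n => S.indicator (Function.uncurry (y n)) z) atTop
      (𝓝 l) := by
    intro z
    by_cases hz : z ∈ S
    · simp only [indicator_of_mem hz]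
      refine cauchySeq_tendsto_of_complete (cauchySeq_of_dist_le_of_summable d (fun n => ?_) hds)
      rw [dist_comm]
      exact (hdiff n z.1 hz.1).abs_le h.lt_one hz.2
    · simp only [indicator_of_notMem hz]
      exact ⟨0, tendsto_const_nhds⟩
  choose l hl using hex
  have hlm : Measurable l := by
    refine measurable_of_tendsto_metrizable (f := fun n => S.indicator (Function.uncurry (y n)))
      (fun n => (hm n).indicator (measurableSet_Icc.prod measurableSet_Icc)) ?_
    rw [tendsto_pi_nhds]
    exact hl
  have hlim : ∀ t ∈ Icc 0 T, ∀ x ∈ Icc (0 : ℝ) 1,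
      Tendsto (fun n => y n t x) atTop (𝓝 (l (t, x))) := by
    intro t ht x hx
    have := hl (t, x)
    have hz : (t, x) ∈ S := ⟨ht, hx⟩
    simp only [indicator_of_mem hz] at this
    exact this
  have hl0 : ∀ t ∈ Icc 0 T, l (t, 0) = φ 0 := by
    intro t ht
    refine tendsto_nhds_unique (hlim t ht 0 ⟨le_rfl, zero_le_one⟩) ?_
    exact tendsto_const_nhds.congr fun n => (sub_eq_zero.1 (hV n t ht).1).symm
  have hYV : ∀ t ∈ Icc 0 T, HolderBd α ((1 - 2 * α) * E) fun x => l (t, x) - φ x := by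
    intro t ht
    refine ⟨sub_eq_zero.2 (hl0 t ht), fun η ξ hη hηξ hξ => ?_⟩
    exact le_of_tendsto (((hlim t ht ξ ⟨hη.trans hηξ, hξ⟩).sub_const _).sub
      ((hlim t ht η ⟨hη, hηξ.trans hξ⟩).sub_const _)).abs
      (Eventually.of_forall fun n => (hV n t ht).2 η ξ hη hηξ hξ)
  have hYN : ∀ t ∈ Icc 0 T, LeftReg α (K + E) fun x => l (t, x) := by
    intro t ht
    have := h.init.add_holderBd h.pos h.lt_half
      (hlm.comp (f := fun x => (t, x)) (by fun_prop)) (hYV t ht)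
    rwa [inv_mul_cancel_left₀ h1.ne'] at this
  let r : ℕ → ℝ := fun n => ∑' m, d (n + m)
  have hr : Tendsto r atTop (𝓝 0) := by
    have := tendsto_sum_nat_add d
    refine this.congr fun n => ?_
    simp only [r, add_comm]
  have htail : ∀ n, ∀ t ∈ Icc 0 T, HolderBd α (r n) fun x => l (t, x) - y n t x := by
    intro n t ht
    refine ⟨sub_eq_zero.2 ((hl0 t ht).trans (sub_eq_zero.1 (hV n t ht).1).symm),
      fun η ξ hη hηξ hξ => ?_⟩
    -- The telescoping bound is applied to spatial increments, so the tail `r n` controls the Hölder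
    -- seminorm and not just the values.
    have := dist_le_tsum_of_dist_le_of_tendsto (f := fun m => y m t ξ - y m t η)
      (fun m => d m * (ξ - η) ^ (1 - α)) (fun m => ?_) (hds.mul_right _)
      ((hlim t ht ξ ⟨hη.trans hηξ, hξ⟩).sub (hlim t ht η ⟨hη, hηξ.trans hξ⟩)) n
    · rw [tsum_mul_right, dist_comm, Real.dist_eq] at this
      refine le_of_eq_of_le ?_ this
      congr 1
      ring
    · have h2 := (hdiff m t ht).2 η ξ hη hηξ hξ
      rw [dist_comm, Real.dist_eq]
      refine le_of_eq_of_le ?_ h2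
      congr 1
      simp only [Nat.succ_eq_add_one]
      ring
  refine ⟨fun t x => l (t, x), K + E, hlm, hYN, fun t ht x hx => ?_⟩
  -- The iterate `y (n+1)`, the Picard step of `y n`, is inserted between the two terms; both
  -- resulting errors are governed by tails of the series.
  have hbound : ∀ n, |l (t, x) - picardStep α A g φ (fun t x => l (t, x)) t x| ≤
      r (n + 1) + (1 - 2 * α) * ∫ _ in Ioo 0 t, L * ((1 - 2 * α)⁻¹ * r n) := by
    intro n
    have t1 := (htail (n + 1) t ht).abs_le h.lt_one hx
    have t2 := (h.picardStep_sub_holderBd (Y := fun t x => l (t, x))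
      (D := fun _ => (1 - 2 * α)⁻¹ * r n) continuous_const
      hM.le hd hlm (hm n) hYN (hN n)
      (fun s hs => (htail n s hs).wBound h.pos h.lt_half) ht).abs_le h.lt_one hx
    rw [abs_sub_comm] at t2
    exact (abs_sub_le _ _ _).trans (add_le_add t1 t2)
  have hlim0 : Tendsto (fun n => r (n + 1) +
      (1 - 2 * α) * ∫ _ in Ioo 0 t, L * ((1 - 2 * α)⁻¹ * r n)) atTop (𝓝 0) := by
    have h2 : Tendsto (fun n => r (n + 1) + (1 - 2 * α) * (t * (L * ((1 - 2 * α)⁻¹ * r n))))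
        atTop (𝓝 (0 + (1 - 2 * α) * (t * (L * ((1 - 2 * α)⁻¹ * 0))))) :=
      ((tendsto_add_atTop_iff_nat 1).2 hr).add
        ((((hr.const_mul _).const_mul _).const_mul _).const_mul _)
    simp only [mul_zero, add_zero] at h2
    refine h2.congr fun n => ?_
    rw [setIntegral_const, Real.volume_real_Ioo_of_le ht.1, sub_zero, smul_eq_mul]
  have := ge_of_tendsto' hlim0 hbound
  exact sub_eq_zero.1 (abs_nonpos_iff.1 this)

end RegularData

end FracVortex

end

/-! ### Return from the regularized data to the original equation -/

theorem theorem5p8 (H α T : ℝ) (hH : 1 / 2 < H) (hH' : H < 1)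
    (hα : 1 - H < α) (hα' : α < 1 / 2) (hT : 0 < T)
    (g : ℝ → ℝ → ℝ) (hg : FracVortex.MemCW0 α T g)
    (φ : ℝ → ℝ) (hφ : FracVortex.MemW α φ)
    (A : ℝ → ℝ) (hA1 : Differentiable ℝ A)
    (hA2 : ∃ M₁ > 0, ∀ x y : ℝ, |A x - A y| ≤ M₁ * |x - y|)
    (hA3 : ∃ M₂ > 0, ∀ x : ℝ, |A x| ≤ M₂)
    (hA4 : ∀ N : ℝ, ∃ M > 0, ∀ x y : ℝ, |x| ≤ N → |y| ≤ N →
      |deriv A x - deriv A y| ≤ M * |x - y|) :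
    ∃ Y : ℝ → ℝ → ℝ, FracVortex.MemCW α T Y ∧ FracVortex.IsSolution α T A g φ Y ∧
      ∀ Z : ℝ → ℝ → ℝ, FracVortex.MemCW α T Z → FracVortex.IsSolution α T A g φ Z →
        ∀ t ∈ Set.Icc 0 T, ∀ ξ ∈ Set.Icc (0 : ℝ) 1, Z t ξ = Y t ξ := by
  have hα0 : 0 < α := by linarith
  have hα1 : α < 1 := by linarith
  obtain ⟨M₁, hM₁, hL⟩ := hA2
  obtain ⟨M₂, -, hB⟩ := hA3
  obtain ⟨g', Λ, hgm, hgg, hgr⟩ := hg.exists_rightReg hα1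
  obtain ⟨φ', K, hφφ, hφr⟩ := hφ.exists_leftReg hα0
  have hR : FracVortex.RegularData α Λ K M₁ M₂ A g' φ' :=
    ⟨hα0, hα', hA1, hM₁, hL, hB, hgm, hgr, hφr⟩
  obtain ⟨V, N, hVm, hVr, hVf⟩ := hR.exists_fixed T hA4
  have hcomp : ∀ {W : ℝ → ℝ}, ∀ {N : ℝ}, FracVortex.LeftReg α N W →
      FracVortex.LeftReg α (M₂ + M₁ * N) fun x => A (W x) := fun hW =>
    hW.comp hA1.continuous hM₁ hL hB
  -- the inner integrals of `Z` are those of a regularization `W` of `Z`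
  have hst : ∀ {Z W : ℝ → ℝ → ℝ} {N : ℝ}, (∀ s ∈ Icc 0 T, FracVortex.LeftReg α N (W s)) →
      (∀ s ∈ Icc 0 T, ∀ x ∈ Ioc (0 : ℝ) 1, W s x = Z s x) → ∀ s ∈ Icc 0 T, ∀ ξ ∈ Icc (0 : ℝ) 1,
      FracVortex.stieltjes α (fun η => A (Z s η)) (g s) 0 ξ =
        FracVortex.drift α A g' W s ξ := by
    intro Z W N hW hWZ s hs ξ hξ
    refine FracVortex.stieltjes_eq_stieltjesReg hα1 (hcomp (hW s hs)) (hgr s) hξ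
      (fun x hx => ?_) fun x hx => (hgg s hs x ⟨hx.1, hx.2.trans_le hξ.2⟩).symm
    simp only [hWZ s hs x ⟨hx.1, hx.2.le.trans hξ.2⟩]
  have hint : ∀ {Z W : ℝ → ℝ → ℝ} {N : ℝ}, (∀ s ∈ Icc 0 T, FracVortex.LeftReg α N (W s)) →
      (∀ s ∈ Icc 0 T, ∀ x ∈ Ioc (0 : ℝ) 1, W s x = Z s x) → ∀ t ∈ Icc 0 T, ∀ ξ ∈ Icc (0 : ℝ) 1,
      ∫ s in (0 : ℝ)..t, FracVortex.stieltjes α (fun η => A (Z s η)) (g s) 0 ξ =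
        ∫ s in Ioo 0 t, FracVortex.drift α A g' W s ξ := by
    intro Z W N hW hWZ t ht ξ hξ
    rw [intervalIntegral.integral_of_le ht.1, integral_Ioc_eq_integral_Ioo]
    exact setIntegral_congr_fun measurableSet_Ioo fun s hs =>
      hst hW hWZ s ⟨hs.1.le, hs.2.le.trans ht.2⟩ ξ hξ
  -- At `ξ = 0` the inner integral is `0`, so the equation forces `Y t 0 = φ 0`, whereas `V t 0` is
  -- the right limit of `φ` at `0`, which may differ.
  set Y : ℝ → ℝ → ℝ := fun t x => if x = 0 then φ 0 else V t x with hYdef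
  have hYV : ∀ s ∈ Icc 0 T, ∀ x ∈ Ioc (0 : ℝ) 1, V s x = Y s x := fun s _ x hx => by
    simp only [hYdef, if_neg hx.1.ne']
  have hYm : Measurable (fun p : ℝ × ℝ => Y p.1 p.2) :=
    Measurable.ite (measurableSet_eq_fun measurable_snd measurable_const) measurable_const hVm
  refine ⟨Y, ⟨hYm.comp measurable_subtype_coe, ?_⟩, ⟨?_, ?_, ?_⟩, ?_⟩
  · refine lt_of_le_of_lt (iSup₂_le fun t ht => ?_)
      (ENNReal.ofReal_lt_top (r := |φ 0| + 2 * N))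
    have := ((hVr t ht).bound.congr fun x hx => (hYV t ht x hx).symm).normW_le
    simpa [hYdef] using this
  · intro s hs ξ hξ
    refine FracVortex.stieltjesIntegrable_of_reg hα0 hα1 (hcomp (hVr s hs)) (hgr s) hξ
      (fun x hx => ?_) fun x hx => (hgg s hs x ⟨hx.1, hx.2.trans_le hξ.2⟩).symm
    simp only [hYV s hs x ⟨hx.1, hx.2.le.trans hξ.2⟩]
  · intro ξ hξ
    exact (hR.integrableOn_drift hVm hVr hξ).congr_fun
      (fun s hs => (hst hVr hYV s hs ξ hξ).symm) measurableSet_Icc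
  · intro t ht ξ hξ
    rw [hint hVr hYV t ht ξ hξ]
    rcases hξ.1.eq_or_lt with rfl | h0
    · simp [hYdef, FracVortex.drift]
    · rw [← hYV t ht ξ ⟨h0, hξ.2⟩, hVf t ht ξ hξ, ← hφφ ξ ⟨h0, hξ.2⟩]
      rfl
  · intro Z hZ hZs t ht ξ hξ
    rcases hξ.1.eq_or_lt with rfl | h0
    · rw [hZs.eqn t ht 0 hξ]
      simp [hYdef, FracVortex.stieltjes]
    -- The regularization `W` of `Z` satisfies the regularized equation on `(0,1]` only; this is
    -- enough, since the uniqueness argument never uses `x = 0`.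
    · obtain ⟨W, N', hWm, hWZ, hWr⟩ := hZ.exists_leftReg hα0
      have hWr' : ∀ s ∈ Icc 0 T, FracVortex.LeftReg α N' (W s) := fun s _ => hWr s
      obtain ⟨M, hM, hd⟩ := hA4 (max N N')
      rw [← hWZ t ht ξ ⟨h0, hξ.2⟩, ← hYV t ht ξ ⟨h0, hξ.2⟩]
      refine hR.eq_of_isFixed hM.le hd hWm hVm
        (fun s hs => (hWr' s hs).mono (le_max_right _ _))
        (fun s hs => (hVr s hs).mono (le_max_left _ _)) (fun s hs x hx => ?_)
        (fun s hs x hx => hVf s hs x ⟨hx.1.le, hx.2⟩) ht ⟨h0, hξ.2⟩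
      rw [hWZ s hs x hx, hZs.eqn s hs x ⟨hx.1.le, hx.2⟩,
        hint hWr' hWZ s hs x ⟨hx.1.le, hx.2⟩, ← hφφ x hx]
      rfl
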